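/- **Setting.** Let $m\in\{2,3,4,6\}$, $\omega=e^{2\pi i/m}$, and let $\Lambda\subset\mathbb C$ be a lattice with $\omega\Lambda=\Lambda$. Let $\mathcal E=\mathbb C/\Lambda$, on which the cyclic group $\mathbb Z_m=\{1,s,\dots,s^{m-1}\}$ acts by $s:q\mapsto\omega q$. To each $x\in\mathcal E$ and $l=1,\dots,m-1$ assign $c_l(x)\in\mathbb C$ with $c_l(x)=0$ unless $s^l(x)=x$, and $c_l(\omega x)=c_l(x)$. Put $\mu_j(x)=\sum_{l=1}^{m-1}\omega^{-jl}c_l(x)$ and $\mu_j=\mu_j(0)$; let $\mathcal S\subset\mathcal E$ be the finite set of nonzero points with a nontrivial stabiliser in $\mathbb Z_m$, and put $\bar\mu_j=\sum_{x\in\mathcal S}\mu_j(x)$. *Quantum case.* Let $\hbar\in\mathbb C$, $\hbar\neq0$, let $\hat p=\hbar\frac{d}{dq}$, and let $\mathcal D_{\mathcal E}$ be the ring of differential operators in $q$ with coefficients in the field $\mathbb C(\mathcal E)$ of elliptic functions. In the crossed product $\mathcal D_{\mathcal E}\rtimes\mathbb Z_m$ one has $sq=\omega qs$ and $s\frac{d}{dq}=\omega^{-1}\frac{d}{dq}s$.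 For a $\mathbb Z_m$-invariant open chart $U\subset\mathcal E$ let $\mathcal O_U\subset\mathbb C(\mathcal E)$ be the ring of elliptic functions regular on $U$, and let $H_{\hbar,c}(U)\subset\mathcal D_{\mathcal E}\rtimes\mathbb Z_m$ be the subalgebra generated by $\mathcal O_U\rtimes\mathbb Z_m$ and an element $$y=\hat p-\sum_{l=1}^{m-1}b_l(q)s^l,\qquad b_l\in\mathbb C(\mathcal E),$$ where, on $U$, $b_l$ has at most simple poles, with residue $c_l(x)$ at each $x\in U$ (charts are those $U$ for which such a $y$ exists; the choice of $y$ does not matter). Let $e=\frac1m\sum_{j=0}^{m-1}s^j$, let $\theta(\sum_l a_ls^l)=\sum_l a_l$ (the action on $\mathbb Z_m$-invariant functions), and let $B_{\hbar,c}(U)=\theta(e\,H_{\hbar,c}(U)\,e)\subset\mathcal D_{\mathcal E}^{\mathbb Z_m}$. This defines the sheaf $B_{\hbar,c}(\mathcal E)$ of spherical elliptic Cherednik algebras; a global section of it is an operator that near every point of $\mathcal E$ lies in $B_{\hbar,c}(U)$ for some chart $U$ containing that point. *Classical case.* $B_{0,c}(\mathcal E)$ is defined in the same way, with $\mathcal D_{\mathcal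 E}$ replaced by the commutative ring $\mathbb C(\mathcal E)[p]$ with $sp=\omega^{-1}ps$, and $\hat p$ replaced by $p$. *Elements.* With $\wp$ the Weierstrass function of $\Lambda$, let $$f(q,z)=\frac12\,\frac{\wp'(q)+\wp'(z)}{\wp(q)-\wp(z)},\qquad f_k(q)=\sum_{x\in\mathcal S}\mu_k(x)f(q,x),$$ $$w_j=(\hat p-f_{j-1})\cdots(\hat p-f_0),\qquad v^{(i)}_j=\wp^{(i)}(q)\,(\hat p-f_{j-1})\cdots(\hat p-f_0),$$ and let the same formulas with $p$ in place of $\hat p$ define the classical $w_j$, $v_j^{(i)}$. **Proposition.** (1) For every $\hbar\ne0$ there are unique constants $\alpha_2,\dots,\alpha_m\in\mathbb C$ such that $$(\hat p-\mu_{m-1}q^{-1})\cdots(\hat p-\mu_0q^{-1})=(\hat p+\bar\mu_{m-1}q^{-1})\cdots(\hat p+\bar\mu_0q^{-1})+\sum_{i=2}^m(-1)^i(i-1)!\,\alpha_i\,q^{-i}(\hat p+\bar\mu_{m-i-1}q^{-1})\cdots(\hat p+\bar\mu_0q^{-1}),$$ and, with these constants, the algebra of global sections of $B_{\hbar,c}(\mathcal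 E)$ is generated, as a $\mathbb C$-algebra, by the single element $$\hat h=w_m+\alpha_2v^{(0)}_{m-2}+\alpha_3v^{(1)}_{m-3}+\dots+\alpha_mv^{(m-2)}_0 .$$ (2) Likewise, there are unique constants $\alpha_2,\dots,\alpha_m\in\mathbb C$ satisfying the relation above with $\hat p$ replaced by $p$, and, with these constants, the algebra of global sections of $B_{0,c}(\mathcal E)$ is generated, as a $\mathbb C$-algebra, by $h=w_m+\sum_{i=2}^m\alpha_iv^{(i-2)}_{m-i}$, formed with the classical $w_m$, $v^{(i)}_j$. -/

import Mathlib

open Filter Topology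

namespace EllipticCherednik

noncomputable section

/-! ### Meromorphic functions on `ℂ`

Two meromorphic functions are identified when they agree off a discrete set, so that the values
at the poles do not matter. -/

/-- Functions `ℂ → ℂ` that are meromorphic on the whole plane. -/
def merFun : Subalgebra ℂ (ℂ → ℂ) where
  carrier := {f | ∀ x, MeromorphicAt f x}
  mul_mem' hf hg x := (hf x).mul (hg x)
  add_mem' hf hg x := (hf x).add (hg x)
  algebraMap_mem' r x := MeromorphicAt.const r x

/-- The meromorphic functions that vanish off a discrete set. -/
def merNull : Ideal merFun where
  carrier := {f | ∀ x, ∀ᶠ z in 𝓝[≠] x, f.1 z = 0}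
  zero_mem' x := Eventually.of_forall fun _ => rfl
  add_mem' {f g} hf hg x := by
    filter_upwards [hf x, hg x] with z h1 h2
    change f.1 z + g.1 z = 0
    rw [h1, h2, add_zero]
  smul_mem' f g hg x := by
    filter_upwards [hg x] with z h
    change f.1 z * g.1 z = 0
    rw [h, mul_zero]

/-- The ring (in fact the field) of meromorphic functions of `q ∈ ℂ`. -/
def Mer : Type := merFun ⧸ merNull

instance : CommRing Mer := inferInstanceAs (CommRing (merFun ⧸ merNull))

instance : Algebra ℂ Mer := inferInstanceAs (Algebra ℂ (merFun ⧸ merNull))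

/-- The quotient map from meromorphic functions. -/
def mkMer : merFun →ₐ[ℂ] Mer := Ideal.Quotient.mkₐ ℂ merNull

theorem mkMer_surjective : Function.Surjective mkMer := Ideal.Quotient.mk_surjective

/-- The element of `Mer` given by a meromorphic function. -/
def toMer (f : ℂ → ℂ) (hf : ∀ x, MeromorphicAt f x) : Mer :=
  mkMer ⟨f, hf⟩

/-- `Represents F f`: the function `F` is a representative of `f ∈ Mer`. -/
def Represents (F : ℂ → ℂ) (f : Mer) : Prop := ∃ hF, toMer F hF = f

theorem toMer_eq_iff (f g : merFun) :
    mkMer f = mkMer g ↔ ∀ x, f.1 =ᶠ[𝓝[≠] x] g.1 := by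
  refine (Ideal.Quotient.eq (I := merNull)).trans ?_
  refine forall_congr' fun x => eventually_congr (Eventually.of_forall fun z => ?_)
  change f.1 z - g.1 z = 0 ↔ _
  exact sub_eq_zero

theorem eventually_punctured {p : ℂ → Prop} {x : ℂ} (h : ∀ᶠ z in 𝓝[≠] x, p z) :
    ∀ᶠ z in 𝓝[≠] x, ∀ᶠ w in 𝓝 z, p w := by
  rw [eventually_nhdsWithin_iff] at h
  rw [eventually_nhdsWithin_iff]
  filter_upwards [h.eventually_nhds] with z hz hzx
  filter_upwards [hz, isOpen_compl_singleton.mem_nhds hzx] with w h1 h2 using h1 h2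

theorem eventually_differentiableAt (f : merFun) (x : ℂ) :
    ∀ᶠ z in 𝓝[≠] x, DifferentiableAt ℂ f.1 z := by
  filter_upwards [(f.2 x).eventually_analyticAt] with z hz using hz.differentiableAt

/-- Differentiation, before passing to the quotient on the source. -/
def derivFun : merFun →ₗ[ℂ] Mer where
  toFun f := toMer (deriv f.1) fun x => (f.2 x).deriv
  map_add' f g := by
    refine (toMer_eq_iff _ (⟨_, _⟩ + ⟨_, _⟩)).2 fun x => ?_
    filter_upwards [eventually_differentiableAt f x, eventually_differentiableAt g x] with z h1 h2
    exact deriv_add h1 h2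
  map_smul' a f := by
    refine (toMer_eq_iff _ (a • ⟨_, _⟩)).2 fun x => ?_
    filter_upwards [eventually_differentiableAt f x] with z h1
    exact deriv_const_smul a h1

theorem derivFun_eq_zero (f : merFun) (hf : f ∈ merNull) : derivFun f = 0 := by
  refine (toMer_eq_iff _ 0).2 fun x => ?_
  filter_upwards [eventually_punctured (hf x)] with z hz
  have h : f.1 =ᶠ[𝓝 z] fun _ => 0 := hz
  change deriv f.1 z = 0
  rw [h.deriv_eq, deriv_const]

/-- The derivation `d/dq` of the ring of meromorphic functions. -/
def ddq : Mer →ₗ[ℂ] Mer :=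
  (merNull.restrictScalars ℂ).liftQ derivFun fun f hf => derivFun_eq_zero f hf

theorem ddq_mk (f : merFun) :
    ddq (mkMer f) = toMer (deriv f.1) fun x => (f.2 x).deriv := rfl

theorem meromorphicAt_rot (u : ℂˣ) {f : ℂ → ℂ} (hf : ∀ x, MeromorphicAt f x) (x : ℂ) :
    MeromorphicAt (fun z => f ((u : ℂ) * z)) x :=
  (hf (u * x)).comp_analyticAt (g := fun z => (u : ℂ) * z) (by fun_prop)

theorem tendsto_rot (u : ℂˣ) (x : ℂ) :
    Tendsto (fun z => (u : ℂ) * z) (𝓝[≠] x) (𝓝[≠] ((u : ℂ) * x)) := by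
  refine tendsto_nhdsWithin_iff.2 ⟨?_, ?_⟩
  · exact ((continuous_const_mul (u : ℂ)).tendsto x).mono_left nhdsWithin_le_nhds
  · filter_upwards [self_mem_nhdsWithin] with z hz h
    exact hz (mul_left_cancel₀ u.ne_zero h)

/-- `f(q) ↦ f(u q)` on functions. -/
def rotFun (u : ℂˣ) : merFun →ₐ[ℂ] merFun where
  toFun f := ⟨fun z => f.1 ((u : ℂ) * z), meromorphicAt_rot u f.2⟩
  map_one' := rfl
  map_mul' _ _ := rfl
  map_zero' := rfl
  map_add' _ _ := rfl
  commutes' _ := rfl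

/-- The substitution `f(q) ↦ f(u q)`, as an algebra homomorphism. -/
def rotHom (u : ℂˣ) : Mer →ₐ[ℂ] Mer :=
  Ideal.quotientMapₐ merNull (rotFun u) fun _ hf x => (tendsto_rot u x).eventually (hf _)

theorem rotHom_mk (u : ℂˣ) (f : merFun) :
    rotHom u (mkMer f) = mkMer (rotFun u f) := rfl

theorem rotHom_one (f : Mer) : rotHom 1 f = f := by
  obtain ⟨f, rfl⟩ := mkMer_surjective f
  rw [rotHom_mk]
  congr 1
  ext z
  simp [rotFun]

theorem rotHom_mul (u v : ℂˣ) (f : Mer) : rotHom (u * v) f = rotHom u (rotHom v f) := by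
  obtain ⟨f, rfl⟩ := mkMer_surjective f
  rw [rotHom_mk, rotHom_mk, rotHom_mk]
  congr 1
  ext z
  simp [rotFun, mul_comm, mul_left_comm]

theorem ddq_rotHom (u : ℂˣ) (f : Mer) : ddq (rotHom u f) = (u : ℂ) • rotHom u (ddq f) := by
  obtain ⟨f, rfl⟩ := mkMer_surjective f
  rw [rotHom_mk, ddq_mk, ddq_mk]
  refine (toMer_eq_iff _ ((u : ℂ) • rotFun u ⟨_, _⟩)).2 fun x => Eventually.of_forall fun z => ?_
  change deriv (fun z => f.1 ((u : ℂ) * z)) z = (u : ℂ) * deriv f.1 ((u : ℂ) * z)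
  rw [deriv_comp_mul_left, smul_eq_mul]

/-! ### Differential operators with meromorphic coefficients, and their classical analogue -/

/-- The ring `𝒟` of differential operators in `q` with meromorphic coefficients, acting on
meromorphic functions: generated by multiplication operators and `d/dq`. -/
def diffOp : Subalgebra ℂ (Module.End ℂ Mer) :=
  Algebra.adjoin ℂ (Set.range (Algebra.lmul ℂ Mer) ∪ {ddq})

/-- A function, viewed as a multiplication operator. -/
def opCoeff : Mer →ₐ[ℂ] diffOp :=
  (Algebra.lmul ℂ Mer).codRestrict diffOp fun f =>
    Algebra.subset_adjoin (Or.inl ⟨f, rfl⟩)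

/-- The quantum momentum `ħ d/dq`. -/
def opMomentum (ħ : ℂ) : diffOp :=
  ħ • ⟨ddq, Algebra.subset_adjoin (Or.inr rfl)⟩

/-- Conjugation of operators by `f(q) ↦ f(u q)`. -/
def conjEnd (u : ℂˣ) : Module.End ℂ Mer →ₐ[ℂ] Module.End ℂ Mer :=
  AlgHom.ofLinearMap
    { toFun := fun A => (rotHom u).toLinearMap ∘ₗ A ∘ₗ (rotHom u⁻¹).toLinearMap
      map_add' := fun A B => by ext f; simp
      map_smul' := fun a A => by ext f; simp }
    (by
      ext f
      simp [← rotHom_mul, rotHom_one])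
    (by
      intro A B
      ext f
      simp [← rotHom_mul u⁻¹ u, rotHom_one])

theorem conjEnd_apply (u : ℂˣ) (A : Module.End ℂ Mer) (f : Mer) :
    conjEnd u A f = rotHom u (A (rotHom u⁻¹ f)) := rfl

theorem conjEnd_mem (u : ℂˣ) {A : Module.End ℂ Mer} (hA : A ∈ diffOp) :
    conjEnd u A ∈ diffOp := by
  suffices h : diffOp ≤ diffOp.comap (conjEnd u) from h hA
  refine Algebra.adjoin_le ?_
  rintro _ (⟨g, rfl⟩ | rfl)
  · have : conjEnd u (Algebra.lmul ℂ Mer g) = Algebra.lmul ℂ Mer (rotHom u g) := by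
      ext f
      simp [conjEnd_apply, ← rotHom_mul, rotHom_one]
    change conjEnd u _ ∈ diffOp
    rw [this]
    exact Algebra.subset_adjoin (Or.inl ⟨_, rfl⟩)
  · have : conjEnd u ddq = ((u⁻¹ : ℂˣ) : ℂ) • ddq := by
      ext f
      rw [conjEnd_apply, ddq_rotHom, map_smul, ← rotHom_mul, mul_inv_cancel, rotHom_one]
      rfl
    change conjEnd u _ ∈ diffOp
    rw [this]
    exact diffOp.smul_mem (Algebra.subset_adjoin (Or.inr rfl)) _

/-- The ring of classical symbols: polynomials in the momentum `p = X`, with meromorphic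
coefficients. -/
abbrev Sym : Type := Polynomial Mer

/-- The substitution `q ↦ u q`, `p ↦ u⁻¹ p` on classical symbols. -/
def symRot (u : ℂˣ) : Sym →+* Sym :=
  Polynomial.eval₂RingHom (Polynomial.C.comp (rotHom u : Mer →+* Mer))
    (((u⁻¹ : ℂˣ) : ℂ) • Polynomial.X)

theorem symRot_C (u : ℂˣ) (f : Mer) :
    symRot u (Polynomial.C f) = Polynomial.C (rotHom u f) := by
  simp [symRot]

theorem symRot_X (u : ℂˣ) :
    symRot u Polynomial.X = ((u⁻¹ : ℂˣ) : ℂ) • Polynomial.X := by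
  simp [symRot]

theorem symRot_smul (u : ℂˣ) (a : ℂ) (f : Sym) : symRot u (a • f) = a • symRot u f := by
  rw [Algebra.smul_def, Algebra.smul_def, map_mul, Polynomial.algebraMap_apply, symRot_C,
    AlgHom.commutes]

theorem symRot_one (f : Sym) : symRot 1 f = f := by
  have : symRot 1 = RingHom.id Sym := by
    ext1
    · ext1 f
      simp [symRot_C, rotHom_one]
    · simp [symRot_X]
  rw [this, RingHom.id_apply]

theorem symRot_mul (u v : ℂˣ) (f : Sym) : symRot (u * v) f = symRot u (symRot v f) := by
  have : symRot (u * v) = (symRot u).comp (symRot v) := by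
    ext1
    · ext1 f
      simp [symRot_C, rotHom_mul]
    · simp only [RingHom.comp_apply, symRot_X, symRot_smul, smul_smul, mul_inv, Units.val_mul]
      rw [mul_comm]
  rw [this, RingHom.comp_apply]

/-! ### The action of `ℤ_m` -/

/-- The cyclic group `ℤ_m = {1, s, …, s^{m-1}}`, written multiplicatively. -/
abbrev Zm (m : ℕ) : Type := Multiplicative (ZMod m)

/-- The generator `s`. -/
def s (m : ℕ) : Zm m := Multiplicative.ofAdd 1

/-- `ω = exp(2πi/m)`. -/
def ω (m : ℕ) : ℂ := Complex.exp (2 * Real.pi * Complex.I / m)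

/-- The character `s ↦ ω` of `ℤ_m`. -/
def rootChar (m : ℕ) [NeZero m] : Zm m →* ℂˣ :=
  (ZMod.stdAddChar (N := m)).toMonoidHom.toHomUnits

theorem rootChar_s (m : ℕ) [NeZero m] : ((rootChar m (s m) : ℂˣ) : ℂ) = ω m := by
  have h := ZMod.stdAddChar_coe (N := m) 1
  simp only [Int.cast_one, mul_one] at h
  exact h

/-- `ℤ_m` acts on differential operators by conjugation: `s q = ω q s`, `s d/dq = ω⁻¹ d/dq s`. -/
instance opAction (m : ℕ) [NeZero m] : MulSemiringAction (Zm m) diffOp where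
  smul g A := ⟨conjEnd (rootChar m g) A.1, conjEnd_mem _ A.2⟩
  one_smul A := by
    apply Subtype.ext
    change conjEnd (rootChar m 1) A.1 = A.1
    ext f
    simp [conjEnd_apply, rotHom_one]
  mul_smul g h A := by
    apply Subtype.ext
    change conjEnd (rootChar m (g * h)) A.1 = conjEnd (rootChar m g) (conjEnd (rootChar m h) A.1)
    ext f
    simp only [conjEnd_apply, map_mul, mul_inv_rev, rotHom_mul]
  smul_zero g := Subtype.ext (map_zero (conjEnd (rootChar m g)))
  smul_add g A B := Subtype.ext (map_add (conjEnd (rootChar m g)) A.1 B.1)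
  smul_one g := Subtype.ext (map_one (conjEnd (rootChar m g)))
  smul_mul g A B := Subtype.ext (map_mul (conjEnd (rootChar m g)) A.1 B.1)

/-- `ℤ_m` acts on classical symbols: `s q = ω q s`, `s p = ω⁻¹ p s`. -/
instance symAction (m : ℕ) [NeZero m] : MulSemiringAction (Zm m) Sym where
  smul g f := symRot (rootChar m g) f
  one_smul f := by
    change symRot (rootChar m 1) f = f
    rw [map_one, symRot_one]
  mul_smul g h f := by
    change symRot (rootChar m (g * h)) f = symRot (rootChar m g) (symRot (rootChar m h) f)
    rw [map_mul, symRot_mul]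
  smul_zero g := map_zero (symRot (rootChar m g))
  smul_add g := map_add (symRot (rootChar m g))
  smul_one g := map_one (symRot (rootChar m g))
  smul_mul g := map_mul (symRot (rootChar m g))

/-! ### Elliptic functions and coupling parameters on `E = ℂ/Λ` -/

/-- The elliptic curve `E = ℂ/Λ`. -/
abbrev Curve (L : PeriodPair) : Type := ℂ ⧸ L.lattice

/-- The point of `E` with coordinate `x`. -/
def pt (L : PeriodPair) (x : ℂ) : Curve L := Submodule.Quotient.mk x

/-- `f ∈ ℂ(E)`: the meromorphic function `f` is `Λ`-periodic. -/
def IsElliptic (L : PeriodPair) (f : Mer) : Prop :=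
  ∃ F, Represents F f ∧ ∀ l ∈ L.lattice, ∀ z, F (z + l) = F z

/-- `f` is regular at `x` (after removing a removable singularity). -/
def RegularAt (f : Mer) (x : ℂ) : Prop := ∃ F, Represents F f ∧ AnalyticAt ℂ F x

/-- `f` has at most a simple pole at `x`, with residue `r`. -/
def SimplePoleAt (f : Mer) (x r : ℂ) : Prop :=
  ∃ F, Represents F f ∧ Tendsto (fun z => (z - x) * F z) (𝓝[≠] x) (𝓝 r)

/-- A `ℤ_m`-invariant open chart of `E`, given by its preimage in `ℂ`. -/
structure IsChart (m : ℕ) (L : PeriodPair) (U : Set ℂ) : Prop where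
  isOpen : IsOpen U
  add_mem : ∀ x ∈ U, ∀ l ∈ L.lattice, x + l ∈ U
  mul_mem : ∀ x ∈ U, ω m * x ∈ U

/-- `𝒪_U`: the elliptic functions regular on `U`. -/
def regularFunctions (L : PeriodPair) (U : Set ℂ) : Set Mer :=
  {f | IsElliptic L f ∧ ∀ x ∈ U, RegularAt f x}

/-- The parameters `c_l(x)`, `x ∈ E`, `l = 1, …, m-1`: zero unless `s^l(x) = x`, and invariant
under `x ↦ ω x`. -/
structure Couplings (m : ℕ) (L : PeriodPair) where
  c : ℕ → Curve L → ℂ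
  eq_zero : ∀ l ∈ Finset.Ico 1 m, ∀ x : ℂ, pt L (ω m ^ l * x) ≠ pt L x → c l (pt L x) = 0
  invariant : ∀ l ∈ Finset.Ico 1 m, ∀ x : ℂ, c l (pt L (ω m * x)) = c l (pt L x)

section Couplings

variable {m : ℕ} {L : PeriodPair} (c : Couplings m L)

/-- `μ_j(x) = ∑_{l=1}^{m-1} ω^{-jl} c_l(x)`. -/
def Couplings.μ (j : ℕ) (x : Curve L) : ℂ :=
  ∑ l ∈ Finset.Ico 1 m, (ω m)⁻¹ ^ (j * l) * c.c l x

/-- The set of nonzero points of `E` with a nontrivial stabiliser in `ℤ_m`. -/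
def fixedPoints (m : ℕ) (L : PeriodPair) : Set (Curve L) :=
  {x | x ≠ 0 ∧ ∃ l ∈ Finset.Ico 1 m, ∃ z : ℂ, pt L z = x ∧ pt L (ω m ^ l * z) = x}

/-- The sum of `μ_j(x)` over the nonzero fixed points `x`. -/
def Couplings.μbar (j : ℕ) : ℂ := ∑ᶠ x ∈ fixedPoints m L, c.μ j x

end Couplings

/-- The Weierstrass function `℘`. -/
def weierP (L : PeriodPair) : Mer := toMer L.weierstrassP fun x => L.meromorphic_weierstrassP x

/-- `f(q, z) = (℘'(q) + ℘'(z)) / (2 (℘(q) - ℘(z)))`, as a function of `q`. -/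
def fEll (L : PeriodPair) (z : ℂ) : Mer :=
  toMer (fun q => (L.derivWeierstrassP q + L.derivWeierstrassP z) /
      (2 * (L.weierstrassP q - L.weierstrassP z))) fun x =>
    ((L.meromorphic_derivWeierstrassP x).add (MeromorphicAt.const _ x)).div
      ((MeromorphicAt.const 2 x).mul
        ((L.meromorphic_weierstrassP x).sub (MeromorphicAt.const _ x)))

/-- `f_k(q) = ∑ μ_k(x) f(q, x)`, the sum over the nonzero fixed points `x`; each `x ∈ E` is
represented by an arbitrary coordinate `x.out ∈ ℂ`, on which `f(q, x)` does not depend. -/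
def Couplings.fk {m : ℕ} {L : PeriodPair} (c : Couplings m L) (k : ℕ) : Mer :=
  ∑ᶠ x ∈ fixedPoints m L, c.μ k x • fEll L (Quotient.out x)

/-- The function `q⁻¹`. -/
def qInv : Mer := toMer (fun q => q⁻¹) fun x => (MeromorphicAt.id x).inv

/-! ### Cherednik algebras, spherical subalgebras, hamiltonians

These are defined for a ring `R` of differential operators or of classical symbols, which
contains the functions through `ι` and has a momentum `P`. -/

section General

variable {R : Type} [Ring R] [Algebra ℂ R] (ι : Mer →ₐ[ℂ] R) (P : R)

section Sheaf

variable {m : ℕ} [NeZero m] {L : PeriodPair} [MulSemiringAction (Zm m) R] (c : Couplings m L)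

/-- `y = P - ∑_{l=1}^{m-1} b_l(q) s^l` in the crossed product `R ⋊ ℤ_m`. -/
def dunkl (b : ℕ → Mer) : SkewMonoidAlgebra R (Zm m) :=
  SkewMonoidAlgebra.single 1 P -
    ∑ l ∈ Finset.Ico 1 m, SkewMonoidAlgebra.single (s m ^ l) (ι (b l))

/-- The coefficients `b_l` are allowed in a Dunkl operator over `U`: they are elliptic, and at
each `x ∈ U` they have at most a simple pole, with residue `c_l(x)`. -/
def AdmissibleOn (U : Set ℂ) (b : ℕ → Mer) : Prop :=
  ∀ l ∈ Finset.Ico 1 m, IsElliptic L (b l) ∧ ∀ x ∈ U, SimplePoleAt (b l) x (c.c l (pt L x))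

/-- The algebra of sections of the elliptic Cherednik algebra over `U`: the subalgebra of
`R ⋊ ℤ_m` generated by `𝒪_U ⋊ ℤ_m` and `y` (the constants lie in `𝒪_U`). -/
def cherednik (L : PeriodPair) (U : Set ℂ) (y : SkewMonoidAlgebra R (Zm m)) :
    Subring (SkewMonoidAlgebra R (Zm m)) :=
  Subring.closure
    ({a | ∃ g : Zm m, ∃ f ∈ regularFunctions L U, a = SkewMonoidAlgebra.single g (ι f)} ∪ {y})

/-- The idempotent `e = (1/m) ∑ s^j`. -/
def e (R : Type) [Ring R] [Algebra ℂ R] (m : ℕ) [NeZero m] [MulSemiringAction (Zm m) R] :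
    SkewMonoidAlgebra R (Zm m) :=
  (m : ℂ)⁻¹ • ∑ j ∈ Finset.range m, SkewMonoidAlgebra.single (s m ^ j) (1 : R)

/-- The map `∑ a_g g ↦ ∑ a_g`: the operator by which an element of `R ⋊ ℤ_m` acts on
`ℤ_m`-invariant functions. -/
def θ (a : SkewMonoidAlgebra R (Zm m)) : R := a.sum fun _ r => r

/-- `B(U) = θ(e H(U) e)`: the sections of the sheaf of spherical subalgebras over a chart `U`
on which an admissible Dunkl operator exists. -/
def sphericalOn (U : Set ℂ) : Set R :=
  {A | ∃ b, AdmissibleOn c U b ∧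
    ∃ a ∈ cherednik ι L U (dunkl ι P b), A = θ (e R m * a * e R m)}

/-- Global sections of the sheaf of spherical subalgebras: the elements that near every point
of `E` are sections over some `ℤ_m`-invariant open chart. -/
def globalSections : Set R :=
  {A | ∀ x : ℂ, ∃ U, IsChart m L U ∧ x ∈ U ∧ A ∈ sphericalOn ι P c U}

end Sheaf

/-- The product `(P - g_{j-1}) ⋯ (P - g_1) (P - g_0)`. -/
def ladder (g : ℕ → Mer) : ℕ → R
  | 0 => 1
  | j + 1 => (P - ι (g j)) * ladder g j

variable {m : ℕ} {L : PeriodPair} (c : Couplings m L)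

/-- `w_j = (P - f_{j-1}) ⋯ (P - f_0)`. -/
def w (j : ℕ) : R := ladder ι P c.fk j

/-- `v^{(i)}_j = ℘^{(i)}(q) (P - f_{j-1}) ⋯ (P - f_0)`. -/
def v (i j : ℕ) : R := ι (ddq^[i] (weierP L)) * ladder ι P c.fk j

/-- `w_m + ∑_{i=2}^m α_i v^{(i-2)}_{m-i}`; the coefficient `α_{i+2}` is written `α i`, with
`0 ≤ i ≤ m-2`. -/
def hamiltonian (α : Fin (m - 1) → ℂ) : R :=
  w ι P c m + ∑ i : Fin (m - 1), α i • v ι P c i (m - 2 - i)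

/-- Equality of principal parts at `q = 0`:
`(P - μ_{m-1} q⁻¹) ⋯ (P - μ_0 q⁻¹) = (P + μ̄_{m-1} q⁻¹) ⋯ (P + μ̄_0 q⁻¹)
  + ∑_{i=2}^m (-1)^i (i-1)! α_i q⁻ⁱ (P + μ̄_{m-i-1} q⁻¹) ⋯ (P + μ̄_0 q⁻¹)`,
where `μ_j = μ_j(0)`, `μ̄_j` is the sum of `μ_j(x)` over the nonzero fixed points, and `α_{i+2}`
is written `α i`. -/
def PrincipalPartsMatch (α : Fin (m - 1) → ℂ) : Prop :=
  ladder ι P (fun k => c.μ k 0 • qInv) m =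
    ladder ι P (fun k => -(c.μbar k • qInv)) m +
      ∑ i : Fin (m - 1),
        ((-1) ^ ((i : ℕ) + 2) * (Nat.factorial ((i : ℕ) + 1) : ℂ) * α i) •
          (ι (qInv ^ ((i : ℕ) + 2)) * ladder ι P (fun k => -(c.μbar k • qInv)) (m - 2 - i))

end General

/-- The inclusion of functions in the ring of classical symbols. -/
def symCoeff : Mer →ₐ[ℂ] Sym := Polynomial.CAlgHom

/-- The classical momentum `p`. -/
def symMomentum : Sym := Polynomial.X

end

end EllipticCherednik

/-! The crossed product acts on `R` itself: coefficients by left multiplication, the group by its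
automorphisms. Since every group element fixes 1, `θ a` is the image of 1 under `a` (`θ_eq_act`). A
PBW argument (`IsMomentum.coeffSpan_stable`) shows that the orbit of 1 under H(U) is the span of the
elements y^k·1 over 𝒪_U, and projecting by e shows that B(U) consists of the invariant elements of
this span (`IsMomentum.mem_sphericalOn_iff`). As y^k·1 is monic of degree k in P, coefficients in
this span are unique. Membership may therefore be tested locally on the curve, and leading
coefficients make sense.

Upper bound (`IsMomentum.globalSections_eq`): the leading coefficient of a global section is
elliptic and regular everywhere, hence a constant by Liouville's theorem; invariance under s then
forces the order to be a multiple of m. Subtracting a multiple of a power of the hamiltonian, which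
is monic of order m, lowers the order, and induction finishes.

Lower bound (`IsMomentum.hamiltonian_mem`): s^l multiplies w_j by ω^{-jl}, so y·w_j = (P - ∑ ω^{-jl}
b_l) w_j. Away from the lattice f_j has the same residues μ_j(x) as ∑ ω^{-jl} b_l, so every w_j lies
in the span. At the origin f_j has residue -μ̄_j instead of μ_j(0). There the correctly normalised
product ∏(P - μ_k/q) lies in the span, and the hamiltonian differs from it by an element generated
by regular germs and qP, which preserve the span. This works because equivariance leaves huge gaps
in the Taylor expansions: f_k = -μ̄_k/q + O(q^{m-1}), and ℘^{(i)} equals its polar part up to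
O(q^{m-i-2}). The equation defining the α_i then says precisely that the polar parts add up to ∏(P -
μ_k/q).

Existence and uniqueness of the α_i (`IsMomentum.exists_principalPartsMatch`): a product of factors
P - t_k/q is a power of 1/q times a polynomial in the Euler operator qP, so the relation is the
expansion of one polynomial in a basis of monic ones. Both cases, ħ ≠ 0 and ħ = 0, are instances of
`IsMomentum`. -/

namespace EllipticCherednik

noncomputable section

set_option linter.unusedSectionVars false

/-! ### Limits, regularity and simple poles of elements of `Mer` -/

/-- `f` tends to `a` at the point `x`. -/
def HasLim (f : Mer) (x a : ℂ) : Prop := ∃ F, Represents F f ∧ Tendsto F (𝓝[≠] x) (𝓝 a)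

theorem represents_mk (f : merFun) : Represents f.1 (mkMer f) := ⟨f.2, rfl⟩

theorem Represents.eventuallyEq {F G : ℂ → ℂ} {f : Mer} (hF : Represents F f)
    (hG : Represents G f) (x : ℂ) : F =ᶠ[𝓝[≠] x] G := by
  obtain ⟨h1, rfl⟩ := hF
  obtain ⟨h2, h⟩ := hG
  exact ((toMer_eq_iff _ _).1 h x).symm

theorem HasLim.tendsto {f : Mer} {x a : ℂ} (h : HasLim f x a) {F : ℂ → ℂ}
    (hF : Represents F f) : Tendsto F (𝓝[≠] x) (𝓝 a) := by
  obtain ⟨G, hG, hl⟩ := h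
  exact hl.congr' (hG.eventuallyEq hF x)

theorem hasLim_mk {f : merFun} {x a : ℂ} :
    HasLim (mkMer f) x a ↔ Tendsto f.1 (𝓝[≠] x) (𝓝 a) :=
  ⟨fun h => h.tendsto (represents_mk f), fun h => ⟨_, represents_mk f, h⟩⟩

theorem hasLim_algebraMap (a x : ℂ) : HasLim (algebraMap ℂ Mer a) x a :=
  ⟨fun _ => a, ⟨fun _ => MeromorphicAt.const _ _, rfl⟩, tendsto_const_nhds⟩

theorem HasLim.add {f g : Mer} {x a b : ℂ} (hf : HasLim f x a) (hg : HasLim g x b) :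
    HasLim (f + g) x (a + b) := by
  obtain ⟨f, rfl⟩ := mkMer_surjective f
  obtain ⟨g, rfl⟩ := mkMer_surjective g
  rw [← map_add, hasLim_mk]
  exact (hasLim_mk.1 hf).add (hasLim_mk.1 hg)

theorem HasLim.mul {f g : Mer} {x a b : ℂ} (hf : HasLim f x a) (hg : HasLim g x b) :
    HasLim (f * g) x (a * b) := by
  obtain ⟨f, rfl⟩ := mkMer_surjective f
  obtain ⟨g, rfl⟩ := mkMer_surjective g
  rw [← map_mul, hasLim_mk]
  exact (hasLim_mk.1 hf).mul (hasLim_mk.1 hg)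

theorem HasLim.smul {f : Mer} {x a : ℂ} (t : ℂ) (hf : HasLim f x a) :
    HasLim (t • f) x (t * a) := by
  rw [Algebra.smul_def]
  exact (hasLim_algebraMap t x).mul hf

theorem HasLim.neg {f : Mer} {x a : ℂ} (hf : HasLim f x a) : HasLim (-f) x (-a) := by
  simpa using hf.smul (-1)

theorem HasLim.sub {f g : Mer} {x a b : ℂ} (hf : HasLim f x a) (hg : HasLim g x b) :
    HasLim (f - g) x (a - b) := by
  simpa [sub_eq_add_neg] using hf.add hg.neg

theorem hasLim_zero (x : ℂ) : HasLim 0 x 0 := by simpa using hasLim_algebraMap 0 x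

theorem HasLim.sum {ι : Type*} {s : Finset ι} {f : ι → Mer} {x : ℂ} {a : ι → ℂ}
    (h : ∀ i ∈ s, HasLim (f i) x (a i)) : HasLim (∑ i ∈ s, f i) x (∑ i ∈ s, a i) := by
  classical
  induction s using Finset.induction_on with
  | empty => simpa using hasLim_zero x
  | insert i s hi ih =>
    rw [Finset.sum_insert hi, Finset.sum_insert hi]
    exact (h i (by simp)).add (ih fun j hj => h j (by simp [hj]))

theorem HasLim.unique {f : Mer} {x a b : ℂ} (hf : HasLim f x a) (hg : HasLim f x b) : a = b := by
  obtain ⟨F, hF, h⟩ := hf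
  exact tendsto_nhds_unique h (hg.tendsto hF)

theorem HasLim.rot {f : Mer} {x a : ℂ} (u : ℂˣ) (h : HasLim f (u * x) a) :
    HasLim (rotHom u f) x a := by
  obtain ⟨f, rfl⟩ := mkMer_surjective f
  rw [rotHom_mk, hasLim_mk]
  exact (hasLim_mk.1 h).comp (tendsto_rot u x)

theorem eventually_ne_punctured (x y : ℂ) : ∀ᶠ z in 𝓝[≠] x, z ≠ y := by
  by_cases hy : x = y
  · exact hy ▸ self_mem_nhdsWithin
  · exact nhdsWithin_le_nhds (isOpen_compl_singleton.mem_nhds hy)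

theorem exists_analyticAt_of_hasLim {f : Mer} {x a : ℂ} (h : HasLim f x a) :
    ∃ F, Represents F f ∧ AnalyticAt ℂ F x ∧ F x = a := by
  obtain ⟨f, rfl⟩ := mkMer_surjective f
  have hev : ∀ y, Function.update f.1 x a =ᶠ[𝓝[≠] y] f.1 := fun y => by
    filter_upwards [eventually_ne_punctured y x] with z hz using Function.update_of_ne hz _ _
  have hm : ∀ y, MeromorphicAt (Function.update f.1 x a) y :=
    fun y => (f.2 y).congr (hev y).symm
  refine ⟨Function.update f.1 x a, ⟨hm, (toMer_eq_iff _ _).2 hev⟩, ?_, by simp⟩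
  refine (hm x).analyticAt ?_
  rw [continuousAt_update_same]
  exact hasLim_mk.1 h

theorem regularAt_iff {f : Mer} {x : ℂ} : RegularAt f x ↔ ∃ a, HasLim f x a := by
  constructor
  · rintro ⟨F, hF, h⟩
    exact ⟨F x, F, hF, h.continuousAt.tendsto.mono_left nhdsWithin_le_nhds⟩
  · rintro ⟨a, h⟩
    obtain ⟨F, hF, hA, -⟩ := exists_analyticAt_of_hasLim h
    exact ⟨F, hF, hA⟩

theorem HasLim.regularAt {f : Mer} {x a : ℂ} (h : HasLim f x a) : RegularAt f x :=
  regularAt_iff.2 ⟨a, h⟩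

theorem regularAt_algebraMap (a x : ℂ) : RegularAt (algebraMap ℂ Mer a) x :=
  (hasLim_algebraMap a x).regularAt

theorem RegularAt.add {f g : Mer} {x : ℂ} (hf : RegularAt f x) (hg : RegularAt g x) :
    RegularAt (f + g) x := by
  obtain ⟨a, ha⟩ := regularAt_iff.1 hf
  obtain ⟨b, hb⟩ := regularAt_iff.1 hg
  exact (ha.add hb).regularAt

theorem RegularAt.mul {f g : Mer} {x : ℂ} (hf : RegularAt f x) (hg : RegularAt g x) :
    RegularAt (f * g) x := by
  obtain ⟨a, ha⟩ := regularAt_iff.1 hf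
  obtain ⟨b, hb⟩ := regularAt_iff.1 hg
  exact (ha.mul hb).regularAt

theorem RegularAt.rot {f : Mer} {x : ℂ} (u : ℂˣ) (h : RegularAt f (u * x)) :
    RegularAt (rotHom u f) x := by
  obtain ⟨a, ha⟩ := regularAt_iff.1 h
  exact (ha.rot u).regularAt

theorem RegularAt.ddq {f : Mer} {x : ℂ} (h : RegularAt f x) : RegularAt (ddq f) x := by
  obtain ⟨F, ⟨hF, rfl⟩, hA⟩ := h
  exact ⟨deriv F, ⟨fun y => (hF y).deriv, rfl⟩, hA.deriv⟩

/-- The coordinate function `q`. -/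
def qMer : Mer := toMer (fun q => q) fun x => MeromorphicAt.id x

theorem hasLim_qMer (x : ℂ) : HasLim qMer x x :=
  ⟨_, ⟨fun x => MeromorphicAt.id x, rfl⟩, tendsto_id.mono_left nhdsWithin_le_nhds⟩

theorem qMer_mul_qInv : qMer * qInv = 1 := by
  refine (toMer_eq_iff (⟨_, _⟩ * ⟨_, _⟩) 1).2 fun x => ?_
  filter_upwards [eventually_ne_punctured x 0] with z hz
  exact mul_inv_cancel₀ hz

theorem qInv_mul_qMer : qInv * qMer = 1 := by rw [mul_comm, qMer_mul_qInv]

theorem simplePoleAt_iff {f : Mer} {x r : ℂ} :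
    SimplePoleAt f x r ↔ HasLim ((qMer - algebraMap ℂ Mer x) * f) x r := by
  obtain ⟨f, rfl⟩ := mkMer_surjective f
  have h : (qMer - algebraMap ℂ Mer x) * mkMer f =
      mkMer ((⟨fun q => q, fun x => MeromorphicAt.id x⟩ - algebraMap ℂ merFun x) * f) := by
    rw [map_mul, map_sub, AlgHom.commutes]
    rfl
  rw [h, hasLim_mk]
  constructor
  · rintro ⟨F, hF, hl⟩
    refine hl.congr' ?_
    filter_upwards [hF.eventuallyEq (represents_mk f) x] with z hz
    rw [hz]
    rfl
  · intro hl
    exact ⟨f.1, represents_mk f, hl⟩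

/-- If K is the analytic extension of (q - x) f, then K(x) = 0 and f is the slope of K at x, which
tends to K'(x). -/
theorem regularAt_of_hasLim_zero {f : Mer} {x : ℂ}
    (h : HasLim ((qMer - algebraMap ℂ Mer x) * f) x 0) : RegularAt f x := by
  obtain ⟨K, hK, hA, h0⟩ := exists_analyticAt_of_hasLim h
  obtain ⟨f, rfl⟩ := mkMer_surjective f
  have hrep : Represents (fun z => (z - x) * f.1 z) ((qMer - algebraMap ℂ Mer x) * mkMer f) := by
    refine ⟨fun y => ((MeromorphicAt.id y).sub (MeromorphicAt.const x y)).mul (f.2 y), ?_⟩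
    change mkMer ((⟨fun q => q, fun x => MeromorphicAt.id x⟩ - algebraMap ℂ merFun x) * f) = _
    rw [map_mul, map_sub, AlgHom.commutes]
    rfl
  have hd : Tendsto (slope K x) (𝓝[≠] x) (𝓝 (deriv K x)) :=
    hasDerivAt_iff_tendsto_slope.1 hA.differentiableAt.hasDerivAt
  refine (hasLim_mk (a := deriv K x)).2 (hd.congr' ?_) |>.regularAt
  filter_upwards [hK.eventuallyEq hrep x, self_mem_nhdsWithin] with z hz hzx
  rw [slope_def_field, hz, h0, sub_zero]
  exact mul_div_cancel_left₀ _ (sub_ne_zero.2 hzx)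

theorem SimplePoleAt.regularAt {f : Mer} {x : ℂ} (h : SimplePoleAt f x 0) : RegularAt f x :=
  regularAt_of_hasLim_zero (simplePoleAt_iff.1 h)

theorem RegularAt.simplePoleAt {f : Mer} {x : ℂ} (h : RegularAt f x) : SimplePoleAt f x 0 := by
  obtain ⟨a, ha⟩ := regularAt_iff.1 h
  have := ((hasLim_qMer x).sub (hasLim_algebraMap x x)).mul ha
  rw [sub_self, zero_mul] at this
  exact simplePoleAt_iff.2 this

theorem SimplePoleAt.add {f g : Mer} {x r t : ℂ} (hf : SimplePoleAt f x r)
    (hg : SimplePoleAt g x t) : SimplePoleAt (f + g) x (r + t) := by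
  rw [simplePoleAt_iff] at *
  rw [mul_add]
  exact hf.add hg

theorem SimplePoleAt.smul {f : Mer} {x r : ℂ} (t : ℂ) (hf : SimplePoleAt f x r) :
    SimplePoleAt (t • f) x (t * r) := by
  rw [simplePoleAt_iff] at *
  rw [mul_smul_comm]
  exact hf.smul t

theorem SimplePoleAt.sub {f g : Mer} {x r t : ℂ} (hf : SimplePoleAt f x r)
    (hg : SimplePoleAt g x t) : SimplePoleAt (f - g) x (r - t) := by
  rw [simplePoleAt_iff] at *
  rw [mul_sub]
  exact hf.sub hg

theorem SimplePoleAt.sum {ι : Type*} {s : Finset ι} {f : ι → Mer} {x : ℂ} {a : ι → ℂ}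
    (h : ∀ i ∈ s, SimplePoleAt (f i) x (a i)) :
    SimplePoleAt (∑ i ∈ s, f i) x (∑ i ∈ s, a i) := by
  simp only [simplePoleAt_iff] at *
  rw [Finset.mul_sum]
  exact HasLim.sum h

theorem rotHom_qMer (u : ℂˣ) : rotHom u qMer = (u : ℂ) • qMer := rfl

theorem SimplePoleAt.rot {f : Mer} {x r : ℂ} (u : ℂˣ) (h : SimplePoleAt f (u * x) r) :
    SimplePoleAt (rotHom u f) x ((u : ℂ)⁻¹ * r) := by
  rw [simplePoleAt_iff] at *
  have := (h.rot u).smul (u : ℂ)⁻¹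
  convert! this using 1
  rw [map_mul, map_sub, rotHom_qMer, AlgHom.commutes, ← smul_mul_assoc, smul_sub, smul_smul,
    inv_mul_cancel₀ u.ne_zero, one_smul, map_mul, ← Algebra.smul_def, smul_smul,
    inv_mul_cancel₀ u.ne_zero, one_smul]

theorem simplePoleAt_qInv : SimplePoleAt qInv 0 1 := by
  rw [simplePoleAt_iff, map_zero, sub_zero, qMer_mul_qInv]
  simpa using hasLim_algebraMap 1 0

/-- A function with a simple pole times a function vanishing there is regular. -/
theorem SimplePoleAt.regularAt_mul {f g : Mer} {x r : ℂ} (hf : SimplePoleAt f x r)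
    (hg : HasLim g x 0) : RegularAt (f * g) x := by
  apply regularAt_of_hasLim_zero
  rw [← mul_assoc]
  simpa using (simplePoleAt_iff.1 hf).mul hg

theorem SimplePoleAt.regularAt_qMer_mul {f : Mer} {r : ℂ} (hf : SimplePoleAt f 0 r) :
    RegularAt (qMer * f) 0 := by
  simpa using (simplePoleAt_iff.1 hf).regularAt

/-! ### The derivation `ddq` -/

theorem ddq_mul (f g : Mer) : ddq (f * g) = ddq f * g + f * ddq g := by
  obtain ⟨f, rfl⟩ := mkMer_surjective f
  obtain ⟨g, rfl⟩ := mkMer_surjective g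
  rw [← map_mul, ddq_mk, ddq_mk, ddq_mk]
  refine (toMer_eq_iff _ (⟨_, _⟩ * g + f * ⟨_, _⟩)).2 fun x => ?_
  filter_upwards [eventually_differentiableAt f x, eventually_differentiableAt g x] with z h1 h2
  exact deriv_mul h1 h2

/-- `ddq` as a derivation. -/
def ddqDer : Derivation ℂ Mer Mer :=
  Derivation.mk' ddq fun f g => by
    rw [ddq_mul, smul_eq_mul, smul_eq_mul, mul_comm g, add_comm]

theorem ddqDer_apply (f : Mer) : ddqDer f = ddq f := rfl

theorem ddq_algebraMap (a : ℂ) : ddq (algebraMap ℂ Mer a) = 0 := ddqDer.map_algebraMap a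

theorem ddq_qMer : ddq qMer = 1 := by
  refine (toMer_eq_iff ⟨_, _⟩ 1).2 fun x => Eventually.of_forall fun z => ?_
  exact deriv_id z

theorem ddq_qInv : ddq qInv = -qInv ^ 2 := by
  have h := ddq_mul qMer qInv
  rw [qMer_mul_qInv, ddq_qMer, one_mul, ← map_one (algebraMap ℂ Mer), ddq_algebraMap] at h
  calc ddq qInv = (qInv * qMer) * ddq qInv := by rw [qInv_mul_qMer, one_mul]
    _ = qInv * (0 - qInv) := by rw [h]; ring
    _ = -qInv ^ 2 := by ring

theorem ddq_qMer_pow (n : ℕ) : ddq (qMer ^ (n + 1)) = (n + 1 : ℂ) • qMer ^ n := by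
  rw [← ddqDer_apply, Derivation.leibniz_pow, ddqDer_apply, ddq_qMer]
  simp [Algebra.smul_def]

theorem ddq_qInv_pow (n : ℕ) : ddq (qInv ^ n) = -((n : ℂ) • qInv ^ (n + 1)) := by
  rw [← ddqDer_apply, Derivation.leibniz_pow, ddqDer_apply, ddq_qInv]
  rcases n with _ | n
  · simp
  · simp [Algebra.smul_def]
    ring

/-! ### Divisibility by powers of `q` from equivariance -/

/-- Powers of q are split off one at a time: the cofactor h after t steps has weight n - t, so its
value a at 0 satisfies a = u^(n-t) a and vanishes because u^(n-t) ≠ 1. -/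
theorem exists_eq_qMer_pow_mul {g : Mer} (hg : RegularAt g 0) (u : ℂˣ) (n : ℕ)
    (hu : ∀ k ∈ Finset.Ico 1 (n + 1), (u : ℂ) ^ k ≠ 1) (hrot : rotHom u g = (u : ℂ) ^ n • g) :
    ∃ h, RegularAt h 0 ∧ g = qMer ^ n * h := by
  suffices H : ∀ t ≤ n, ∃ h, RegularAt h 0 ∧ g = qMer ^ t * h from H n le_rfl
  intro t
  induction t with
  | zero => exact fun _ => ⟨g, hg, by simp⟩
  | succ t ih =>
    intro ht
    obtain ⟨h, hr, hgh⟩ := ih (by omega)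
    have hq : qInv ^ t * qMer ^ t = 1 := by rw [← mul_pow, qInv_mul_qMer, one_pow]
    have hh : rotHom u h = (u : ℂ) ^ (n - t) • h := by
      have h1 : (u : ℂ) ^ t • (qMer ^ t * rotHom u h) = (u : ℂ) ^ n • (qMer ^ t * h) := by
        rw [← hgh, ← hrot, hgh, map_mul, map_pow, rotHom_qMer, smul_pow, smul_mul_assoc]
      have h2 : qMer ^ t * rotHom u h = (u : ℂ) ^ (n - t) • (qMer ^ t * h) := by
        apply smul_right_injective Mer (pow_ne_zero t u.ne_zero)
        change (u : ℂ) ^ t • _ = (u : ℂ) ^ t • _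
        rw [h1, smul_smul, ← pow_add]
        congr 3
        omega
      calc rotHom u h = qInv ^ t * (qMer ^ t * rotHom u h) := by rw [← mul_assoc, hq, one_mul]
        _ = _ := by rw [h2, mul_smul_comm, ← mul_assoc, hq, one_mul]
    obtain ⟨a, ha⟩ := regularAt_iff.1 hr
    have h3 : HasLim (rotHom u h) 0 a := HasLim.rot u (by simpa using ha)
    rw [hh] at h3
    have h4 := h3.unique (ha.smul _)
    have ha0 : a = 0 := by
      by_contra hne
      refine hu (n - t) (by simp; omega) ?_
      have : ((u : ℂ) ^ (n - t) - 1) * a = 0 := by linear_combination -h4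
      rcases mul_eq_zero.1 this with h | h
      · exact sub_eq_zero.1 h
      · exact absurd h hne
    refine ⟨qInv * h, regularAt_of_hasLim_zero ?_, ?_⟩
    · rw [map_zero, sub_zero, ← mul_assoc, qMer_mul_qInv, one_mul]
      exact ha0 ▸ ha
    · rw [hgh, pow_succ, mul_assoc, ← mul_assoc qMer, qMer_mul_qInv, one_mul]

/-! ### Elliptic functions -/

section Elliptic

variable {L : PeriodPair}

theorem isElliptic_algebraMap (a : ℂ) : IsElliptic L (algebraMap ℂ Mer a) :=
  ⟨fun _ => a, ⟨fun _ => MeromorphicAt.const _ _, rfl⟩, fun _ _ _ => rfl⟩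

theorem IsElliptic.add {f g : Mer} (hf : IsElliptic L f) (hg : IsElliptic L g) :
    IsElliptic L (f + g) := by
  obtain ⟨F, ⟨hF, rfl⟩, h1⟩ := hf
  obtain ⟨G, ⟨hG, rfl⟩, h2⟩ := hg
  refine ⟨F + G, ⟨fun x => (hF x).add (hG x), rfl⟩, fun l hl z => ?_⟩
  rw [Pi.add_apply, Pi.add_apply, h1 l hl, h2 l hl]

theorem IsElliptic.mul {f g : Mer} (hf : IsElliptic L f) (hg : IsElliptic L g) :
    IsElliptic L (f * g) := by
  obtain ⟨F, ⟨hF, rfl⟩, h1⟩ := hf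
  obtain ⟨G, ⟨hG, rfl⟩, h2⟩ := hg
  refine ⟨F * G, ⟨fun x => (hF x).mul (hG x), rfl⟩, fun l hl z => ?_⟩
  rw [Pi.mul_apply, Pi.mul_apply, h1 l hl, h2 l hl]

theorem IsElliptic.smul {f : Mer} (a : ℂ) (hf : IsElliptic L f) : IsElliptic L (a • f) := by
  rw [Algebra.smul_def]
  exact (isElliptic_algebraMap a).mul hf

theorem IsElliptic.ddq {f : Mer} (hf : IsElliptic L f) : IsElliptic L (ddq f) := by
  obtain ⟨F, ⟨hF, rfl⟩, h1⟩ := hf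
  refine ⟨deriv F, ⟨fun x => (hF x).deriv, rfl⟩, fun l hl z => ?_⟩
  rw [← deriv_comp_add_const]
  exact congrArg (fun G => deriv G z) (funext fun z => h1 l hl z)

theorem IsElliptic.rot {f : Mer} (hf : IsElliptic L f) (u : ℂˣ)
    (hu : ∀ z ∈ L.lattice, (u : ℂ) * z ∈ L.lattice) : IsElliptic L (rotHom u f) := by
  obtain ⟨F, ⟨hF, rfl⟩, h1⟩ := hf
  refine ⟨fun z => F (u * z), ⟨meromorphicAt_rot u hF, rfl⟩, fun l hl z => ?_⟩
  change F (u * (z + l)) = F (u * z)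
  rw [mul_add, h1 _ (hu l hl)]

theorem IsElliptic.sum {ι : Type*} {s : Finset ι} {f : ι → Mer}
    (h : ∀ i ∈ s, IsElliptic L (f i)) : IsElliptic L (∑ i ∈ s, f i) := by
  classical
  induction s using Finset.induction_on with
  | empty => simpa using isElliptic_algebraMap (L := L) 0
  | insert i s hi ih =>
    rw [Finset.sum_insert hi]
    exact (h i (by simp)).add (ih fun j hj => h j (by simp [hj]))

theorem tendsto_add_punctured (x l : ℂ) : Tendsto (fun z => z + l) (𝓝[≠] x) (𝓝[≠] (x + l)) := by
  refine tendsto_nhdsWithin_iff.2 ⟨?_, ?_⟩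
  · exact ((continuous_add_const l).tendsto x).mono_left nhdsWithin_le_nhds
  · filter_upwards [self_mem_nhdsWithin] with z hz h
    exact hz (add_right_cancel h)

theorem IsElliptic.hasLim_add {f : Mer} (hf : IsElliptic L f) {x a : ℂ} (h : HasLim f x a)
    {l : ℂ} (hl : l ∈ L.lattice) : HasLim f (x + l) a := by
  obtain ⟨F, hF, h1⟩ := hf
  refine ⟨F, hF, ?_⟩
  have h2 := (h.tendsto hF).comp (tendsto_add_punctured (x + l) (-l) |>.mono_right (by simp))
  refine h2.congr fun z => ?_
  exact h1 (-l) (neg_mem hl) z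

theorem IsElliptic.regularAt_add {f : Mer} (hf : IsElliptic L f) {x : ℂ} (h : RegularAt f x)
    {l : ℂ} (hl : l ∈ L.lattice) : RegularAt f (x + l) := by
  obtain ⟨a, ha⟩ := regularAt_iff.1 h
  exact (hf.hasLim_add ha hl).regularAt

/-- Liouville's theorem for elliptic functions. -/
theorem IsElliptic.eq_algebraMap {f : Mer} (hf : IsElliptic L f) (h : ∀ x, RegularAt f x) :
    ∃ a, f = algebraMap ℂ Mer a := by
  -- The values of a representative at single points carry no information, so the entire function is
  -- assembled from the limits.
  choose A hA using fun x => regularAt_iff.1 (h x)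
  have hloc : ∀ x, ∃ F, Represents F f ∧ AnalyticAt ℂ F x ∧ A =ᶠ[𝓝 x] F := by
    intro x
    obtain ⟨F, hF, hAn, hx⟩ := exists_analyticAt_of_hasLim (hA x)
    refine ⟨F, hF, hAn, ?_⟩
    filter_upwards [hAn.eventually_analyticAt] with z hz
    refine (hA z).unique ⟨F, hF, ?_⟩
    exact hz.continuousAt.tendsto.mono_left nhdsWithin_le_nhds
  have hd : Differentiable ℂ A := fun x => by
    obtain ⟨F, -, hAn, hE⟩ := hloc x
    exact (hAn.congr hE.symm).differentiableAt
  have hper : ∀ z, ∀ w ∈ L.lattice, A (z + w) = A z := fun z w hw =>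
    (hA (z + w)).unique (hf.hasLim_add (hA z) hw)
  have hc : ∀ x, A x = A 0 := fun x =>
    hd.apply_eq_apply_of_bounded (IsZLattice.isCompact_range_of_periodic L.lattice _
      hd.continuous hper).isBounded x 0
  refine ⟨A 0, ?_⟩
  obtain ⟨F, ⟨hF, rfl⟩, -⟩ := hf
  refine (toMer_eq_iff _ (algebraMap ℂ merFun (A 0))).2 fun x => ?_
  obtain ⟨G, hG, -, hE⟩ := hloc x
  filter_upwards [Represents.eventuallyEq ⟨hF, rfl⟩ hG x, nhdsWithin_le_nhds hE] with z h1 h2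
  change F z = A 0
  rw [h1, ← h2, hc]

end Elliptic

/-! ### Rings of differential operators and of symbols, abstractly -/

section Abstract

variable {R : Type} [Ring R] [Algebra ℂ R]

/-- The properties of the momentum shared by differential operators and classical symbols. -/
structure IsMomentum (ι : Mer →ₐ[ℂ] R) (P : R) (ħ : ℂ) (m : ℕ) [NeZero m]
    [MulSemiringAction (Zm m) R] : Prop where
  mul_coeff : ∀ f, P * ι f = ι f * P + ħ • ι (ddq f)
  smul_coeff : ∀ f, s m • ι f = ι (rotHom (rootChar m (s m)) f)
  smul_momentum : s m • P = (ω m)⁻¹ • P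
  coeff_eq_zero : ∀ n (a : ℕ → Mer),
    ∑ k ∈ Finset.range (n + 1), ι (a k) * P ^ k = 0 → a n = 0

/-- The elements `∑_{k<n} a_k η_k` with coefficients `a_k ∈ K`. -/
def coeffSpan (ι : Mer →ₐ[ℂ] R) (K : Subalgebra ℂ Mer) (η : ℕ → R) (n : ℕ) : AddSubgroup R where
  carrier := {r | ∃ a : ℕ → Mer, (∀ k, a k ∈ K) ∧ r = ∑ k ∈ Finset.range n, ι (a k) * η k}
  zero_mem' := ⟨0, fun _ => K.zero_mem, by simp⟩
  add_mem' := by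
    rintro _ _ ⟨a, ha, rfl⟩ ⟨b, hb, rfl⟩
    exact ⟨a + b, fun k => K.add_mem (ha k) (hb k), by
      simp [add_mul, Finset.sum_add_distrib]⟩
  neg_mem' := by
    rintro _ ⟨a, ha, rfl⟩
    exact ⟨-a, fun k => K.neg_mem (ha k), by simp⟩

/-! ### Module operations on spans over a ring of functions -/

section CoeffSpan

variable {ι : Mer →ₐ[ℂ] R} {K : Subalgebra ℂ Mer} {η : ℕ → R} {n : ℕ}

theorem mul_mem_coeffSpan {a : Mer} (ha : a ∈ K) {k : ℕ} (hk : k < n) :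
    ι a * η k ∈ coeffSpan ι K η n := by
  classical
  refine ⟨fun j => if j = k then a else 0, fun j => ?_, ?_⟩
  · dsimp only
    split_ifs
    exacts [ha, K.zero_mem]
  · rw [Finset.sum_eq_single_of_mem k (Finset.mem_range.2 hk)]
    · simp
    · intro j _ hj
      simp [hj]

theorem coeffSpan_le {T : AddSubgroup R} (h : ∀ a ∈ K, ∀ k < n, ι a * η k ∈ T) :
    coeffSpan ι K η n ≤ T := by
  rintro _ ⟨a, ha, rfl⟩
  exact sum_mem fun k hk => h _ (ha k) k (Finset.mem_range.1 hk)

theorem coeffSpan_mono {n' : ℕ} (h : n ≤ n') : coeffSpan ι K η n ≤ coeffSpan ι K η n' :=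
  coeffSpan_le fun _ ha _ hk => mul_mem_coeffSpan ha (hk.trans_le h)

theorem coeff_mul_mem_coeffSpan {f : Mer} (hf : f ∈ K) {r : R} (hr : r ∈ coeffSpan ι K η n) :
    ι f * r ∈ coeffSpan ι K η n := by
  have : coeffSpan ι K η n ≤ (coeffSpan ι K η n).comap (AddMonoidHom.mulLeft (ι f)) :=
    coeffSpan_le fun a ha k hk => by
      change ι f * (ι a * η k) ∈ coeffSpan ι K η n
      rw [← mul_assoc, ← map_mul]
      exact mul_mem_coeffSpan (K.mul_mem hf ha) hk
  exact this hr

theorem smul_mem_coeffSpan (t : ℂ) {r : R} (hr : r ∈ coeffSpan ι K η n) :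
    t • r ∈ coeffSpan ι K η n := by
  have := coeff_mul_mem_coeffSpan (K.algebraMap_mem t) hr
  rwa [AlgHom.commutes, ← Algebra.smul_def] at this

theorem mem_coeffSpan_self {k : ℕ} (hk : k < n) : η k ∈ coeffSpan ι K η n := by
  simpa using mul_mem_coeffSpan (ι := ι) (η := η) K.one_mem hk

end CoeffSpan

variable (ι : Mer →ₐ[ℂ] R) (P : R) (ħ : ℂ) (m : ℕ) [NeZero m] [MulSemiringAction (Zm m) R]

/-- The operator by which a Dunkl operator acts on `R`. -/
def dunklMap (b : ℕ → Mer) : R →+ R where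
  toFun r := P * r - ∑ l ∈ Finset.Ico 1 m, ι (b l) * (s m ^ l • r)
  map_zero' := by simp
  map_add' x y := by
    simp only [mul_add, smul_add, Finset.sum_add_distrib]
    abel

theorem dunklMap_apply (b : ℕ → Mer) (r : R) :
    dunklMap ι P m b r = P * r - ∑ l ∈ Finset.Ico 1 m, ι (b l) * (s m ^ l • r) := rfl

/-- The elements `y^k · 1`. -/
def dunklPow (b : ℕ → Mer) (k : ℕ) : R := (dunklMap ι P m b)^[k] 1

theorem dunklPow_zero (b : ℕ → Mer) : dunklPow ι P m b 0 = 1 := rfl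

theorem dunklPow_succ (b : ℕ → Mer) (k : ℕ) :
    dunklPow ι P m b (k + 1) = dunklMap ι P m b (dunklPow ι P m b k) :=
  Function.iterate_succ_apply' _ _ _

/-- Stability conditions on a ring of functions, under which the span of the `y^k · 1` is stable
under the Cherednik algebra. -/
structure Compatible (b : ℕ → Mer) (K : Subalgebra ℂ Mer) : Prop where
  rot_mem : ∀ f ∈ K, rotHom (rootChar m (s m)) f ∈ K
  ddq_mem : ∀ f ∈ K, ddq f ∈ K
  mul_sub_mem : ∀ l ∈ Finset.Ico 1 m, ∀ f ∈ K, b l * (rotHom (rootChar m (s m) ^ l) f - f) ∈ K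
  sub_rot_mem : ∀ l ∈ Finset.Ico 1 m, (ω m)⁻¹ • b l - rotHom (rootChar m (s m)) (b l) ∈ K

/-- With b = 0 and no condition on the coefficients, the stability lemma for spans turns into
statements about the order filtration: `IsMomentum.smul_mem_ordLT` and `IsMomentum.mul_mem_ordLT`.
-/
theorem compatible_top (b : ℕ → Mer) : Compatible m b ⊤ where
  rot_mem _ _ := trivial
  ddq_mem _ _ := trivial
  mul_sub_mem _ _ _ _ := trivial
  sub_rot_mem _ _ := trivial

/-! ### Commutation relations and stability of the span of the y^k·1 -/

variable {ι P ħ m}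

theorem IsMomentum.smul_pow_coeff (h : IsMomentum ι P ħ m) (l : ℕ) (f : Mer) :
    s m ^ l • ι f = ι (rotHom (rootChar m (s m) ^ l) f) := by
  induction l with
  | zero => simp [rotHom_one]
  | succ l ih => rw [pow_succ', mul_smul, ih, h.smul_coeff, pow_succ', rotHom_mul]

theorem IsMomentum.smul_complex (h : IsMomentum ι P ħ m) (t : ℂ) (r : R) :
    s m • (t • r) = t • (s m • r) := by
  rw [Algebra.smul_def, Algebra.smul_def, ← ι.commutes, smul_mul', h.smul_coeff, AlgHom.commutes]

/-- The commutator of y with a function: b_l enters only through b_l · (s^l f - f), where the zero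
of the difference at a fixed point compensates the pole of b_l. This is the origin of
`Compatible.mul_sub_mem`. -/
theorem IsMomentum.dunklMap_coeff_mul (h : IsMomentum ι P ħ m) (b : ℕ → Mer) (f : Mer) (r : R) :
    dunklMap ι P m b (ι f * r) = ι f * dunklMap ι P m b r + ħ • (ι (ddq f) * r) -
      ∑ l ∈ Finset.Ico 1 m,
        ι (b l * (rotHom (rootChar m (s m) ^ l) f - f)) * (s m ^ l • r) := by
  have h1 : ∀ l, ι (b l) * (s m ^ l • (ι f * r)) =
      ι f * (ι (b l) * (s m ^ l • r)) +
        ι (b l * (rotHom (rootChar m (s m) ^ l) f - f)) * (s m ^ l • r) := fun l => by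
    rw [smul_mul', h.smul_pow_coeff, ← mul_assoc, ← mul_assoc, ← map_mul, ← map_mul, ← add_mul,
      ← map_add]
    congr 2
    ring
  simp only [dunklMap_apply, h1, Finset.sum_add_distrib, mul_sub, Finset.mul_sum]
  rw [← mul_assoc, h.mul_coeff, add_mul, smul_mul_assoc, mul_assoc]
  abel

/-- The relation s y = ω⁻¹ y s holds up to the coefficients ω⁻¹ b_l - s(b_l), in which the residues
cancel. This is the origin of `Compatible.sub_rot_mem`. -/
theorem IsMomentum.smul_dunklMap (h : IsMomentum ι P ħ m) (b : ℕ → Mer) (r : R) :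
    s m • dunklMap ι P m b r = (ω m)⁻¹ • dunklMap ι P m b (s m • r) +
      ∑ l ∈ Finset.Ico 1 m,
        ι ((ω m)⁻¹ • b l - rotHom (rootChar m (s m)) (b l)) * (s m ^ l • (s m • r)) := by
  simp only [dunklMap_apply, smul_sub, smul_mul', Finset.smul_sum, h.smul_coeff, h.smul_momentum,
    map_sub, map_smul, sub_mul, smul_mul_assoc, Finset.sum_sub_distrib]
  have : ∀ l, s m • (s m ^ l • r) = s m ^ l • (s m • r) := fun l => by
    rw [smul_smul, smul_smul, ← pow_succ, ← pow_succ']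
  simp only [this]
  abel

/-- Elements of order `< n`. -/
abbrev ordLT (ι : Mer →ₐ[ℂ] R) (P : R) (n : ℕ) : AddSubgroup R :=
  coeffSpan ι ⊤ (fun k => P ^ k) n

theorem smul_pow_mem {T : AddSubgroup R} (hT : ∀ r ∈ T, s m • r ∈ T) (l : ℕ) {r : R}
    (hr : r ∈ T) : s m ^ l • r ∈ T := by
  induction l with
  | zero => simpa using hr
  | succ l ih =>
    rw [pow_succ', mul_smul]
    exact hT _ ih

/-- The PBW argument: the commutation relations push s and y to the right through the coefficients,
at the cost of terms of lower index with coefficients still in `K`. -/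
theorem IsMomentum.coeffSpan_stable (h : IsMomentum ι P ħ m) {b : ℕ → Mer}
    {K : Subalgebra ℂ Mer} (hb : Compatible m b K) (n : ℕ) :
    (∀ r ∈ coeffSpan ι K (dunklPow ι P m b) n, s m • r ∈ coeffSpan ι K (dunklPow ι P m b) n) ∧
    (∀ r ∈ coeffSpan ι K (dunklPow ι P m b) n,
      dunklMap ι P m b r ∈ coeffSpan ι K (dunklPow ι P m b) (n + 1)) := by
  -- Stability under y at level n needs only stability under s at the same level. Conversely s at
  -- level n + 1 needs both at level n, because y^(k+1)·1 = y·(y^k·1); the induction below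
  -- alternates the two.
  have step : ∀ n, (∀ r ∈ coeffSpan ι K (dunklPow ι P m b) n,
        s m • r ∈ coeffSpan ι K (dunklPow ι P m b) n) →
      (∀ r ∈ coeffSpan ι K (dunklPow ι P m b) n,
        dunklMap ι P m b r ∈ coeffSpan ι K (dunklPow ι P m b) (n + 1)) := by
    intro n hs
    suffices H : coeffSpan ι K (dunklPow ι P m b) n ≤
        (coeffSpan ι K (dunklPow ι P m b) (n + 1)).comap (dunklMap ι P m b) from fun r hr => H hr
    refine coeffSpan_le fun a ha k hk => ?_
    rw [AddSubgroup.mem_comap, h.dunklMap_coeff_mul, ← dunklPow_succ]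
    refine sub_mem (add_mem (mul_mem_coeffSpan ha (by omega)) (smul_mem_coeffSpan _
      (mul_mem_coeffSpan (hb.ddq_mem a ha) (by omega)))) (sum_mem fun l hl => ?_)
    exact coeff_mul_mem_coeffSpan (hb.mul_sub_mem l hl a ha)
      (coeffSpan_mono n.le_succ (smul_pow_mem hs l (mem_coeffSpan_self hk)))
  suffices H : ∀ r ∈ coeffSpan ι K (dunklPow ι P m b) n,
      s m • r ∈ coeffSpan ι K (dunklPow ι P m b) n from ⟨H, step n H⟩
  induction n with
  | zero =>
    rintro _ ⟨a, -, rfl⟩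
    simp
  | succ n ih =>
    suffices H : coeffSpan ι K (dunklPow ι P m b) (n + 1) ≤
        (coeffSpan ι K (dunklPow ι P m b) (n + 1)).comap
          (DistribSMul.toAddMonoidHom R (s m)) from fun r hr => H hr
    refine coeffSpan_le fun a ha k hk => ?_
    change s m • (ι a * dunklPow ι P m b k) ∈ coeffSpan ι K (dunklPow ι P m b) (n + 1)
    rw [smul_mul', h.smul_coeff]
    refine coeff_mul_mem_coeffSpan (hb.rot_mem a ha) ?_
    rcases k with _ | k
    · rw [dunklPow_zero, smul_one]
      exact mem_coeffSpan_self (η := dunklPow ι P m b) (k := 0) (by omega)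
    · have hk' : s m • dunklPow ι P m b k ∈ coeffSpan ι K (dunklPow ι P m b) n :=
        ih _ (mem_coeffSpan_self (by omega))
      rw [dunklPow_succ, h.smul_dunklMap]
      refine add_mem (smul_mem_coeffSpan _ (step n ih _ hk')) (sum_mem fun l hl => ?_)
      exact coeff_mul_mem_coeffSpan (hb.sub_rot_mem l hl)
        (coeffSpan_mono n.le_succ (smul_pow_mem ih l hk'))

theorem dunklMap_zero (r : R) : dunklMap ι P m 0 r = P * r := by
  simp [dunklMap_apply]

theorem dunklPow_zero_coeff (k : ℕ) : dunklPow ι P m 0 k = P ^ k := by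
  induction k with
  | zero => simp [dunklPow_zero]
  | succ k ih => rw [dunklPow_succ, ih, dunklMap_zero, pow_succ']

theorem IsMomentum.smul_mem_ordLT (h : IsMomentum ι P ħ m) {n : ℕ} {r : R}
    (hr : r ∈ ordLT ι P n) : s m • r ∈ ordLT ι P n := by
  have := (h.coeffSpan_stable (compatible_top m 0) n).1
  simp only [show dunklPow ι P m 0 = fun k => P ^ k from funext dunklPow_zero_coeff] at this
  exact this r hr

theorem IsMomentum.mul_mem_ordLT (h : IsMomentum ι P ħ m) {n : ℕ} {r : R}
    (hr : r ∈ ordLT ι P n) : P * r ∈ ordLT ι P (n + 1) := by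
  have := (h.coeffSpan_stable (compatible_top m 0) n).2
  simp only [show dunklPow ι P m 0 = fun k => P ^ k from funext dunklPow_zero_coeff,
    dunklMap_zero] at this
  exact this r hr

theorem coeff_mul_mem_ordLT (f : Mer) {n : ℕ} {r : R} (hr : r ∈ ordLT ι P n) :
    ι f * r ∈ ordLT ι P n := coeff_mul_mem_coeffSpan (K := ⊤) (f := f) trivial hr

theorem IsMomentum.pow_mul_mem_ordLT (h : IsMomentum ι P ħ m) {n : ℕ} {r : R}
    (hr : r ∈ ordLT ι P n) (k : ℕ) : P ^ k * r ∈ ordLT ι P (n + k) := by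
  induction k with
  | zero => simpa using hr
  | succ k ih =>
    rw [pow_succ', mul_assoc]
    exact h.mul_mem_ordLT ih

theorem mem_ordLT_of_monic {n : ℕ} {r : R} (hr : r - P ^ n ∈ ordLT ι P n) :
    r ∈ ordLT ι P (n + 1) := by
  have := add_mem (coeffSpan_mono n.le_succ hr)
    (mem_coeffSpan_self (ι := ι) (K := ⊤) (η := fun k => P ^ k) n.lt_succ_self)
  simpa using this

theorem IsMomentum.monic_mul (h : IsMomentum ι P ħ m) {j k : ℕ} {r t : R}
    (hr : r - P ^ j ∈ ordLT ι P j) (ht : t - P ^ k ∈ ordLT ι P k) :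
    r * t - P ^ (j + k) ∈ ordLT ι P (j + k) := by
  have h1 : r * t - P ^ (j + k) = (r - P ^ j) * t + P ^ j * (t - P ^ k) := by
    rw [pow_add]
    noncomm_ring
  have h2 : ordLT ι P j ≤ (ordLT ι P (j + k)).comap (AddMonoidHom.mulRight t) := by
    refine coeffSpan_le fun a _ i hi => ?_
    change ι a * P ^ i * t ∈ ordLT ι P (j + k)
    rw [mul_assoc]
    exact coeff_mul_mem_ordLT a (coeffSpan_mono (by omega)
      (h.pow_mul_mem_ordLT (mem_ordLT_of_monic ht) i))
  rw [h1]
  refine add_mem (h2 hr) ?_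
  rw [add_comm j k]
  exact h.pow_mul_mem_ordLT ht j

theorem IsMomentum.monic_pow (h : IsMomentum ι P ħ m) {n : ℕ} {r : R}
    (hr : r - P ^ n ∈ ordLT ι P n) (k : ℕ) : r ^ k - P ^ (n * k) ∈ ordLT ι P (n * k) := by
  induction k with
  | zero => simp
  | succ k ih =>
    rw [pow_succ, mul_add, mul_one]
    exact h.monic_mul ih hr

theorem IsMomentum.eq_zero_of_mul_pow_mem (h : IsMomentum ι P ħ m) {n : ℕ} {a : Mer}
    (ha : ι a * P ^ n ∈ ordLT ι P n) : a = 0 := by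
  obtain ⟨b, -, hb⟩ := ha
  have := h.coeff_eq_zero n (fun k => if k = n then a else -b k) ?_
  · simpa using this
  · rw [Finset.sum_range_succ, if_pos rfl, hb, ← Finset.sum_add_distrib]
    refine Finset.sum_eq_zero fun k hk => ?_
    rw [if_neg (Finset.mem_range.1 hk).ne]
    simp

theorem IsMomentum.dunklPow_monic (h : IsMomentum ι P ħ m) (b : ℕ → Mer) (k : ℕ) :
    dunklPow ι P m b k - P ^ k ∈ ordLT ι P k := by
  induction k with
  | zero => simp [dunklPow_zero]
  | succ k ih =>
    have h1 : dunklPow ι P m b (k + 1) - P ^ (k + 1) = P * (dunklPow ι P m b k - P ^ k) -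
        ∑ l ∈ Finset.Ico 1 m, ι (b l) * (s m ^ l • dunklPow ι P m b k) := by
      rw [dunklPow_succ, dunklMap_apply, pow_succ']
      noncomm_ring
    rw [h1]
    refine sub_mem (h.mul_mem_ordLT ih) (sum_mem fun l _ => coeff_mul_mem_ordLT _ ?_)
    exact smul_pow_mem (fun _ => h.smul_mem_ordLT) l (mem_ordLT_of_monic ih)

/-! ### Families that are monic in the momentum -/

section Monic

variable {η : ℕ → R} {K : Subalgebra ℂ Mer}

theorem coeff_mul_sub_mem_ordLT (hη : ∀ k, η k - P ^ k ∈ ordLT ι P k) (a : Mer) (k : ℕ) :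
    ι a * η k - ι a * P ^ k ∈ ordLT ι P k := by
  rw [← mul_sub]
  exact coeff_mul_mem_ordLT a (hη k)

theorem coeffSpan_le_ordLT (hη : ∀ k, η k - P ^ k ∈ ordLT ι P k) (n : ℕ) :
    coeffSpan ι K η n ≤ ordLT ι P n :=
  coeffSpan_le fun a _ k hk =>
    coeff_mul_mem_ordLT a (coeffSpan_mono hk (mem_ordLT_of_monic (hη k)))

theorem sum_sub_mem_ordLT (hη : ∀ k, η k - P ^ k ∈ ordLT ι P k) (a : ℕ → Mer) (n : ℕ) :
    ∑ k ∈ Finset.range (n + 1), ι (a k) * η k - ι (a n) * P ^ n ∈ ordLT ι P n := by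
  rw [Finset.sum_range_succ, add_sub_assoc]
  exact add_mem (coeffSpan_le_ordLT (K := ⊤) hη n ⟨a, fun _ => trivial, rfl⟩)
    (coeff_mul_sub_mem_ordLT hη _ n)

theorem IsMomentum.coeff_eq_zero_of_sum (h : IsMomentum ι P ħ m)
    (hη : ∀ k, η k - P ^ k ∈ ordLT ι P k) {n : ℕ} {a : ℕ → Mer}
    (ha : ∑ k ∈ Finset.range n, ι (a k) * η k = 0) : ∀ k < n, a k = 0 := by
  induction n with
  | zero => intro k hk; omega
  | succ n ih =>
    have h1 := sum_sub_mem_ordLT hη a n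
    rw [ha, zero_sub, neg_mem_iff] at h1
    have h2 := h.eq_zero_of_mul_pow_mem h1
    rw [Finset.sum_range_succ, h2, map_zero, zero_mul, add_zero] at ha
    intro k hk
    rcases Nat.lt_succ_iff_lt_or_eq.1 hk with hk | rfl
    exacts [ih ha k hk, h2]

/-- Coefficients with respect to a monic family are unique, so the two expansions of `r` coincide.
This is what allows membership to be tested separately near the origin and away from it. -/
theorem IsMomentum.mem_coeffSpan_inf (h : IsMomentum ι P ħ m)
    (hη : ∀ k, η k - P ^ k ∈ ordLT ι P k) {K' : Subalgebra ℂ Mer} {n n' : ℕ} {r : R}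
    (h1 : r ∈ coeffSpan ι K η n) (h2 : r ∈ coeffSpan ι K' η n') :
    r ∈ coeffSpan ι (K ⊓ K') η (max n n') := by
  classical
  obtain ⟨a, ha, rfl⟩ := coeffSpan_mono (le_max_left n n') h1
  obtain ⟨a', ha', he⟩ := coeffSpan_mono (le_max_right n n') h2
  have h3 : ∀ k < max n n', a k = a' k := fun k hk => sub_eq_zero.1 <|
    h.coeff_eq_zero_of_sum hη (a := a - a') (by simp [sub_mul, he]) k hk
  refine sum_mem fun k hk => ?_
  have hk' := Finset.mem_range.1 hk
  exact mul_mem_coeffSpan (Algebra.mem_inf.2 ⟨ha k, h3 k hk' ▸ ha' k⟩) hk'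

/-- The expansion may formally have length beyond n + 1; since `r` has order at most n, its higher
coefficients vanish from the top down. The leading coefficient of `r` in P is then one of the
coefficients from `K`. -/
theorem IsMomentum.exists_leading (h : IsMomentum ι P ħ m)
    (hη : ∀ k, η k - P ^ k ∈ ordLT ι P k) {n N : ℕ} {r : R}
    (h1 : r ∈ coeffSpan ι K η N) (h2 : r ∈ ordLT ι P (n + 1)) :
    ∃ a ∈ K, r - ι a * P ^ n ∈ ordLT ι P n := by
  have key : r ∈ coeffSpan ι K η (n + 1) := by
    induction N with
    | zero => exact coeffSpan_mono (Nat.zero_le _) h1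
    | succ N ih =>
      rcases Nat.lt_or_ge n N with hN | hN
      · obtain ⟨a, ha, rfl⟩ := h1
        have h3 := sum_sub_mem_ordLT hη a N
        have h4 : a N = 0 := h.eq_zero_of_mul_pow_mem <| by
          have := sub_mem (coeffSpan_mono (show n + 1 ≤ N by omega) h2) h3
          simpa using this
        refine ih ⟨a, ha, ?_⟩
        rw [Finset.sum_range_succ, h4, map_zero, zero_mul, add_zero]
      · exact coeffSpan_mono (by omega) h1
  obtain ⟨a, ha, rfl⟩ := key
  exact ⟨a n, ha n, sum_sub_mem_ordLT hη a n⟩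

end Monic

/-! ### The action of the crossed product on `R` -/

variable (R m) in
/-- `R ⋊ ℤ_m` acts on `R`. -/
def act : SkewMonoidAlgebra R (Zm m) →+* AddMonoid.End R :=
  SkewMonoidAlgebra.liftNCRingHom (Module.toAddMonoidEnd R R)
    (DistribMulAction.toAddMonoidEnd (Zm m) R) fun {x g} => by
      ext r
      change (g • x) * (g • r) = g • (x * r)
      rw [smul_mul']

theorem act_single (g : Zm m) (x r : R) :
    act R m (SkewMonoidAlgebra.single g x) r = x * (g • r) := by
  have := SkewMonoidAlgebra.liftNC_single (Module.toAddMonoidEnd R R : R →+ AddMonoid.End R)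
    (DistribMulAction.toAddMonoidEnd (Zm m) R) g x
  exact DFunLike.congr_fun this r

theorem act_add (a b : SkewMonoidAlgebra R (Zm m)) (r : R) :
    act R m (a + b) r = act R m a r + act R m b r := by
  rw [map_add]
  rfl

theorem act_sub (a b : SkewMonoidAlgebra R (Zm m)) (r : R) :
    act R m (a - b) r = act R m a r - act R m b r := by
  rw [map_sub]
  rfl

theorem act_mul (a b : SkewMonoidAlgebra R (Zm m)) (r : R) :
    act R m (a * b) r = act R m a (act R m b r) := by
  rw [map_mul]
  rfl

theorem act_sum {κ : Type*} (t : Finset κ) (a : κ → SkewMonoidAlgebra R (Zm m)) (r : R) :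
    act R m (∑ i ∈ t, a i) r = ∑ i ∈ t, act R m (a i) r := by
  classical
  induction t using Finset.induction_on with
  | empty => simp
  | insert i t hi ih => rw [Finset.sum_insert hi, Finset.sum_insert hi, act_add, ih]

/-- The action consists of left multiplications and automorphisms, so it commutes with right
multiplication by an invariant element. -/
theorem act_invariant (a : SkewMonoidAlgebra R (Zm m)) {r : R} (hr : s m • r = r) :
    act R m a r = act R m a 1 * r := by
  have hg : ∀ g : Zm m, g • r = r := fun g => by
    have h1 : g = s m ^ (Multiplicative.toAdd g).val := by
      rw [s, ← ofAdd_nsmul]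
      simp
    rw [h1]
    generalize (Multiplicative.toAdd g).val = k
    induction k with
    | zero => simp
    | succ k ih => rw [pow_succ', mul_smul, ih, hr]
  induction a using SkewMonoidAlgebra.induction_on with
  | zero => simp
  | single g x => rw [act_single, act_single, hg, smul_one, mul_one]
  | add a b ha hb =>
    rw [act_add, act_add, ha, hb, add_mul]

theorem θ_eq_act (a : SkewMonoidAlgebra R (Zm m)) : θ a = act R m a 1 := by
  induction a using SkewMonoidAlgebra.induction_on with
  | zero => simp [θ]
  | single g x =>
    rw [act_single, smul_one, mul_one]
    exact SkewMonoidAlgebra.sum_single_index rfl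
  | add a b ha hb =>
    rw [act_add, ← ha, ← hb]
    exact SkewMonoidAlgebra.sum_add_index' (fun _ => rfl) fun _ _ _ => rfl

theorem act_dunkl (b : ℕ → Mer) (r : R) :
    act R m (dunkl ι P b) r = dunklMap ι P m b r := by
  rw [dunkl, act_sub, act_sum, act_single, dunklMap_apply, one_smul]
  congr 1
  exact Finset.sum_congr rfl fun l _ => act_single _ _ _

theorem act_dunkl_pow (b : ℕ → Mer) (k : ℕ) :
    act R m (dunkl ι P b ^ k) 1 = dunklPow ι P m b k := by
  induction k with
  | zero => simp [dunklPow_zero]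
  | succ k ih =>
    rw [pow_succ', act_mul, ih, act_dunkl, dunklPow_succ]

theorem act_e (r : R) :
    act R m (e R m) r = (m : ℂ)⁻¹ • ∑ j ∈ Finset.range m, s m ^ j • r := by
  rw [e, Finset.smul_sum, act_sum, Finset.smul_sum]
  refine Finset.sum_congr rfl fun j _ => ?_
  rw [SkewMonoidAlgebra.smul_single, act_single, smul_mul_assoc, one_mul]

theorem act_e_of_invariant {r : R} (hr : s m • r = r) : act R m (e R m) r = r := by
  have h : ∀ j, s m ^ j • r = r := fun j => by
    induction j with
    | zero => simp
    | succ k ih => rw [pow_succ', mul_smul, ih, hr]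
  rw [act_e]
  simp only [h, Finset.sum_const, Finset.card_range]
  rw [← Nat.cast_smul_eq_nsmul ℂ, smul_smul, inv_mul_cancel₀ (by simp [NeZero.ne]), one_smul]

theorem s_pow (m : ℕ) : s m ^ m = 1 := by
  rw [s, ← ofAdd_nsmul]
  simp

theorem IsMomentum.smul_act_e (h : IsMomentum ι P ħ m) (r : R) :
    s m • act R m (e R m) r = act R m (e R m) r := by
  rw [act_e, h.smul_complex, Finset.smul_sum]
  congr 1
  have h1 : ∀ j, s m • (s m ^ j • r) = s m ^ (j + 1) • r := fun j => by
    rw [smul_smul, pow_succ']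
  simp only [h1]
  have h2 := Finset.sum_range_succ (fun j => s m ^ j • r) m
  rw [Finset.sum_range_succ' (fun j => s m ^ j • r) m, s_pow, pow_zero] at h2
  exact add_right_cancel h2

end Abstract

theorem isPrimitiveRoot_ω (m : ℕ) [NeZero m] : IsPrimitiveRoot (ω m) m :=
  Complex.isPrimitiveRoot_exp m (NeZero.ne m)

theorem ω_ne_zero (m : ℕ) : ω m ≠ 0 := Complex.exp_ne_zero _

theorem ω_pow_mul_mem {m : ℕ} {L : PeriodPair} (hL : ∀ z ∈ L.lattice, ω m * z ∈ L.lattice) (l : ℕ)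
    {z : ℂ} (hz : z ∈ L.lattice) : ω m ^ l * z ∈ L.lattice := by
  induction l with
  | zero => simpa using hz
  | succ l ih =>
    rw [pow_succ', mul_assoc]
    exact hL _ ih

theorem pt_eq_iff {L : PeriodPair} {x y : ℂ} : pt L x = pt L y ↔ x - y ∈ L.lattice :=
  Submodule.Quotient.eq L.lattice

/-! ### Rings of regular functions -/

/-- The algebra of elliptic functions regular on a set. -/
def regularSubalgebra (L : PeriodPair) (U : Set ℂ) : Subalgebra ℂ Mer where
  carrier := regularFunctions L U
  mul_mem' hf hg := ⟨hf.1.mul hg.1, fun x hx => (hf.2 x hx).mul (hg.2 x hx)⟩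
  add_mem' hf hg := ⟨hf.1.add hg.1, fun x hx => (hf.2 x hx).add (hg.2 x hx)⟩
  algebraMap_mem' a := ⟨isElliptic_algebraMap a, fun x _ => regularAt_algebraMap a x⟩

/-- The algebra of meromorphic functions regular at the origin. -/
def regularAtZero : Subalgebra ℂ Mer where
  carrier := {f | RegularAt f 0}
  mul_mem' hf hg := RegularAt.mul hf hg
  add_mem' hf hg := RegularAt.add hf hg
  algebraMap_mem' a := regularAt_algebraMap a 0

section Compat

variable {m : ℕ} [NeZero m] {L : PeriodPair} {c : Couplings m L} {U : Set ℂ} {b : ℕ → Mer}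

theorem rootChar_s_pow (l : ℕ) : ((rootChar m (s m) ^ l : ℂˣ) : ℂ) = ω m ^ l := by
  rw [Units.val_pow_eq_pow_val, rootChar_s]

theorem regularAt_sub_rot (hb : AdmissibleOn c U b) {l : ℕ} (hl : l ∈ Finset.Ico 1 m) {x : ℂ}
    (hx : x ∈ U) (hx' : ω m * x ∈ U) :
    RegularAt ((ω m)⁻¹ • b l - rotHom (rootChar m (s m)) (b l)) x := by
  have h1 := (hb l hl).2 _ hx'
  rw [c.invariant l hl] at h1
  have h2 := SimplePoleAt.rot (rootChar m (s m)) (f := b l) (x := x) (r := c.c l (pt L x))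
    (by rwa [rootChar_s])
  rw [rootChar_s] at h2
  have h3 := (((hb l hl).2 _ hx).smul (ω m)⁻¹).sub h2
  rw [sub_self] at h3
  exact h3.regularAt

/-- The set `S` is taken to be all of `U`, or `U` without the lattice; in the second case the
hamiltonian can be treated without meeting the pole at 0. -/
theorem compatible_regularSubalgebra (hL : ∀ z ∈ L.lattice, ω m * z ∈ L.lattice)
    (hb : AdmissibleOn c U b) {S : Set ℂ} (hSU : S ⊆ U) (hS : ∀ x ∈ S, ω m * x ∈ S) :
    Compatible m b (regularSubalgebra L S) := by
  have hSl : ∀ l : ℕ, ∀ x ∈ S, ω m ^ l * x ∈ S := fun l x hx => by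
    induction l with
    | zero => simpa using hx
    | succ l ih =>
      rw [pow_succ', mul_assoc]
      exact hS _ ih
  have hu : ∀ z ∈ L.lattice, ((rootChar m (s m) : ℂˣ) : ℂ) * z ∈ L.lattice := fun z hz => by
    rw [rootChar_s]
    exact hL z hz
  have hul : ∀ l : ℕ, ∀ z ∈ L.lattice, ((rootChar m (s m) ^ l : ℂˣ) : ℂ) * z ∈ L.lattice :=
    fun l z hz => by
      rw [rootChar_s_pow]
      exact ω_pow_mul_mem hL l hz
  refine ⟨fun f hf => ⟨hf.1.rot _ hu, fun x hx => RegularAt.rot _ ?_⟩,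
    fun f hf => ⟨hf.1.ddq, fun x hx => (hf.2 x hx).ddq⟩,
    fun l hl f hf => ⟨?_, fun x hx => ?_⟩, fun l hl => ⟨?_, fun x hx => ?_⟩⟩
  · rw [rootChar_s]
    exact hf.2 _ (hS x hx)
  · refine (hb l hl).1.mul ?_
    rw [sub_eq_add_neg, ← neg_one_smul ℂ f]
    exact (hf.1.rot _ (hul l)).add (hf.1.smul _)
  -- At a point fixed by s^l periodicity makes s^l f - f vanish, which cancels the simple pole of
  -- b_l; at any other point c_l(x) = 0 and b_l is itself regular.
  · by_cases hp : pt L (ω m ^ l * x) = pt L x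
    · obtain ⟨a, ha⟩ := regularAt_iff.1 (hf.2 x hx)
      have h1 := hf.1.hasLim_add ha (pt_eq_iff.1 hp)
      rw [add_sub_cancel, ← rootChar_s_pow] at h1
      have h2 := (h1.rot _).sub ha
      rw [sub_self] at h2
      exact ((hb l hl).2 x (hSU hx)).regularAt_mul h2
    · have h1 := (hb l hl).2 x (hSU hx)
      rw [c.eq_zero l hl x hp] at h1
      have h2 : RegularAt (rotHom (rootChar m (s m) ^ l) f) x := RegularAt.rot _ <| by
        rw [rootChar_s_pow]
        exact hf.2 _ (hSl l x hx)
      refine h1.regularAt.mul ?_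
      obtain ⟨a, ha⟩ := regularAt_iff.1 (hf.2 x hx)
      obtain ⟨a', ha'⟩ := regularAt_iff.1 h2
      exact (ha'.sub ha).regularAt
  · rw [sub_eq_add_neg, ← neg_one_smul ℂ (rotHom _ _)]
    exact ((hb l hl).1.smul _).add (((hb l hl).1.rot _ hu).smul _)
  · exact regularAt_sub_rot hb hl (hSU hx) (hSU (hS x hx))

theorem compatible_regularAtZero (hb : AdmissibleOn c U b) (h0 : (0 : ℂ) ∈ U) :
    Compatible m b regularAtZero := by
  refine ⟨fun f hf => RegularAt.rot _ ?_, fun f hf => RegularAt.ddq hf, fun l hl f hf => ?_,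
    fun l hl => regularAt_sub_rot hb hl h0 (by simpa using h0)⟩
  · rw [mul_zero]
    exact hf
  · obtain ⟨a, ha⟩ := regularAt_iff.1 hf
    have h2 := (HasLim.rot (rootChar m (s m) ^ l) (f := f) (x := 0) (a := a)
      (by rwa [mul_zero])).sub ha
    rw [sub_self] at h2
    exact ((hb l hl).2 0 h0).regularAt_mul h2

end Compat

/-! ### Sections over a chart and global sections -/

section Abstract

variable {R : Type} [Ring R] [Algebra ℂ R]
variable {ι : Mer →ₐ[ℂ] R} {P : R} {ħ : ℂ} {m : ℕ} [NeZero m] [MulSemiringAction (Zm m) R]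

variable (ι P m) in
/-- The elements `∑ a_k (y^k · 1)` with `a_k ∈ K`. -/
def dunklSpan (K : Subalgebra ℂ Mer) (b : ℕ → Mer) : AddSubgroup R where
  carrier := {r | ∃ n, r ∈ coeffSpan ι K (dunklPow ι P m b) n}
  zero_mem' := ⟨0, zero_mem _⟩
  add_mem' := by
    rintro x y ⟨n, hx⟩ ⟨n', hy⟩
    exact ⟨max n n', add_mem (coeffSpan_mono (le_max_left _ _) hx)
      (coeffSpan_mono (le_max_right _ _) hy)⟩
  neg_mem' := by
    rintro x ⟨n, hx⟩
    exact ⟨n, neg_mem hx⟩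

section DunklSpan

variable {K : Subalgebra ℂ Mer} {b : ℕ → Mer} {r : R}

theorem one_mem_dunklSpan : (1 : R) ∈ dunklSpan ι P m K b :=
  ⟨1, mem_coeffSpan_self (η := dunklPow ι P m b) zero_lt_one⟩

theorem coeff_mul_mem_dunklSpan {f : Mer} (hf : f ∈ K) (hr : r ∈ dunklSpan ι P m K b) :
    ι f * r ∈ dunklSpan ι P m K b := by
  obtain ⟨n, hn⟩ := hr
  exact ⟨n, coeff_mul_mem_coeffSpan hf hn⟩

theorem smul_mem_dunklSpan (t : ℂ) (hr : r ∈ dunklSpan ι P m K b) :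
    t • r ∈ dunklSpan ι P m K b := by
  obtain ⟨n, hn⟩ := hr
  exact ⟨n, smul_mem_coeffSpan t hn⟩

theorem IsMomentum.rot_mem_dunklSpan (h : IsMomentum ι P ħ m) (hb : Compatible m b K)
    (hr : r ∈ dunklSpan ι P m K b) : s m • r ∈ dunklSpan ι P m K b := by
  obtain ⟨n, hn⟩ := hr
  exact ⟨n, (h.coeffSpan_stable hb n).1 r hn⟩

theorem IsMomentum.dunklMap_mem_dunklSpan (h : IsMomentum ι P ħ m) (hb : Compatible m b K)
    (hr : r ∈ dunklSpan ι P m K b) : dunklMap ι P m b r ∈ dunklSpan ι P m K b := by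
  obtain ⟨n, hn⟩ := hr
  exact ⟨n + 1, (h.coeffSpan_stable hb n).2 r hn⟩

theorem IsMomentum.mem_dunklSpan_inf (h : IsMomentum ι P ħ m) {K' : Subalgebra ℂ Mer}
    (h1 : r ∈ dunklSpan ι P m K b) (h2 : r ∈ dunklSpan ι P m K' b) :
    r ∈ dunklSpan ι P m (K ⊓ K') b := by
  obtain ⟨n, hn⟩ := h1
  obtain ⟨n', hn'⟩ := h2
  exact ⟨_, h.mem_coeffSpan_inf (h.dunklPow_monic b) hn hn'⟩

theorem dunklSpan_mono {K' : Subalgebra ℂ Mer} (hK : K ≤ K') :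
    dunklSpan ι P m K b ≤ dunklSpan ι P m K' b := by
  rintro r ⟨n, a, ha, rfl⟩
  exact ⟨n, a, fun k => hK (ha k), rfl⟩

end DunklSpan

/-! ### Sections over a chart as the invariant elements of the span -/

variable {L : PeriodPair} {c : Couplings m L}

theorem eq_s_pow (g : Zm m) : ∃ j, g = s m ^ j := by
  refine ⟨(Multiplicative.toAdd g).val, ?_⟩
  rw [s, ← ofAdd_nsmul]
  simp

theorem IsMomentum.act_mem_dunklSpan (h : IsMomentum ι P ħ m) {b : ℕ → Mer} {U : Set ℂ}
    (hb : Compatible m b (regularSubalgebra L U)) {a : SkewMonoidAlgebra R (Zm m)}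
    (ha : a ∈ cherednik ι L U (dunkl ι P b)) {r : R}
    (hr : r ∈ dunklSpan ι P m (regularSubalgebra L U) b) :
    act R m a r ∈ dunklSpan ι P m (regularSubalgebra L U) b := by
  induction ha using Subring.closure_induction generalizing r with
  | mem x hx =>
    rcases hx with ⟨g, f, hf, rfl⟩ | hx
    · obtain ⟨j, rfl⟩ := eq_s_pow g
      rw [act_single]
      exact coeff_mul_mem_dunklSpan hf (smul_pow_mem (fun _ => h.rot_mem_dunklSpan hb) j hr)
    · rw [Set.mem_singleton_iff.1 hx, act_dunkl]
      exact h.dunklMap_mem_dunklSpan hb hr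
  | zero => simp
  | one => simpa using hr
  | add x y _ _ hx hy =>
    rw [act_add]
    exact add_mem (hx hr) (hy hr)
  | neg x _ hx =>
    rw [map_neg]
    exact neg_mem (hx hr)
  | mul x y _ _ hx hy =>
    rw [act_mul]
    exact hx (hy hr)

theorem exists_act_one_eq {b : ℕ → Mer} {U : Set ℂ} {r : R}
    (hr : r ∈ dunklSpan ι P m (regularSubalgebra L U) b) :
    ∃ a ∈ cherednik ι L U (dunkl ι P b), r = act R m a 1 := by
  obtain ⟨n, a, ha, rfl⟩ := hr
  have h1 : ∀ k, SkewMonoidAlgebra.single (1 : Zm m) (ι (a k)) ∈ cherednik ι L U (dunkl ι P b) :=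
    fun k => Subring.subset_closure (Or.inl ⟨1, a k, ha k, rfl⟩)
  have h2 : (dunkl ι P b : SkewMonoidAlgebra R (Zm m)) ∈ cherednik ι L U (dunkl ι P b) :=
    Subring.subset_closure (Or.inr rfl)
  refine ⟨∑ k ∈ Finset.range n, SkewMonoidAlgebra.single 1 (ι (a k)) * dunkl ι P b ^ k,
    sum_mem fun k _ => mul_mem (h1 k) (pow_mem h2 k), ?_⟩
  rw [act_sum]
  refine Finset.sum_congr rfl fun k _ => ?_
  rw [act_mul, act_dunkl_pow, act_single, one_smul]

theorem act_e_one : act R m (e R m) 1 = 1 := act_e_of_invariant (smul_one _)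

/-- Since e·1 = 1, θ(e a e) = e·(a·1), where a·1 runs through the whole span and e averages it onto
its invariant part. -/
theorem IsMomentum.mem_sphericalOn_iff (h : IsMomentum ι P ħ m) {U : Set ℂ} {r : R}
    (hc : ∀ b, AdmissibleOn c U b → Compatible m b (regularSubalgebra L U)) :
    r ∈ sphericalOn ι P c U ↔
      ∃ b, AdmissibleOn c U b ∧ r ∈ dunklSpan ι P m (regularSubalgebra L U) b ∧ s m • r = r := by
  refine exists_congr fun b => and_congr_right fun hb => ⟨?_, ?_⟩
  · rintro ⟨a, ha, rfl⟩
    rw [θ_eq_act, act_mul, act_mul, act_e_one]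
    refine ⟨?_, h.smul_act_e _⟩
    rw [act_e]
    have h1 := h.act_mem_dunklSpan (hc b hb) ha one_mem_dunklSpan
    exact smul_mem_dunklSpan _ (sum_mem fun j _ =>
      smul_pow_mem (fun _ => h.rot_mem_dunklSpan (hc b hb)) j h1)
  · rintro ⟨h1, h2⟩
    obtain ⟨a, ha, rfl⟩ := exists_act_one_eq h1
    refine ⟨a, ha, ?_⟩
    rw [θ_eq_act, act_mul, act_mul, act_e_one, act_e_of_invariant h2]

/-- Writing r = a·1 with a in the Cherednik algebra gives r t = a·t, because t is invariant. Hence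
powers of an invariant section remain sections. -/
theorem IsMomentum.mul_mem_of_invariant (h : IsMomentum ι P ħ m) {b : ℕ → Mer} {U : Set ℂ}
    (hb : Compatible m b (regularSubalgebra L U)) {r t : R}
    (hr : r ∈ dunklSpan ι P m (regularSubalgebra L U) b)
    (ht : t ∈ dunklSpan ι P m (regularSubalgebra L U) b) (hti : s m • t = t) :
    r * t ∈ dunklSpan ι P m (regularSubalgebra L U) b := by
  obtain ⟨a, ha, rfl⟩ := exists_act_one_eq hr
  rw [← act_invariant a hti]
  exact h.act_mem_dunklSpan hb ha ht

theorem IsMomentum.adjoin_invariant (h : IsMomentum ι P ħ m) {H : R} (hH : s m • H = H) {r : R}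
    (hr : r ∈ Algebra.adjoin ℂ {H}) : s m • r = r := by
  induction hr using Algebra.adjoin_induction with
  | mem x hx => rw [Set.mem_singleton_iff.1 hx, hH]
  | algebraMap t => rw [Algebra.algebraMap_eq_smul_one, h.smul_complex, smul_one]
  | add x y _ _ hx hy => rw [smul_add, hx, hy]
  | mul x y _ _ hx hy => rw [smul_mul', hx, hy]

theorem IsMomentum.adjoin_mem_dunklSpan (h : IsMomentum ι P ħ m) {b : ℕ → Mer} {U : Set ℂ}
    (hb : Compatible m b (regularSubalgebra L U)) {H : R} (hH : s m • H = H)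
    (hmem : H ∈ dunklSpan ι P m (regularSubalgebra L U) b) {r : R}
    (hr : r ∈ Algebra.adjoin ℂ {H}) : r ∈ dunklSpan ι P m (regularSubalgebra L U) b := by
  induction hr using Algebra.adjoin_induction with
  | mem x hx => rwa [Set.mem_singleton_iff.1 hx]
  | algebraMap t =>
    rw [Algebra.algebraMap_eq_smul_one]
    exact smul_mem_dunklSpan t one_mem_dunklSpan
  | add x y _ _ hx hy => exact add_mem hx hy
  | mul x y _ hy' hx hy => exact h.mul_mem_of_invariant hb hx hy (h.adjoin_invariant hH hy')

theorem IsMomentum.coeffSpan_le_dunklSpan_top (h : IsMomentum ι P ħ m) {K : Subalgebra ℂ Mer}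
    {b : ℕ → Mer} {r : R} (hr : r ∈ dunklSpan ι P m K b) : ∃ n, r ∈ ordLT ι P n := by
  obtain ⟨n, hn⟩ := hr
  exact ⟨n, coeffSpan_le_ordLT (h.dunklPow_monic b) n hn⟩

/-- An invariant element whose leading coefficient is constant has order divisible by `m`. -/
theorem IsMomentum.dvd_of_invariant (h : IsMomentum ι P ħ m) {r : R} (hr : s m • r = r) {n : ℕ}
    {t : ℂ} (ht : t ≠ 0) (hlead : r - ι (algebraMap ℂ Mer t) * P ^ n ∈ ordLT ι P n) : m ∣ n := by
  have hPn : s m • P ^ n = (ω m)⁻¹ ^ n • P ^ n := by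
    rw [smul_pow', h.smul_momentum, smul_pow]
  have h1 := h.smul_mem_ordLT hlead
  rw [smul_sub, hr, smul_mul', h.smul_coeff, AlgHom.commutes, hPn] at h1
  have h2 := sub_mem h1 hlead
  -- P^n has weight -n under s, so comparing the leading terms of s • r and r gives t (1 - ω^{-n}) =
  -- 0.
  have h3 : ι (algebraMap ℂ Mer (t - t * (ω m)⁻¹ ^ n)) * P ^ n ∈ ordLT ι P n := by
    convert! h2 using 1
    simp only [map_sub, map_smul, map_one, Algebra.algebraMap_eq_smul_one, sub_mul,
      smul_mul_assoc, one_mul, mul_smul_comm, smul_smul]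
    rw [mul_comm]
    abel
  have h4 := h.eq_zero_of_mul_pow_mem h3
  have h4' : Function.Injective (algebraMap ℂ Mer) := by
    have : Nontrivial Mer := by
      refine ⟨⟨1, 0, fun h0 => ?_⟩⟩
      have h5 := hasLim_algebraMap 1 0
      rw [map_one, h0] at h5
      exact zero_ne_one (hasLim_zero 0 |>.unique h5)
    exact (algebraMap ℂ Mer).injective
  have h5 : t - t * (ω m)⁻¹ ^ n = 0 := h4' (by rw [h4, map_zero])
  have h6 : ω m ^ n = 1 := by
    have : t * (1 - (ω m)⁻¹ ^ n) = 0 := by linear_combination h5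
    rcases mul_eq_zero.1 this with h | h
    · exact absurd h ht
    · rw [inv_pow, sub_eq_zero] at h
      rw [← inv_inv (ω m ^ n), ← h, inv_one]
  exact (isPrimitiveRoot_ω m).dvd_of_pow_eq_one n h6

/-- Induction on the order of a global section. The charts and Dunkl operators witnessing it vary
from point to point, which is why `hmem` is required for all of them. -/
theorem IsMomentum.globalSections_eq (h : IsMomentum ι P ħ m)
    (hL : ∀ z ∈ L.lattice, ω m * z ∈ L.lattice) {H : R} (hH : s m • H = H)
    (hmon : H - P ^ m ∈ ordLT ι P m)
    (hmem : ∀ U b, IsChart m L U → AdmissibleOn c U b →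
      H ∈ dunklSpan ι P m (regularSubalgebra L U) b)
    (hex : ∀ x : ℂ, ∃ U, IsChart m L U ∧ x ∈ U ∧ ∃ b, AdmissibleOn c U b) :
    globalSections ι P c = (Algebra.adjoin ℂ {H} : Set R) := by
  have hcomp : ∀ U, IsChart m L U → ∀ b, AdmissibleOn c U b →
      Compatible m b (regularSubalgebra L U) := fun U hU b hb =>
    compatible_regularSubalgebra hL hb subset_rfl hU.mul_mem
  have hiff : ∀ r, r ∈ globalSections ι P c ↔ ∀ x : ℂ, ∃ U, IsChart m L U ∧ x ∈ U ∧
      ∃ b, AdmissibleOn c U b ∧ r ∈ dunklSpan ι P m (regularSubalgebra L U) b ∧ s m • r = r :=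
    fun r => forall_congr' fun x => exists_congr fun U => and_congr_right fun hU =>
      and_congr_right fun _ => h.mem_sphericalOn_iff (hcomp U hU)
  ext r
  constructor
  · intro hr
    rw [hiff] at hr
    obtain ⟨n, hn⟩ : ∃ n, r ∈ ordLT ι P n := by
      obtain ⟨U, -, -, b, -, hr, -⟩ := hr 0
      exact h.coeffSpan_le_dunklSpan_top hr
    induction n generalizing r with
    | zero =>
      obtain ⟨a, -, rfl⟩ := hn
      simp
    | succ n ih =>
      have hlead : ∀ x, ∃ a, IsElliptic L a ∧ RegularAt a x ∧
          r - ι a * P ^ n ∈ ordLT ι P n := fun x => by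
        obtain ⟨U, -, hx, b, -, ⟨N, hr⟩, -⟩ := hr x
        obtain ⟨a, ha, hra⟩ := h.exists_leading (h.dunklPow_monic b) hr hn
        exact ⟨a, ha.1, ha.2 x hx, hra⟩
      obtain ⟨a, haE, -, ha⟩ := hlead 0
      -- The leading coefficients found at different points agree by uniqueness, so a single
      -- elliptic function is regular everywhere and Liouville's theorem applies.
      obtain ⟨t, rfl⟩ := haE.eq_algebraMap fun x => by
        obtain ⟨a', -, hreg, ha'⟩ := hlead x
        have h1 := sub_mem ha' ha
        have h2 : a - a' = 0 := h.eq_zero_of_mul_pow_mem (n := n) <| by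
          rw [map_sub, sub_mul]
          simpa using h1
        rw [sub_eq_zero.1 h2]
        exact hreg
      by_cases ht : t = 0
      · subst ht
        exact ih r hr (by simpa using ha)
      have hinv : s m • r = r := by
        obtain ⟨_, -, -, _, -, -, h1⟩ := hr 0
        exact h1
      -- The order is now m k, the order of H^k, so t H^k cancels the leading term.
      obtain ⟨k, rfl⟩ := h.dvd_of_invariant hinv ht ha
      have hpow : t • H ^ k ∈ Algebra.adjoin ℂ {H} :=
        Subalgebra.smul_mem _ (pow_mem (Algebra.self_mem_adjoin_singleton ℂ H) k) t
      have h3 : r - t • H ^ k ∈ Algebra.adjoin ℂ {H} := by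
        refine ih _ (fun x => ?_) ?_
        · obtain ⟨U, hU, hx, b, hb, h1, h2⟩ := hr x
          refine ⟨U, hU, hx, b, hb, sub_mem h1 ?_, ?_⟩
          · exact h.adjoin_mem_dunklSpan (hcomp U hU b hb) hH (hmem U b hU hb) hpow
          · rw [smul_sub, h2, h.adjoin_invariant hH hpow]
        · have h4 := sub_mem ha (smul_mem_coeffSpan t (h.monic_pow hmon k))
          convert! h4 using 1
          rw [AlgHom.commutes, ← Algebra.smul_def, smul_sub]
          abel
      have := add_mem h3 hpow
      rwa [sub_add_cancel] at this
  · intro hr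
    rw [hiff]
    intro x
    obtain ⟨U, hU, hx, b, hb⟩ := hex x
    exact ⟨U, hU, hx, b, hb, h.adjoin_mem_dunklSpan (hcomp U hU b hb) hH (hmem U b hU hb) hr,
      h.adjoin_invariant hH hr⟩

end Abstract

/-! ### The two rings of the theorem -/

theorem algebraMap_mer_injective : Function.Injective (algebraMap ℂ Mer) := by
  intro a b h
  have h1 := hasLim_algebraMap a 0
  rw [h] at h1
  exact h1.unique (hasLim_algebraMap b 0)

theorem isMomentum_sym (m : ℕ) [NeZero m] : IsMomentum symCoeff symMomentum 0 m where
  mul_coeff f := by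
    rw [zero_smul, add_zero]
    exact Polynomial.X_mul
  smul_coeff f := symRot_C _ f
  smul_momentum := by
    have h := symRot_X (rootChar m (s m))
    rw [Units.val_inv_eq_inv_val, rootChar_s] at h
    exact h
  coeff_eq_zero n a h := by
    have h1 := congrArg (fun p : Sym => p.coeff n) h
    change (∑ k ∈ Finset.range (n + 1), Polynomial.C (a k) * Polynomial.X ^ k).coeff n = 0 at h1
    simpa [Polynomial.finsetSum_coeff, Polynomial.coeff_C_mul, Polynomial.coeff_X_pow] using h1

theorem ddq_iterate_qMer_pow (k j : ℕ) :
    ddq^[k] (qMer ^ j) = (j.descFactorial k : ℂ) • qMer ^ (j - k) := by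
  induction k with
  | zero => simp
  | succ k ih =>
    rw [Function.iterate_succ_apply', ih, map_smul, Nat.descFactorial_succ]
    rcases Nat.eq_zero_or_pos (j - k) with h | h
    · rw [h, pow_zero, ← map_one (algebraMap ℂ Mer), ddq_algebraMap]
      simp
    · obtain ⟨i, hi⟩ : ∃ i, j - k = i + 1 := ⟨j - k - 1, by omega⟩
      have hi' : j - (k + 1) = i := by omega
      rw [hi, ddq_qMer_pow, hi', smul_smul]
      push_cast
      rw [mul_comm]

theorem opMomentum_pow_apply (ħ : ℂ) (k : ℕ) (f : Mer) :
    ((opMomentum ħ ^ k : diffOp) : Module.End ℂ Mer) f = ħ ^ k • ddq^[k] f := by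
  induction k with
  | zero => simp
  | succ k ih =>
    rw [pow_succ', Function.iterate_succ_apply']
    change ħ • ddq (((opMomentum ħ ^ k : diffOp) : Module.End ℂ Mer) f) = _
    rw [ih, map_smul, smul_smul, pow_succ']

theorem isMomentum_op {ħ : ℂ} (hħ : ħ ≠ 0) (m : ℕ) [NeZero m] :
    IsMomentum opCoeff (opMomentum ħ) ħ m where
  mul_coeff f := by
    apply Subtype.ext
    ext g
    change ħ • ddq (f * g) = f * (ħ • ddq g) + ħ • (ddq f * g)
    rw [ddq_mul, smul_add, mul_smul_comm, add_comm]
  smul_coeff f := by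
    apply Subtype.ext
    ext g
    change rotHom _ (f * rotHom _ g) = rotHom _ f * g
    rw [map_mul, ← rotHom_mul, mul_inv_cancel, rotHom_one]
  smul_momentum := by
    apply Subtype.ext
    ext g
    change rotHom (rootChar m (s m)) (ħ • ddq (rotHom (rootChar m (s m))⁻¹ g)) =
      (ω m)⁻¹ • (ħ • ddq g)
    rw [ddq_rotHom, map_smul, map_smul, ← rotHom_mul, mul_inv_cancel, rotHom_one,
      Units.val_inv_eq_inv_val, rootChar_s, smul_comm]
  coeff_eq_zero n a h := by
    -- The operator is tested on q^j: terms with k > j vanish, those with k < j are zero by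
    -- induction, and what is left is ħ^j j! a_j.
    have happ : ∀ j, ∑ k ∈ Finset.range (n + 1),
        a k * ((ħ ^ k * (j.descFactorial k : ℂ)) • qMer ^ (j - k)) = 0 := fun j => by
      have h1 := congrArg (fun A : diffOp => (A : Module.End ℂ Mer) (qMer ^ j)) h
      have h2 : ∀ t : Finset ℕ, ((∑ k ∈ t, opCoeff (a k) * opMomentum ħ ^ k : diffOp) :
          Module.End ℂ Mer) (qMer ^ j) =
          ∑ k ∈ t, a k * ((ħ ^ k * (j.descFactorial k : ℂ)) • qMer ^ (j - k)) := fun t => by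
        rw [AddSubmonoidClass.coe_finsetSum, LinearMap.sum_apply]
        refine Finset.sum_congr rfl fun k _ => ?_
        change a k * ((opMomentum ħ ^ k : diffOp) : Module.End ℂ Mer) (qMer ^ j) = _
        rw [opMomentum_pow_apply, ddq_iterate_qMer_pow, smul_smul]
      rw [← h2]
      exact h1
    suffices H : ∀ j ≤ n, a j = 0 from H n le_rfl
    intro j
    induction j using Nat.strong_induction_on with
    | _ j ih =>
      intro hj
      have h1 := happ j
      rw [Finset.sum_eq_single_of_mem j (by simp; omega)] at h1
      · rw [Nat.sub_self, pow_zero, Nat.descFactorial_self, mul_smul_comm, mul_one] at h1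
        have h2 : ħ ^ j * (j.factorial : ℂ) ≠ 0 :=
          mul_ne_zero (pow_ne_zero _ hħ) (by exact_mod_cast j.factorial_ne_zero)
        rw [← smul_zero (ħ ^ j * (j.factorial : ℂ))] at h1
        exact smul_right_injective Mer h2 h1
      · intro k _ hkj
        rcases lt_or_gt_of_ne hkj with hk | hk
        · rw [ih k hk (by omega), zero_mul]
        · rw [Nat.descFactorial_eq_zero_iff_lt.2 hk]
          simp

/-! ### The fixed points -/

section Fixed

variable {m : ℕ} [NeZero m] {L : PeriodPair}

/-- With ζ = ω^l ≠ 1, summing ζ^k z - z over k < m gives -m z, since ∑ ζ^k = 0. Fixed points are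
thus m-torsion, hence finite in number. -/
theorem natCast_mul_mem_lattice (hL : ∀ z ∈ L.lattice, ω m * z ∈ L.lattice) {l : ℕ}
    (hl : l ∈ Finset.Ico 1 m) {z : ℂ} (hz : ω m ^ l * z - z ∈ L.lattice) :
    (m : ℂ) * z ∈ L.lattice := by
  have hl' := Finset.mem_Ico.1 hl
  have h1 : ∀ k : ℕ, (ω m ^ l) ^ k * z - z ∈ L.lattice := fun k => by
    induction k with
    | zero => simp
    | succ k ih =>
      have h2 := add_mem ih (ω_pow_mul_mem hL (l * k) hz)
      convert! h2 using 1
      rw [pow_mul]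
      ring
  have h3 : ∑ k ∈ Finset.range m, (ω m ^ l) ^ k = 0 := by
    have hne : ω m ^ l ≠ 1 := fun h =>
      absurd (Nat.le_of_dvd (by omega) ((isPrimitiveRoot_ω m).dvd_of_pow_eq_one l h)) (by omega)
    have h4 := mul_neg_geom_sum (ω m ^ l) m
    rw [← pow_mul, mul_comm l, pow_mul, (isPrimitiveRoot_ω m).pow_eq_one, one_pow, sub_self] at h4
    rcases mul_eq_zero.1 h4 with h | h
    · exact absurd (sub_eq_zero.1 h).symm hne
    · exact h
  have h5 : ∑ k ∈ Finset.range m, ((ω m ^ l) ^ k * z - z) ∈ L.lattice := sum_mem fun k _ => h1 k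
  rw [Finset.sum_sub_distrib, ← Finset.sum_mul, h3] at h5
  simpa using neg_mem h5

theorem finite_fixedPoints (hL : ∀ z ∈ L.lattice, ω m * z ∈ L.lattice) :
    (fixedPoints m L).Finite := by
  refine (Set.finite_range fun p : Fin m × Fin m =>
    pt L (((p.1 : ℕ) * L.ω₁ + (p.2 : ℕ) * L.ω₂) / m)).subset ?_
  rintro x ⟨-, l, hl, z, rfl, hz⟩
  obtain ⟨a, b, hab⟩ := PeriodPair.mem_lattice.1
    (natCast_mul_mem_lattice hL hl (pt_eq_iff.1 hz))
  have hm : (m : ℂ) ≠ 0 := by exact_mod_cast NeZero.ne m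
  have hmZ : (m : ℤ) ≠ 0 := by exact_mod_cast NeZero.ne m
  have key : ∀ a : ℤ, ∃ (i : Fin m) (t : ℤ), a = i + m * t := fun a => by
    refine ⟨⟨(a % m).toNat, ?_⟩, a / m, ?_⟩
    · have := Int.emod_lt_of_pos a (show (0 : ℤ) < m by have := NeZero.pos m; omega)
      have := Int.emod_nonneg a hmZ
      omega
    · have := Int.emod_nonneg a hmZ
      have := Int.emod_add_mul_ediv a m
      simp only
      omega
  obtain ⟨i, t, rfl⟩ := key a
  obtain ⟨j, t', rfl⟩ := key b
  refine ⟨(i, j), pt_eq_iff.2 (PeriodPair.mem_lattice.2 ⟨-t, -t', ?_⟩)⟩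
  push_cast at hab ⊢
  field_simp
  linear_combination -hab

/-- Orthogonality of characters: ∑_j ω^{-jl} = 0 for 0 < l < m. It is the reason why the expansion
defining the α_i has no term with i = 1. -/
theorem sum_μ_eq_zero (c : Couplings m L) (x : Curve L) : ∑ j ∈ Finset.range m, c.μ j x = 0 := by
  simp only [Couplings.μ]
  rw [Finset.sum_comm]
  refine Finset.sum_eq_zero fun l hl => ?_
  have hl' := Finset.mem_Ico.1 hl
  rw [← Finset.sum_mul]
  have h1 : ∑ j ∈ Finset.range m, (ω m)⁻¹ ^ (j * l) = 0 := by
    have hp := (isPrimitiveRoot_ω m).inv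
    have hne : (ω m)⁻¹ ^ l ≠ 1 := fun h =>
      absurd (Nat.le_of_dvd (by omega) (hp.dvd_of_pow_eq_one l h)) (by omega)
    have h4 := mul_neg_geom_sum ((ω m)⁻¹ ^ l) m
    rw [← pow_mul, mul_comm l m, pow_mul, hp.pow_eq_one, one_pow, sub_self] at h4
    rcases mul_eq_zero.1 h4 with h | h
    · exact absurd (sub_eq_zero.1 h).symm hne
    · rw [← h]
      exact Finset.sum_congr rfl fun j _ => by rw [← pow_mul, mul_comm]
  rw [h1, zero_mul]

theorem μbar_eq_sum (hfin : (fixedPoints m L).Finite) (c : Couplings m L) (k : ℕ) :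
    c.μbar k = ∑ x ∈ hfin.toFinset, c.μ k x :=
  finsum_mem_eq_finite_toFinset_sum _ hfin

theorem sum_μbar_eq_zero (hfin : (fixedPoints m L).Finite) (c : Couplings m L) :
    ∑ j ∈ Finset.range m, c.μbar j = 0 := by
  simp only [μbar_eq_sum hfin]
  rw [Finset.sum_comm]
  exact Finset.sum_eq_zero fun x _ => sum_μ_eq_zero c x

end Fixed

/-! ### Euler operators and principal parts -/

open Polynomial in
/-- Expansion of a polynomial of degree `< n` in a family of monic polynomials. -/
theorem exists_expansion {p : ℕ → ℂ[X]} (hm : ∀ k, (p k).Monic) (hd : ∀ k, (p k).natDegree = k)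
    (n : ℕ) (g : ℂ[X]) (hg : g.degree < n) :
    ∃ γ : ℕ → ℂ, g = ∑ k ∈ Finset.range n, C (γ k) * p k := by
  induction n generalizing g with
  | zero => exact ⟨0, by simpa using hg⟩
  | succ n ih =>
    have h1 : (g - C (g.coeff n) * p n).degree < n := by
      rw [Polynomial.degree_lt_iff_coeff_zero]
      intro k hk
      rcases Nat.eq_or_lt_of_le hk with rfl | hk
      · have h3 : (p n).coeff n = 1 := by
          have := hm n
          rwa [Monic, leadingCoeff, hd] at this
        simp [h3]
      · have h2 := (Polynomial.degree_lt_iff_coeff_zero _ _).1 hg k hk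
        have h3 : (p n).coeff k = 0 :=
          coeff_eq_zero_of_natDegree_lt (by rw [hd]; exact hk)
        simp [h2, h3]
    obtain ⟨γ, hγ⟩ := ih _ h1
    refine ⟨Function.update γ n (g.coeff n), ?_⟩
    rw [Finset.sum_range_succ, Function.update_self, ← sub_eq_iff_eq_add, hγ]
    refine Finset.sum_congr rfl fun k hk => ?_
    rw [Function.update_of_ne (Finset.mem_range.1 hk).ne]

open Polynomial in
theorem expansion_eq_zero {p : ℕ → ℂ[X]} (hm : ∀ k, (p k).Monic) (hd : ∀ k, (p k).natDegree = k)
    (n : ℕ) (γ : ℕ → ℂ) (h : ∑ k ∈ Finset.range n, C (γ k) * p k = 0) : ∀ k < n, γ k = 0 := by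
  induction n with
  | zero => intro k hk; omega
  | succ n ih =>
    have h1 : γ n = 0 := by
      have h2 := congrArg (fun q => q.coeff n) h
      have h3 : (p n).coeff n = 1 := by
        have := hm n
        rwa [Monic, leadingCoeff, hd] at this
      simp only [Finset.sum_range_succ, coeff_add, finsetSum_coeff, coeff_C_mul, h3, mul_one,
        coeff_zero] at h2
      rw [Finset.sum_eq_zero, zero_add] at h2
      · exact h2
      · intro k hk
        rw [coeff_eq_zero_of_natDegree_lt, mul_zero]
        rw [hd]
        exact Finset.mem_range.1 hk
    rw [Finset.sum_range_succ, h1, C_0, zero_mul, add_zero] at h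
    intro k hk
    rcases Nat.lt_succ_iff_lt_or_eq.1 hk with hk | rfl
    exacts [ih h k hk, h1]

open Polynomial in
/-- The polynomial `∏_{k<j} (X - ħ k - a_k)`. -/
def eulerPoly (ħ : ℂ) (a : ℕ → ℂ) (j : ℕ) : ℂ[X] :=
  ∏ k ∈ Finset.range j, (X - C (ħ * k + a k))

open Polynomial in
theorem eulerPoly_monic (ħ : ℂ) (a : ℕ → ℂ) (j : ℕ) : (eulerPoly ħ a j).Monic :=
  monic_prod_of_monic _ _ fun _ _ => monic_X_sub_C _

open Polynomial in
theorem natDegree_eulerPoly (ħ : ℂ) (a : ℕ → ℂ) (j : ℕ) : (eulerPoly ħ a j).natDegree = j := by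
  rw [eulerPoly, natDegree_prod_of_monic _ _ fun _ _ => monic_X_sub_C _]
  simp only [natDegree_X_sub_C, Finset.sum_const, Finset.card_range, smul_eq_mul, mul_one]

open Polynomial in
-- Both polynomials are monic, and their next coefficients are minus the sums of the roots, which
-- agree by `h`; the shifts ħ k are common to both.
theorem degree_eulerPoly_sub_lt (ħ : ℂ) {a b : ℕ → ℂ} {n : ℕ}
    (h : ∑ k ∈ Finset.range (n + 1), a k = ∑ k ∈ Finset.range (n + 1), b k) :
    (eulerPoly ħ a (n + 1) - eulerPoly ħ b (n + 1)).degree < n := by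
  rw [degree_lt_iff_coeff_zero]
  intro k hk
  rw [coeff_sub, sub_eq_zero]
  have hlead : ∀ a, (eulerPoly ħ a (n + 1)).coeff (n + 1) = 1 := fun a => by
    have := eulerPoly_monic ħ a (n + 1)
    rwa [Monic, leadingCoeff, natDegree_eulerPoly] at this
  have hnext : ∀ a, (eulerPoly ħ a (n + 1)).coeff n =
      -∑ k ∈ Finset.range (n + 1), (ħ * k + a k) := fun a => by
    have := prod_X_sub_C_coeff_card_pred (Finset.range (n + 1)) (fun k => ħ * k + a k) (by simp)
    rwa [Finset.card_range, Nat.add_sub_cancel] at this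
  rcases Nat.lt_trichotomy k n with h1 | rfl | h1
  · omega
  · rw [hnext, hnext, Finset.sum_add_distrib, Finset.sum_add_distrib, h]
  · rcases Nat.eq_or_lt_of_le (Nat.succ_le_of_lt h1) with rfl | h2
    · rw [Nat.succ_eq_add_one, hlead, hlead]
    · rw [coeff_eq_zero_of_natDegree_lt, coeff_eq_zero_of_natDegree_lt] <;>
        rw [natDegree_eulerPoly] <;> exact h2

section Principal

variable {R : Type} [Ring R] [Algebra ℂ R]
variable {ι : Mer →ₐ[ℂ] R} {P : R} {ħ : ℂ} {m : ℕ} [NeZero m] [MulSemiringAction (Zm m) R]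

theorem IsMomentum.euler_mul_qInv_pow (h : IsMomentum ι P ħ m) (j : ℕ) :
    ι qMer * P * ι (qInv ^ j) = ι (qInv ^ j) * (ι qMer * P - algebraMap ℂ R (ħ * j)) := by
  have h1 : qMer * qInv ^ (j + 1) = qInv ^ j := by
    rw [pow_succ', ← mul_assoc, qMer_mul_qInv, one_mul]
  rw [mul_assoc, h.mul_coeff, ddq_qInv_pow, map_neg, map_smul, mul_add, mul_smul_comm, mul_neg,
    mul_smul_comm, ← map_mul, h1, mul_sub, ← mul_assoc, ← map_mul, mul_comm qMer, map_mul,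
    mul_assoc, smul_neg, smul_smul, ← Algebra.commutes, ← Algebra.smul_def, sub_eq_add_neg]

open Polynomial in
-- Each factor is P - a/q = q⁻¹ (qP - a), and moving qP past q^{-j} replaces it by qP - ħ j. The
-- product becomes q^{-j} times a polynomial in the Euler operator.
theorem IsMomentum.ladder_smul_qInv (h : IsMomentum ι P ħ m) (a : ℕ → ℂ) (j : ℕ) :
    ladder ι P (fun k => a k • qInv) j =
      ι (qInv ^ j) * aeval (ι qMer * P) (eulerPoly ħ a j) := by
  induction j with
  | zero => simp [ladder, eulerPoly]
  | succ j ih =>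
    have h0 : ι qInv * ι qMer = 1 := by rw [← map_mul, qInv_mul_qMer, map_one]
    have h1 : P - ι (a j • qInv) = ι qInv * (ι qMer * P - algebraMap ℂ R (a j)) := by
      rw [mul_sub, ← mul_assoc, h0, one_mul, map_smul, Algebra.smul_def, Algebra.commutes]
    have h2 : (ι qMer * P - algebraMap ℂ R (a j)) * ι (qInv ^ j) =
        ι (qInv ^ j) * aeval (ι qMer * P) (X - C (ħ * j + a j)) := by
      rw [sub_mul, h.euler_mul_qInv_pow, Algebra.commutes, ← mul_sub, map_sub, aeval_X, aeval_C,
        map_add]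
      congr 1
      abel
    rw [ladder, ih, h1, mul_assoc, ← mul_assoc _ (ι (qInv ^ j)), h2, ← mul_assoc, ← mul_assoc,
      ← map_mul, ← pow_succ', mul_assoc, ← map_mul, mul_comm (X - C _), eulerPoly, eulerPoly,
      Finset.prod_range_succ (fun k : ℕ => X - C (ħ * k + a k))]

theorem IsMomentum.euler_pow (h : IsMomentum ι P ħ m) (k : ℕ) :
    (ι qMer * P) ^ k - ι (qMer ^ k) * P ^ k ∈ ordLT ι P k := by
  induction k with
  | zero => simp
  | succ k ih =>
    have h1 : (ι qMer * P) ^ (k + 1) - ι (qMer ^ (k + 1)) * P ^ (k + 1) =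
        ι qMer * (P * ((ι qMer * P) ^ k - ι (qMer ^ k) * P ^ k)) +
          ħ • (ι (qMer * ddq (qMer ^ k)) * P ^ k) := by
      have h2 : ι qMer * (P * (ι (qMer ^ k) * P ^ k)) = ι (qMer ^ (k + 1)) * P ^ (k + 1) +
          ħ • (ι (qMer * ddq (qMer ^ k)) * P ^ k) := by
        rw [← mul_assoc P, h.mul_coeff, add_mul, mul_add, pow_succ' qMer, pow_succ' P, map_mul,
          map_mul]
        simp only [mul_assoc, smul_mul_assoc, mul_smul_comm]
      rw [mul_sub, mul_sub, h2, pow_succ', mul_assoc]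
      abel
    rw [h1]
    refine add_mem (coeff_mul_mem_ordLT _ (h.mul_mem_ordLT ih)) (smul_mem_coeffSpan _ ?_)
    exact mul_mem_coeffSpan (K := ⊤) (η := fun k => P ^ k) trivial k.lt_succ_self

open Polynomial in
-- The leading term of a polynomial in qP of degree n is its leading coefficient times q^n P^n,
-- which cannot cancel.
theorem IsMomentum.aeval_euler_injective (h : IsMomentum ι P ħ m) :
    Function.Injective (aeval (R := ℂ) (ι qMer * P)) := by
  rw [injective_iff_map_eq_zero]
  intro p hp
  by_contra hne
  have h1 : ∀ k, (ι qMer * P) ^ k ∈ ordLT ι P (k + 1) := fun k => by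
    have := add_mem (coeffSpan_mono k.le_succ (h.euler_pow k))
      (mul_mem_coeffSpan (ι := ι) (K := ⊤) (η := fun k => P ^ k) (a := qMer ^ k) trivial
        k.lt_succ_self)
    simpa using this
  rw [aeval_eq_sum_range, Finset.sum_range_succ] at hp
  set n := p.natDegree
  have h2 : ι (p.coeff n • qMer ^ n) * P ^ n ∈ ordLT ι P n := by
    have h3 : ∑ k ∈ Finset.range n, p.coeff k • (ι qMer * P) ^ k ∈ ordLT ι P n :=
      sum_mem fun k hk => smul_mem_coeffSpan _
        (coeffSpan_mono (Finset.mem_range.1 hk) (h1 k))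
    have h4 := smul_mem_coeffSpan (p.coeff n) (h.euler_pow n)
    have h5 := add_mem h3 h4
    rw [smul_sub, ← add_sub_assoc, hp, zero_sub, neg_mem_iff] at h5
    rwa [map_smul, smul_mul_assoc]
  have h6 := h.eq_zero_of_mul_pow_mem h2
  have h7 : algebraMap ℂ Mer (p.coeff n) = algebraMap ℂ Mer 0 := by
    have h8 := congrArg (fun f => f * qInv ^ n) h6
    simpa [← mul_pow, qMer_mul_qInv, Algebra.algebraMap_eq_smul_one] using h8
  exact hne (leadingCoeff_eq_zero.1 (algebraMap_mer_injective h7))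

open Polynomial in
theorem IsMomentum.exists_principalPartsMatch (h : IsMomentum ι P ħ m) (hm : 2 ≤ m)
    {L : PeriodPair} (hL : ∀ z ∈ L.lattice, ω m * z ∈ L.lattice) (c : Couplings m L) :
    ∃ α : Fin (m - 1) → ℂ, ∀ β : Fin (m - 1) → ℂ, PrincipalPartsMatch ι P c β ↔ β = α := by
  set a : ℕ → ℂ := fun k => c.μ k 0
  set b : ℕ → ℂ := fun k => -c.μbar k
  set d : ℕ → ℂ := fun i => (-1) ^ (i + 2) * (Nat.factorial (i + 1) : ℂ)
  have hd : ∀ i, d i ≠ 0 := fun i =>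
    mul_ne_zero (pow_ne_zero _ (by norm_num)) (by exact_mod_cast Nat.factorial_ne_zero _)
  have hsum : ∀ F : ℕ → ℂ[X], ∑ i : Fin (m - 1), F (m - 2 - i) =
      ∑ k ∈ Finset.range (m - 1), F k := fun F => by
    rw [← Finset.sum_range_reflect, Finset.sum_range]
    exact Finset.sum_congr rfl fun i _ => by rw [Nat.sub_sub m 1 1]
  -- Every term of the relation carries the same factor q^{-m} on the left; removing it leaves an
  -- identity of polynomials in qP.
  have hiff : ∀ β : Fin (m - 1) → ℂ, PrincipalPartsMatch ι P c β ↔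
      eulerPoly ħ a m - eulerPoly ħ b m =
        ∑ i : Fin (m - 1), C (d i * β i) * eulerPoly ħ b (m - 2 - i) := fun β => by
    have hb : (fun k => -(c.μbar k • qInv)) = fun k => b k • qInv :=
      funext fun k => (neg_smul _ _).symm
    have hterm : ∀ i : Fin (m - 1), (d i * β i) • (ι (qInv ^ ((i : ℕ) + 2)) *
        ladder ι P (fun k => b k • qInv) (m - 2 - i)) =
        ι (qInv ^ m) * aeval (ι qMer * P) (C (d i * β i) * eulerPoly ħ b (m - 2 - i)) := fun i => by
      rw [h.ladder_smul_qInv, ← mul_assoc, ← map_mul, ← pow_add,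
        show (i : ℕ) + 2 + (m - 2 - i) = m by omega, map_mul, aeval_C, ← Algebra.smul_def,
        mul_smul_comm]
    rw [PrincipalPartsMatch, hb, h.ladder_smul_qInv, h.ladder_smul_qInv,
      Finset.sum_congr rfl fun i _ => hterm i, ← Finset.mul_sum, ← mul_add, ← map_sum, ← map_add,
      sub_eq_iff_eq_add']
    constructor
    · intro he
      have h1 := congrArg (fun r => ι (qMer ^ m) * r) he
      simp only [← mul_assoc, ← map_mul, ← mul_pow, qMer_mul_qInv, one_pow, map_one,
        one_mul] at h1
      exact h.aeval_euler_injective h1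
    · intro he
      rw [he]
  have hdeg : (eulerPoly ħ a m - eulerPoly ħ b m).degree < (m - 1 : ℕ) := by
    obtain ⟨n, rfl⟩ : ∃ n, m = n + 1 := ⟨m - 1, by omega⟩
    refine degree_eulerPoly_sub_lt ħ ?_
    rw [sum_μ_eq_zero, Finset.sum_neg_distrib, sum_μbar_eq_zero (finite_fixedPoints hL), neg_zero]
  obtain ⟨γ, hγ⟩ := exists_expansion (eulerPoly_monic ħ b) (natDegree_eulerPoly ħ b) _ _ hdeg
  refine ⟨fun i => (d i)⁻¹ * γ (m - 2 - i), fun β => ?_⟩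
  rw [hiff]
  constructor
  · intro he
    -- The index change i ↦ m - 2 - i, an involution of 0, …, m - 2, read as a function on ℕ. The
    -- condition always holds as m ≥ 2, so the default 0 is never taken.
    let γ' : ℕ → ℂ := fun k => if hk : m - 2 - k < m - 1 then d (m - 2 - k) * β ⟨m - 2 - k, hk⟩
      else 0
    have hγ' : ∀ i : Fin (m - 1), γ' (m - 2 - i) = d i * β i := fun i => by
      have h1 : m - 2 - (m - 2 - (i : ℕ)) = i := by omega
      have h2 : m - 2 - (m - 2 - (i : ℕ)) < m - 1 := by omega
      simp only [γ', dif_pos h2]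
      congr 2
      exact Fin.ext h1
    have h1 : ∑ k ∈ Finset.range (m - 1), C ((γ' - γ) k) * eulerPoly ħ b k = 0 := by
      simp only [Pi.sub_apply, C_sub, sub_mul, Finset.sum_sub_distrib]
      rw [← hγ, he, ← hsum fun k => C (γ' k) * eulerPoly ħ b k, sub_eq_zero]
      exact Finset.sum_congr rfl fun i _ => by rw [hγ']
    ext i
    have h2 := expansion_eq_zero (eulerPoly_monic ħ b) (natDegree_eulerPoly ħ b) _ _ h1
      (m - 2 - i) (by omega)
    rw [Pi.sub_apply, hγ', sub_eq_zero] at h2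
    rw [← h2, inv_mul_cancel_left₀ (hd i)]
  · rintro rfl
    rw [hγ, ← hsum fun k => C (γ k) * eulerPoly ħ b k]
    exact Finset.sum_congr rfl fun i _ => by rw [mul_inv_cancel_left₀ (hd i)]

end Principal

/-! ### The Weierstrass function -/

section Weierstrass

variable (L : PeriodPair)

theorem isOpen_compl_lattice : IsOpen ((L.lattice : Set ℂ)ᶜ) := L.isClosed_lattice.isOpen_compl

theorem countable_lattice : (L.lattice : Set ℂ).Countable := by
  have h : Countable L.lattice := L.latticeEquivProd.toEquiv.countable_iff.2 inferInstance
  exact h.to_set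

theorem isPreconnected_compl_of_countable {S : Set ℂ} (hS : S.Countable) : IsPreconnected Sᶜ :=
  (hS.isPathConnected_compl_of_one_lt_rank (by simp)).isConnected.isPreconnected

theorem hasDerivAt_weierstrassP {z : ℂ} (hz : z ∉ L.lattice) :
    HasDerivAt L.weierstrassP (L.derivWeierstrassP z) z := by
  have h := (L.analyticOnNhd_weierstrassP z hz).differentiableAt.hasDerivAt
  rwa [L.deriv_weierstrassP] at h

theorem eventually_notMem_lattice (x : ℂ) : ∀ᶠ z in 𝓝[≠] x, z ∉ L.lattice := by
  filter_upwards [self_mem_nhdsWithin,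
    mem_nhdsWithin_of_mem_nhds (L.compl_lattice_sdiff_singleton_mem_nhds x)] with w hw hw'
  simp_all

theorem tendsto_sq_mul_weierstrassP :
    Tendsto (fun z => z ^ 2 * L.weierstrassP z) (𝓝[≠] 0) (𝓝 1) := by
  have h : ContinuousAt (fun z : ℂ => z ^ 2 * L.weierstrassPExcept 0 z + 1) 0 :=
    ((continuousAt_id.pow 2).mul (L.analyticAt_weierstrassPExcept 0).continuousAt).add
      continuousAt_const
  have h2 := h.tendsto.mono_left (nhdsWithin_le_nhds (s := {0}ᶜ))
  simp only [ne_eq, OfNat.ofNat_ne_zero, not_false_eq_true, zero_pow, zero_mul, zero_add] at h2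
  refine h2.congr' ?_
  filter_upwards [self_mem_nhdsWithin] with z hz
  have hz' : z ≠ 0 := hz
  have h3 := L.weierstrassPExcept_def 0 z
  simp only [ZeroMemClass.coe_zero, sub_zero] at h3
  rw [h3]
  field_simp
  ring

theorem tendsto_cube_mul_derivWeierstrassP :
    Tendsto (fun z => z ^ 3 * L.derivWeierstrassP z) (𝓝[≠] 0) (𝓝 (-2)) := by
  have h : ContinuousAt (fun z : ℂ => z ^ 3 * L.derivWeierstrassPExcept 0 z - 2) 0 :=
    ((continuousAt_id.pow 3).mul (L.analyticAt_derivWeierstrassPExcept 0).continuousAt).sub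
      continuousAt_const
  have h2 := h.tendsto.mono_left (nhdsWithin_le_nhds (s := {0}ᶜ))
  simp only [ne_eq, OfNat.ofNat_ne_zero, not_false_eq_true, zero_pow, zero_mul, zero_sub] at h2
  refine h2.congr' ?_
  filter_upwards [self_mem_nhdsWithin] with z hz
  have hz' : z ≠ 0 := hz
  have h3 := L.derivWeierstrassPExcept_def 0 z
  simp only [ZeroMemClass.coe_zero, sub_zero] at h3
  rw [h3]
  field_simp
  ring

theorem weierstrassP_not_eqOn_const (e : ℂ) : ¬ ∀ z ∉ L.lattice, L.weierstrassP z = e := by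
  intro h
  have h1 : Tendsto (fun z : ℂ => z ^ 2 * e) (𝓝[≠] 0) (𝓝 1) :=
    (tendsto_sq_mul_weierstrassP L).congr' <| by
      filter_upwards [eventually_notMem_lattice L 0] with z hz
      rw [h z hz]
  have h2 : Tendsto (fun z : ℂ => z ^ 2 * e) (𝓝[≠] 0) (𝓝 (0 ^ 2 * e)) :=
    Continuous.tendsto (by fun_prop) 0 |>.mono_left nhdsWithin_le_nhds
  simpa using tendsto_nhds_unique h1 h2

/-- Differentiating the cubic equation gives ℘' · (℘'' - 6℘² + g₂/2) = 0 on the connected complement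
of the lattice. One analytic factor vanishes identically, and it is not ℘', because of its pole at
0. -/
theorem deriv_derivWeierstrassP {z : ℂ} (hz : z ∉ L.lattice) :
    deriv L.derivWeierstrassP z = 6 * L.weierstrassP z ^ 2 - L.g₂ / 2 := by
  have hA := L.analyticOnNhd_weierstrassP
  have hA' := L.analyticOnNhd_derivWeierstrassP
  have hB : AnalyticOnNhd ℂ
      (fun z => deriv L.derivWeierstrassP z - (6 * L.weierstrassP z ^ 2 - L.g₂ / 2))
      (L.lattice : Set ℂ)ᶜ := fun w hw =>
    (hA' w hw).deriv.sub (((hA w hw).pow 2 |> analyticAt_const.mul).sub analyticAt_const)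
  have hmul : ∀ w ∈ (L.lattice : Set ℂ)ᶜ, L.derivWeierstrassP w •
      (deriv L.derivWeierstrassP w - (6 * L.weierstrassP w ^ 2 - L.g₂ / 2)) = 0 := by
    intro w hw
    have hd := hasDerivAt_weierstrassP L hw
    have hd' := (hA' w hw).differentiableAt.hasDerivAt
    have h1 := hd'.pow 2
    have h2 := (((hd.pow 3).const_mul 4).sub (hd.const_mul L.g₂)).sub_const L.g₃
    have h3 : (fun z => L.derivWeierstrassP z ^ 2) =ᶠ[𝓝 w] fun z =>
        4 * L.weierstrassP z ^ 3 - L.g₂ * L.weierstrassP z - L.g₃ := by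
      filter_upwards [(isOpen_compl_lattice L).mem_nhds hw] with z hz
        using L.derivWeierstrassP_sq z hz
    have h4 := (h1.congr_of_eventuallyEq h3.symm).unique h2
    simp only [Nat.add_one_sub_one, pow_one, Nat.cast_ofNat] at h4
    rw [smul_eq_mul]
    linear_combination h4 / 2
  rcases hA'.eq_zero_or_eq_zero_of_smul_eq_zero hB hmul
    (isPreconnected_compl_of_countable (countable_lattice L)) with h | h
  · exfalso
    have h1 : Tendsto (fun _ : ℂ => (0 : ℂ)) (𝓝[≠] 0) (𝓝 (-2)) :=
      (tendsto_cube_mul_derivWeierstrassP L).congr' <| by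
        filter_upwards [eventually_notMem_lattice L 0] with z hz
        rw [h z hz, mul_zero]
    simpa using tendsto_nhds_unique h1 tendsto_const_nhds
  · exact sub_eq_zero.1 (h z hz)

open Polynomial in
-- The differential equation makes all derivatives at z functions of ℘(z) and ℘'(z). The condition
-- on `A` concerns a double root e of the cubic: it makes all derivatives vanish where ℘' = ℘'' = 0.
theorem exists_iteratedDeriv_weierstrassP (n : ℕ) : ∃ A B : ℂ[X],
    (∀ e : ℂ, 4 * e ^ 3 - L.g₂ * e - L.g₃ = 0 → 6 * e ^ 2 - L.g₂ / 2 = 0 → A.eval e = 0) ∧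
    ∀ z ∉ L.lattice, iteratedDeriv (n + 1) L.weierstrassP z =
      A.eval (L.weierstrassP z) + B.eval (L.weierstrassP z) * L.derivWeierstrassP z := by
  induction n with
  | zero =>
    refine ⟨0, 1, by simp, fun z _ => ?_⟩
    rw [zero_add, iteratedDeriv_one, L.deriv_weierstrassP]
    simp
  | succ n ih =>
    obtain ⟨A, B, -, h⟩ := ih
    refine ⟨derivative B * (C 4 * X ^ 3 - C L.g₂ * X - C L.g₃) + B * (C 6 * X ^ 2 - C (L.g₂ / 2)),
      derivative A, fun e h1 h2 => ?_, fun z hz => ?_⟩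
    · simp only [eval_add, eval_mul, eval_sub, eval_C, eval_pow, eval_X, h1, h2]
      ring
    · have hd := hasDerivAt_weierstrassP L hz
      have hd' := (L.analyticOnNhd_derivWeierstrassP z hz).differentiableAt.hasDerivAt
      rw [deriv_derivWeierstrassP L hz] at hd'
      have h3 : iteratedDeriv (n + 1) L.weierstrassP =ᶠ[𝓝 z] fun z =>
          A.eval (L.weierstrassP z) + B.eval (L.weierstrassP z) * L.derivWeierstrassP z := by
        filter_upwards [(isOpen_compl_lattice L).mem_nhds hz] with w hw using h w hw
      rw [iteratedDeriv_succ, h3.deriv_eq]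
      have h4 := ((A.hasDerivAt _).comp z hd).add (((B.hasDerivAt _).comp z hd).mul hd')
      refine Eq.trans h4.deriv ?_
      simp only [eval_add, eval_mul, eval_sub, eval_C, eval_pow, eval_X, Function.comp_apply]
      linear_combination (derivative B).eval (L.weierstrassP z) * L.derivWeierstrassP_sq z hz

theorem eventually_eq_of_iteratedDeriv_eq {f g : ℂ → ℂ} {x : ℂ} (hf : AnalyticAt ℂ f x)
    (hg : AnalyticAt ℂ g x) (h : ∀ n, iteratedDeriv n f x = iteratedDeriv n g x) :
    f =ᶠ[𝓝 x] g := by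
  have h1 : ∀ n : ℕ, (n : ℕ∞) ≤ analyticOrderAt (f - g) x := fun n => by
    rw [natCast_le_analyticOrderAt_iff_iteratedDeriv_eq_zero (hf.sub hg)]
    intro i _
    rw [iteratedDeriv_sub hf.contDiffAt hg.contDiffAt, h, sub_self]
  have h2 : analyticOrderAt (f - g) x = ⊤ := ENat.eq_top_iff_forall_ge.2 h1
  filter_upwards [analyticOrderAt_eq_top.1 h2] with z hz using sub_eq_zero.1 hz

/-- Equal values of ℘ and ℘' give equal Taylor series at a and b, so b - a is a period of ℘, and the
only poles of ℘ are the lattice points. -/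
theorem sub_mem_lattice_of_weierstrassP_eq {a b : ℂ} (ha : a ∉ L.lattice) (hb : b ∉ L.lattice)
    (h : L.weierstrassP a = L.weierstrassP b)
    (h' : L.derivWeierstrassP a = L.derivWeierstrassP b) : b - a ∈ L.lattice := by
  by_contra hab
  have hA := L.analyticOnNhd_weierstrassP
  set t := b - a
  have hat : a + t = b := by simp [t]
  have hloc : L.weierstrassP =ᶠ[𝓝 a] fun z => L.weierstrassP (z + t) := by
    refine eventually_eq_of_iteratedDeriv_eq (hA a ha)
      (AnalyticAt.fun_comp (by rw [hat]; exact hA b hb) (by fun_prop)) fun n => ?_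
    rw [iteratedDeriv_comp_add_const]
    simp only [hat]
    rcases n with _ | n
    · simpa using h
    · obtain ⟨A, B, -, hAB⟩ := exists_iteratedDeriv_weierstrassP L n
      rw [hAB a ha, hAB b hb, h, h']
  -- The poles of both functions; being countable, they leave a connected complement for the
  -- identity theorem.
  let S : Set ℂ := L.lattice ∪ (fun z => z + t) ⁻¹' L.lattice
  have hS : S.Countable := (countable_lattice L).union
    ((countable_lattice L).preimage (add_left_injective t))
  have hEq : Set.EqOn L.weierstrassP (fun z => L.weierstrassP (z + t)) Sᶜ := by
    refine AnalyticOnNhd.eqOn_of_preconnected_of_eventuallyEq (fun z hz => hA z ?_)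
      (fun z hz => AnalyticAt.fun_comp (hA (z + t) ?_) (by fun_prop))
      (isPreconnected_compl_of_countable hS) (z₀ := a) ?_ hloc
    · exact fun h => hz (Or.inl h)
    · exact fun h => hz (Or.inr h)
    · rintro (h | h)
      · exact ha h
      · exact hb (by rwa [Set.mem_preimage, hat] at h)
  -- If t is not a period, ℘(z + t) is regular at 0, so z² ℘(z + t) → 0; but z² ℘(z) → 1.
  have hc : ContinuousAt (fun z : ℂ => z ^ 2 * L.weierstrassP (z + t)) 0 := by
    have h1 : ContinuousAt L.weierstrassP (0 + t) := by
      rw [zero_add]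
      exact (hA t hab).continuousAt
    exact (continuousAt_id.pow 2).mul
      (ContinuousAt.comp' h1 (continuousAt_id.add continuousAt_const))
  have h1 := hc.tendsto.mono_left (nhdsWithin_le_nhds (s := {0}ᶜ))
  have h2 : Tendsto (fun z : ℂ => z ^ 2 * L.weierstrassP (z + t)) (𝓝[≠] 0) (𝓝 1) := by
    refine (tendsto_sq_mul_weierstrassP L).congr' ?_
    have h3 : ∀ᶠ z in 𝓝 (0 : ℂ), z + t ∉ L.lattice :=
      (continuous_add_const t).continuousAt.eventually_mem
        ((isOpen_compl_lattice L).mem_nhds (by simpa using hab))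
    filter_upwards [eventually_notMem_lattice L 0, nhdsWithin_le_nhds h3] with z hz hz'
    rw [hEq (show z ∈ Sᶜ from fun h => h.elim hz hz')]
  simpa using tendsto_nhds_unique h1 h2

theorem derivWeierstrassP_ne_zero {z : ℂ} (hz : z ∉ L.lattice) (h2 : 2 * z ∉ L.lattice) :
    L.derivWeierstrassP z ≠ 0 := by
  intro h
  have hz' : -z ∉ L.lattice := fun h => hz (by simpa using neg_mem h)
  have := sub_mem_lattice_of_weierstrassP_eq L hz' hz (L.weierstrassP_neg z)
    (by rw [L.derivWeierstrassP_neg, h, neg_zero])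
  exact h2 (by convert! this using 1; ring)

theorem weierstrassP_ne {z x : ℂ} (hz : z ∉ L.lattice) (hx : x ∉ L.lattice)
    (h1 : x - z ∉ L.lattice) (h2 : x + z ∉ L.lattice) : L.weierstrassP x ≠ L.weierstrassP z := by
  intro h
  have h3 : L.derivWeierstrassP x ^ 2 = L.derivWeierstrassP z ^ 2 := by
    rw [L.derivWeierstrassP_sq x hx, L.derivWeierstrassP_sq z hz, h]
  have hz' : -z ∉ L.lattice := fun h => hz (by simpa using neg_mem h)
  rcases sq_eq_sq_iff_eq_or_eq_neg.1 h3 with h4 | h4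
  · exact h1 (sub_mem_lattice_of_weierstrassP_eq L hz hx h.symm h4.symm)
  · refine h2 ?_
    have := sub_mem_lattice_of_weierstrassP_eq L hz' hx (by rw [L.weierstrassP_neg, h])
      (by rw [L.derivWeierstrassP_neg, h4])
    rwa [sub_neg_eq_add] at this

/-- If ℘' and ℘'' both vanished at z, all derivatives would, and ℘ would be constant. Hence zeros of
℘' are simple, which fixes the residue of f(q, z) at points of order two. -/
theorem six_mul_sq_ne_zero {z : ℂ} (hz : z ∉ L.lattice) (h : L.derivWeierstrassP z = 0) :
    6 * L.weierstrassP z ^ 2 - L.g₂ / 2 ≠ 0 := by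
  intro h2
  have h1 : 4 * L.weierstrassP z ^ 3 - L.g₂ * L.weierstrassP z - L.g₃ = 0 := by
    rw [← L.derivWeierstrassP_sq z hz, h]
    ring
  have hA := L.analyticOnNhd_weierstrassP
  have hloc : L.weierstrassP =ᶠ[𝓝 z] fun _ => L.weierstrassP z := by
    refine eventually_eq_of_iteratedDeriv_eq (hA z hz) analyticAt_const fun n => ?_
    rcases n with _ | n
    · simp
    · obtain ⟨A, B, hAz, hAB⟩ := exists_iteratedDeriv_weierstrassP L n
      rw [hAB z hz, hAz _ h1 h2, h]
      simp [iteratedDeriv_const]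
  exact weierstrassP_not_eqOn_const L (L.weierstrassP z)
    (hA.eqOn_of_preconnected_of_eventuallyEq (fun _ _ => analyticAt_const)
      (isPreconnected_compl_of_countable (countable_lattice L)) hz hloc)

end Weierstrass

/-! ### The functions `f(q, z)` -/

section FEll

variable (L : PeriodPair)

theorem IsElliptic.simplePoleAt_add {L : PeriodPair} {f : Mer} (hf : IsElliptic L f) {x r : ℂ}
    (h : SimplePoleAt f x r) {l : ℂ} (hl : l ∈ L.lattice) : SimplePoleAt f (x + l) r := by
  obtain ⟨F, hF, h1⟩ := hf
  obtain ⟨G, hG, h2⟩ := h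
  refine ⟨F, hF, ?_⟩
  have h3 : Tendsto (fun z => (z - x) * F z) (𝓝[≠] x) (𝓝 r) := h2.congr' <| by
    filter_upwards [hG.eventuallyEq hF x] with z hz
    rw [hz]
  have h4 := h3.comp (tendsto_add_punctured (x + l) (-l) |>.mono_right (by simp))
  refine h4.congr fun z => ?_
  simp only [Function.comp_apply]
  rw [h1 (-l) (neg_mem hl)]
  ring

theorem isElliptic_fEll (z : ℂ) : IsElliptic L (fEll L z) := by
  refine ⟨_, ⟨_, rfl⟩, fun l hl q => ?_⟩
  have h1 := L.weierstrassP_add_coe q ⟨l, hl⟩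
  have h2 := L.derivWeierstrassP_add_coe q ⟨l, hl⟩
  simp only at h1 h2
  rw [h1, h2]

theorem represents_fEll (z : ℂ) : Represents
    (fun q => (L.derivWeierstrassP q + L.derivWeierstrassP z) /
      (2 * (L.weierstrassP q - L.weierstrassP z))) (fEll L z) := ⟨_, rfl⟩

theorem simplePoleAt_fEll_zero (z : ℂ) : SimplePoleAt (fEll L z) 0 (-1) := by
  refine ⟨_, represents_fEll L z, ?_⟩
  have h0 : Tendsto (fun q : ℂ => q) (𝓝[≠] 0) (𝓝 0) := tendsto_id.mono_left nhdsWithin_le_nhds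
  have h1 := ((tendsto_cube_mul_derivWeierstrassP L).add
    ((h0.pow 3).mul_const (L.derivWeierstrassP z))).div
    (((tendsto_sq_mul_weierstrassP L).sub ((h0.pow 2).mul_const (L.weierstrassP z))).const_mul 2)
    (by norm_num)
  norm_num at h1
  refine h1.congr' ?_
  filter_upwards [self_mem_nhdsWithin] with q hq
  have hq' : q ≠ 0 := hq
  rw [Pi.div_apply, sub_zero, ← mul_sub, ← mul_add, ← mul_div_assoc,
    show 2 * (q ^ 2 * (L.weierstrassP q - L.weierstrassP z)) =
      q ^ 2 * (2 * (L.weierstrassP q - L.weierstrassP z)) by ring,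
    show q ^ 3 * (L.derivWeierstrassP q + L.derivWeierstrassP z) =
      q ^ 2 * (q * (L.derivWeierstrassP q + L.derivWeierstrassP z)) by ring,
    mul_div_mul_left _ _ (pow_ne_zero 2 hq')]

/-- A simple zero of the denominator at a point where ℘(x) = ℘(z). The residue is 1 for x = z and 0
for x = -z, by oddness of ℘'. -/
theorem tendsto_sub_mul_fEll {x z : ℂ} (hx : x ∉ L.lattice)
    (hxz : L.weierstrassP x = L.weierstrassP z) (h : L.derivWeierstrassP x ≠ 0) :
    SimplePoleAt (fEll L z) x ((L.derivWeierstrassP x + L.derivWeierstrassP z) /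
      (2 * L.derivWeierstrassP x)) := by
  refine ⟨_, represents_fEll L z, ?_⟩
  have h1 := hasDerivAt_iff_tendsto_slope.1 (hasDerivAt_weierstrassP L hx)
  have h2 : Tendsto L.derivWeierstrassP (𝓝[≠] x) (𝓝 (L.derivWeierstrassP x)) :=
    (L.analyticOnNhd_derivWeierstrassP x hx).continuousAt.tendsto.mono_left nhdsWithin_le_nhds
  have h3 := (h2.add_const (L.derivWeierstrassP z)).div (h1.const_mul 2)
    (mul_ne_zero two_ne_zero h)
  refine h3.congr' ?_
  filter_upwards [self_mem_nhdsWithin] with q hq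
  have hq' : q - x ≠ 0 := sub_ne_zero.2 hq
  rw [Pi.div_apply, slope_def_field, hxz, ← mul_div_assoc, div_div_eq_mul_div, mul_comm,
    mul_div_assoc]

theorem simplePoleAt_fEll_self {z : ℂ} (hz : z ∉ L.lattice) : SimplePoleAt (fEll L z) z 1 := by
  by_cases h : L.derivWeierstrassP z = 0
  · have hA := L.analyticOnNhd_weierstrassP z hz
    -- At a point of order two the denominator has a double zero. Writing ℘ = ℘(z) + (q - z)² D, the
    -- quantity (q - z) f tends to 2D(z)/2D(z) = 1, with D(z) ≠ 0 since ℘''(z) = 2D(z).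
    obtain ⟨D, hD, hDe⟩ : ∃ D : ℂ → ℂ, AnalyticAt ℂ D z ∧
        ∀ q, L.weierstrassP q = L.weierstrassP z + (q - z) ^ 2 * D q := by
      have h1 : AnalyticAt ℂ (dslope L.weierstrassP z) z := by
        obtain ⟨p, hp⟩ := hA
        exact hp.has_fpower_series_dslope_fslope.analyticAt
      have h2 : AnalyticAt ℂ (dslope (dslope L.weierstrassP z) z) z := by
        obtain ⟨p, hp⟩ := h1
        exact hp.has_fpower_series_dslope_fslope.analyticAt
      refine ⟨_, h2, fun q => ?_⟩
      have h3 := sub_smul_dslope L.weierstrassP z q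
      have h4 := sub_smul_dslope (dslope L.weierstrassP z) z q
      rw [dslope_same, L.deriv_weierstrassP, h] at h4
      simp only [smul_eq_mul] at h3 h4
      linear_combination (-1 : ℂ) * h3 - (q - z) * h4
    have hderiv : ∀ᶠ q in 𝓝[≠] z, L.derivWeierstrassP q =
        (q - z) * (2 * D q + (q - z) * deriv D q) := by
      filter_upwards [nhdsWithin_le_nhds hD.eventually_analyticAt,
        eventually_notMem_lattice L z] with q hq hqL
      have h1 := (((hasDerivAt_id q).sub_const z).pow 2).mul hq.differentiableAt.hasDerivAt
        |>.const_add (L.weierstrassP z)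
      have h3 := hasDerivAt_weierstrassP L hqL
      have h4 := h3.unique (h1.congr_of_eventuallyEq (Eventually.of_forall fun w => hDe w))
      rw [h4]
      simp
      ring
    have hlim : Tendsto (fun q => 2 * D q + (q - z) * deriv D q) (𝓝[≠] z) (𝓝 (2 * D z)) := by
      have h1 : ContinuousAt (fun q => 2 * D q + (q - z) * deriv D q) z :=
        (continuousAt_const.mul hD.continuousAt).add
          ((continuousAt_id.sub continuousAt_const).mul hD.deriv.continuousAt)
      have h2 := h1.tendsto.mono_left (nhdsWithin_le_nhds (s := {z}ᶜ))
      simpa using h2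
    have hDz : D z ≠ 0 := by
      have h1 := hasDerivAt_iff_tendsto_slope.1
        (L.analyticOnNhd_derivWeierstrassP z hz).differentiableAt.hasDerivAt
      have h2 : Tendsto (slope L.derivWeierstrassP z) (𝓝[≠] z) (𝓝 (2 * D z)) := by
        refine hlim.congr' ?_
        filter_upwards [hderiv, self_mem_nhdsWithin] with q hq hqz
        rw [slope_def_field, hq, h, sub_zero, mul_div_cancel_left₀ _ (sub_ne_zero.2 hqz)]
      have h3 := tendsto_nhds_unique h1 h2
      rw [deriv_derivWeierstrassP L hz] at h3
      intro h4
      exact six_mul_sq_ne_zero L hz h (by rw [h3, h4, mul_zero])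
    refine ⟨_, represents_fEll L z, ?_⟩
    have h5 := hlim.div ((hD.continuousAt.tendsto.mono_left
      (nhdsWithin_le_nhds (s := {z}ᶜ))).const_mul 2) (mul_ne_zero two_ne_zero hDz)
    rw [div_self (mul_ne_zero two_ne_zero hDz)] at h5
    refine h5.congr' ?_
    filter_upwards [hderiv, self_mem_nhdsWithin] with q hq hqz
    have hq' : q - z ≠ 0 := sub_ne_zero.2 hqz
    rw [hq, hDe q, h, add_zero, add_sub_cancel_left, Pi.div_apply, ← mul_div_assoc, ← mul_assoc,
      show 2 * ((q - z) ^ 2 * D q) = (q - z) * (q - z) * (2 * D q) by ring,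
      mul_div_mul_left _ _ (mul_ne_zero hq' hq')]
  · have h1 := tendsto_sub_mul_fEll L hz rfl h
    rwa [← two_mul, div_self (mul_ne_zero two_ne_zero h)] at h1

theorem regularAt_fEll {z x : ℂ} (hz : z ∉ L.lattice) (hx : x ∉ L.lattice)
    (hxz : x - z ∉ L.lattice) : RegularAt (fEll L z) x := by
  -- At x ≡ -z the denominator vanishes, but so does the numerator. Here 2z is not in the lattice,
  -- since otherwise x ≡ z, so the zero of the denominator is simple.
  by_cases h : x + z ∈ L.lattice
  · have hz' : -z ∉ L.lattice := fun h => hz (by simpa using neg_mem h)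
    have h2 : 2 * z ∉ L.lattice := fun h2 => hxz (by
      convert! sub_mem h h2 using 1
      ring)
    have h3 : L.derivWeierstrassP (-z) ≠ 0 := by
      rw [L.derivWeierstrassP_neg]
      exact neg_ne_zero.2 (derivWeierstrassP_ne_zero L hz h2)
    have h4 := tendsto_sub_mul_fEll L hz' (L.weierstrassP_neg z) h3
    rw [L.derivWeierstrassP_neg, neg_add_cancel, zero_div] at h4
    have h5 := (isElliptic_fEll L z).regularAt_add h4.regularAt h
    rwa [neg_add_cancel_comm_assoc] at h5
  · refine ⟨_, represents_fEll L z, ?_⟩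
    exact ((L.analyticOnNhd_derivWeierstrassP x hx).add analyticAt_const).div
      (analyticAt_const.mul ((L.analyticOnNhd_weierstrassP x hx).sub analyticAt_const))
      (mul_ne_zero two_ne_zero (sub_ne_zero.2 (weierstrassP_ne L hz hx hxz h)))

theorem fEll_congr {z z' : ℂ} (h : z' - z ∈ L.lattice) : fEll L z' = fEll L z := by
  have h1 := L.weierstrassP_add_coe z ⟨_, h⟩
  have h2 := L.derivWeierstrassP_add_coe z ⟨_, h⟩
  simp only [add_sub_cancel] at h1 h2
  simp only [fEll, h1, h2]

variable {L} {m : ℕ} [NeZero m]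

/-- Multiplication by `ω` on the lattice. -/
def latticeRot (hL : ∀ z ∈ L.lattice, ω m * z ∈ L.lattice) : L.lattice ≃ L.lattice where
  toFun l := ⟨ω m * l, hL _ l.2⟩
  invFun l := ⟨ω m ^ (m - 1) * l, ω_pow_mul_mem hL _ l.2⟩
  left_inv l := Subtype.ext <| by
    simp only
    rw [← mul_assoc, ← pow_succ, Nat.sub_add_cancel (NeZero.pos m),
      (isPrimitiveRoot_ω m).pow_eq_one, one_mul]
  right_inv l := Subtype.ext <| by
    simp only
    rw [← mul_assoc, ← pow_succ', Nat.sub_add_cancel (NeZero.pos m),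
      (isPrimitiveRoot_ω m).pow_eq_one, one_mul]

theorem weierstrassP_rot (hL : ∀ z ∈ L.lattice, ω m * z ∈ L.lattice) (z : ℂ) :
    L.weierstrassP (ω m * z) = (ω m)⁻¹ ^ 2 * L.weierstrassP z := by
  simp only [PeriodPair.weierstrassP]
  rw [← (latticeRot hL).tsum_eq, ← tsum_mul_left]
  refine tsum_congr fun l => ?_
  simp only [latticeRot, Equiv.coe_fn_mk]
  rw [← mul_sub, mul_pow, mul_pow, one_div, one_div, mul_inv, mul_inv, one_div, one_div, mul_sub,
    inv_pow]

theorem derivWeierstrassP_rot (hL : ∀ z ∈ L.lattice, ω m * z ∈ L.lattice) (z : ℂ) :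
    L.derivWeierstrassP (ω m * z) = (ω m)⁻¹ ^ 3 * L.derivWeierstrassP z := by
  simp only [PeriodPair.derivWeierstrassP]
  rw [← (latticeRot hL).tsum_eq, mul_neg, ← tsum_mul_left]
  congr 1
  refine tsum_congr fun l => ?_
  simp only [latticeRot, Equiv.coe_fn_mk]
  rw [← mul_sub, mul_pow, div_eq_mul_inv, div_eq_mul_inv, mul_inv, inv_pow]
  ring

theorem rotHom_weierP (hL : ∀ z ∈ L.lattice, ω m * z ∈ L.lattice) :
    rotHom (rootChar m (s m)) (weierP L) = (ω m)⁻¹ ^ 2 • weierP L := by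
  refine (toMer_eq_iff (rotFun _ ⟨_, _⟩) ((ω m)⁻¹ ^ 2 • ⟨_, _⟩)).2 fun x =>
    Eventually.of_forall fun z => ?_
  change L.weierstrassP (rootChar m (s m) * z) = (ω m)⁻¹ ^ 2 * L.weierstrassP z
  rw [rootChar_s, weierstrassP_rot hL]

theorem rotHom_fEll (hL : ∀ z ∈ L.lattice, ω m * z ∈ L.lattice) (z : ℂ) :
    rotHom (rootChar m (s m)) (fEll L (ω m * z)) = (ω m)⁻¹ • fEll L z := by
  refine (toMer_eq_iff (rotFun _ ⟨_, _⟩) ((ω m)⁻¹ • ⟨_, _⟩)).2 fun x =>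
    Eventually.of_forall fun q => ?_
  change (L.derivWeierstrassP (rootChar m (s m) * q) + L.derivWeierstrassP (ω m * z)) /
    (2 * (L.weierstrassP (rootChar m (s m) * q) - L.weierstrassP (ω m * z))) =
    (ω m)⁻¹ * ((L.derivWeierstrassP q + L.derivWeierstrassP z) /
      (2 * (L.weierstrassP q - L.weierstrassP z)))
  have h : (ω m)⁻¹ ≠ 0 := inv_ne_zero (ω_ne_zero m)
  rw [rootChar_s, weierstrassP_rot hL, weierstrassP_rot hL, derivWeierstrassP_rot hL,
    derivWeierstrassP_rot hL, ← mul_add, ← mul_sub,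
    show 2 * ((ω m)⁻¹ ^ 2 * (L.weierstrassP q - L.weierstrassP z)) =
      (ω m)⁻¹ ^ 2 * (2 * (L.weierstrassP q - L.weierstrassP z)) by ring,
    show (ω m)⁻¹ ^ 3 * (L.derivWeierstrassP q + L.derivWeierstrassP z) =
      (ω m)⁻¹ ^ 2 * ((ω m)⁻¹ * (L.derivWeierstrassP q + L.derivWeierstrassP z)) by ring,
    mul_div_mul_left _ _ (pow_ne_zero 2 h), mul_div_assoc]

end FEll

/-! ### Sums of `f(q, x)` over the fixed points -/

section FixedSum

variable {m : ℕ} [NeZero m] {L : PeriodPair}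

theorem pt_out (x : Curve L) : pt L (Quotient.out x) = x := Quotient.out_eq x

theorem pt_eq_zero_iff {x : ℂ} : pt L x = 0 ↔ x ∈ L.lattice :=
  Submodule.Quotient.mk_eq_zero L.lattice

theorem out_notMem {x : Curve L} (hx : x ≠ 0) : (Quotient.out x : ℂ) ∉ L.lattice := fun h =>
  hx (by rw [← pt_out x, pt_eq_zero_iff.2 h])

theorem pt_ω_mul_congr (hL : ∀ z ∈ L.lattice, ω m * z ∈ L.lattice) {x y : ℂ}
    (h : pt L x = pt L y) : pt L (ω m * x) = pt L (ω m * y) := by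
  rw [pt_eq_iff] at *
  rw [← mul_sub]
  exact hL _ h

theorem ω_mul_mem_iff (hL : ∀ z ∈ L.lattice, ω m * z ∈ L.lattice) {x : ℂ} :
    ω m * x ∈ L.lattice ↔ x ∈ L.lattice := by
  refine ⟨fun h => ?_, hL x⟩
  have h1 := ω_pow_mul_mem hL (m - 1) h
  rwa [← mul_assoc, ← pow_succ, Nat.sub_add_cancel (NeZero.pos m),
    (isPrimitiveRoot_ω m).pow_eq_one, one_mul] at h1

/-- `∑ d(x) f(q, x)`, the sum over the nonzero fixed points. -/
def fixedSum (hfin : (fixedPoints m L).Finite) (d : Curve L → ℂ) : Mer :=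
  ∑ x ∈ hfin.toFinset, d x • fEll L (Quotient.out x)

theorem fk_eq_fixedSum (hfin : (fixedPoints m L).Finite) (c : Couplings m L) (k : ℕ) :
    c.fk k = fixedSum hfin (c.μ k) := finsum_mem_eq_finite_toFinset_sum _ hfin

theorem isElliptic_fixedSum (hfin : (fixedPoints m L).Finite) (d : Curve L → ℂ) :
    IsElliptic L (fixedSum hfin d) :=
  IsElliptic.sum fun _ _ => (isElliptic_fEll L _).smul _

theorem simplePoleAt_fixedSum_zero (hfin : (fixedPoints m L).Finite) (d : Curve L → ℂ) :
    SimplePoleAt (fixedSum hfin d) 0 (-∑ x ∈ hfin.toFinset, d x) := by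
  have h := SimplePoleAt.sum (s := hfin.toFinset) fun x _ =>
    (simplePoleAt_fEll_zero L (Quotient.out x)).smul (d x)
  simpa [fixedSum] using h

theorem simplePoleAt_fixedSum (hfin : (fixedPoints m L).Finite) {d : Curve L → ℂ} {p : ℂ}
    (hp : p ∉ L.lattice) (hd : pt L p ∉ fixedPoints m L → d (pt L p) = 0) :
    SimplePoleAt (fixedSum hfin d) p (d (pt L p)) := by
  classical
  have h1 : ∀ x ∈ hfin.toFinset, SimplePoleAt (d x • fEll L (Quotient.out x)) p
      (d x * if x = pt L p then 1 else 0) := fun x hx => by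
    have hx' : (Quotient.out x : ℂ) ∉ L.lattice := out_notMem ((hfin.mem_toFinset.1 hx).1)
    refine SimplePoleAt.smul _ ?_
    split_ifs with h
    · rw [← pt_out x, eq_comm, pt_eq_iff] at h
      have h2 := (isElliptic_fEll L _).simplePoleAt_add (simplePoleAt_fEll_self L hx') h
      rwa [add_sub_cancel] at h2
    · refine (regularAt_fEll L hx' hp fun h2 => h ?_).simplePoleAt
      rw [← pt_out x, eq_comm]
      exact pt_eq_iff.2 h2
  have h2 := SimplePoleAt.sum h1
  convert! h2 using 1
  simp only [mul_ite, mul_one, mul_zero, Finset.sum_ite_eq', hfin.mem_toFinset]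
  split_ifs with h
  exacts [rfl, hd h]

theorem pt_ω_mem_fixedPoints (hL : ∀ z ∈ L.lattice, ω m * z ∈ L.lattice) {z : ℂ} :
    pt L (ω m * z) ∈ fixedPoints m L ↔ pt L z ∈ fixedPoints m L := by
  have key : ∀ y : ℂ, pt L y ∈ fixedPoints m L ↔
      y ∉ L.lattice ∧ ∃ l ∈ Finset.Ico 1 m, ω m ^ l * y - y ∈ L.lattice := fun y => by
    refine and_congr pt_eq_zero_iff.not (exists_congr fun l => and_congr_right fun _ => ?_)
    constructor
    · rintro ⟨z, h1, h2⟩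
      rw [pt_eq_iff] at h1 h2
      have h3 := sub_mem h2 (ω_pow_mul_mem hL l h1)
      convert! h3 using 1
      ring
    · exact fun h => ⟨y, rfl, pt_eq_iff.2 h⟩
  rw [key, key, ω_mul_mem_iff hL]
  refine and_congr_right fun _ => exists_congr fun l => and_congr_right fun _ => ?_
  rw [mul_left_comm, ← mul_sub, ω_mul_mem_iff hL]

/-- f(ωq, ωx) = ω⁻¹ f(q, x), so the claim follows by reindexing the sum along x ↦ ω⁻¹ x. The
coordinates chosen by `Quotient.out` change under this, but f(q, x) depends only on the class of x.
-/
theorem rotHom_fixedSum (hL : ∀ z ∈ L.lattice, ω m * z ∈ L.lattice)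
    (hfin : (fixedPoints m L).Finite) {d : Curve L → ℂ}
    (hd : ∀ x : ℂ, d (pt L (ω m * x)) = d (pt L x)) :
    rotHom (rootChar m (s m)) (fixedSum hfin d) = (ω m)⁻¹ • fixedSum hfin d := by
  have hω : ω m * (ω m)⁻¹ = 1 := mul_inv_cancel₀ (ω_ne_zero m)
  have hpt : ∀ x : Curve L, pt L (ω m * ((ω m)⁻¹ * Quotient.out x)) = x := fun x => by
    rw [← mul_assoc, hω, one_mul, pt_out]
  rw [fixedSum, map_sum, Finset.smul_sum]
  refine Finset.sum_nbij' (fun x => pt L ((ω m)⁻¹ * Quotient.out x))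
    (fun x => pt L (ω m * Quotient.out x)) ?_ ?_ ?_ ?_ ?_
  · intro x hx
    rw [hfin.mem_toFinset, ← pt_ω_mem_fixedPoints hL, hpt]
    exact hfin.mem_toFinset.1 hx
  · intro x hx
    rw [hfin.mem_toFinset, pt_ω_mem_fixedPoints hL, pt_out]
    exact hfin.mem_toFinset.1 hx
  · intro x _
    rw [pt_ω_mul_congr hL (pt_out (pt L ((ω m)⁻¹ * Quotient.out x))), hpt]
  · intro x _
    have h2 : pt L ((ω m)⁻¹ * Quotient.out (pt L (ω m * Quotient.out x))) =
        pt L (Quotient.out x) := by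
      rw [pt_eq_iff, ← ω_mul_mem_iff hL, mul_sub, ← mul_assoc, hω, one_mul, ← pt_eq_iff, pt_out]
    rw [h2, pt_out]
  · intro x _
    have h1 : fEll L (Quotient.out (pt L ((ω m)⁻¹ * Quotient.out x))) =
        fEll L ((ω m)⁻¹ * Quotient.out x) := fEll_congr L (pt_eq_iff.1 (pt_out _))
    have h2 := rotHom_fEll hL ((ω m)⁻¹ * Quotient.out x)
    rw [← mul_assoc, hω, one_mul] at h2
    rw [map_smul, h1, h2, smul_comm, ← hd, hpt]

theorem Couplings.c_eq_zero (c : Couplings m L) {p : ℂ} (hp : p ∉ L.lattice)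
    (hS : pt L p ∉ fixedPoints m L) {l : ℕ} (hl : l ∈ Finset.Ico 1 m) : c.c l (pt L p) = 0 := by
  refine c.eq_zero l hl p fun h => hS ⟨fun h0 => hp (pt_eq_zero_iff.1 h0), l, hl, p, rfl, h⟩

theorem Couplings.μ_invariant (c : Couplings m L) (k : ℕ) (x : ℂ) :
    c.μ k (pt L (ω m * x)) = c.μ k (pt L x) :=
  Finset.sum_congr rfl fun l hl => by rw [c.invariant l hl]

theorem simplePoleAt_fk (hfin : (fixedPoints m L).Finite) (c : Couplings m L) (k : ℕ) {p : ℂ}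
    (hp : p ∉ L.lattice) : SimplePoleAt (c.fk k) p (c.μ k (pt L p)) := by
  rw [fk_eq_fixedSum hfin]
  refine simplePoleAt_fixedSum hfin hp fun hS => Finset.sum_eq_zero fun l hl => ?_
  rw [c.c_eq_zero hp hS hl, mul_zero]

theorem rotHom_fk (hL : ∀ z ∈ L.lattice, ω m * z ∈ L.lattice) (c : Couplings m L) (k : ℕ) :
    rotHom (rootChar m (s m)) (c.fk k) = (ω m)⁻¹ • c.fk k := by
  rw [fk_eq_fixedSum (finite_fixedPoints hL)]
  exact rotHom_fixedSum hL _ (c.μ_invariant k)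

/-! ### Existence of charts -/

/-- Away from the lattice, b_l = ∑ c_l(x) f(q, x) works. Its residue at 0 is forced to be -∑ c_l(x);
to correct it, an extra pole is moved to an auxiliary point z whose orbit is removed from the chart.
-/
theorem exists_chart (hL : ∀ z ∈ L.lattice, ω m * z ∈ L.lattice) (c : Couplings m L) (x : ℂ) :
    ∃ U, IsChart m L U ∧ x ∈ U ∧ ∃ b, AdmissibleOn c U b := by
  have hfin := finite_fixedPoints hL
  by_cases hx : x ∈ L.lattice
  · have hz := L.ω₁_div_two_notMem_lattice
    set z := L.ω₁ / 2
    have hzj : ∀ j : ℕ, ω m ^ j * z ∉ L.lattice := fun j => by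
      induction j with
      | zero => simpa using hz
      | succ j ih => rwa [pow_succ', mul_assoc, ω_mul_mem_iff hL]
    -- f(q, z) has residue -1 at 0, so subtracting (c_l(0) + ∑ c_l(x)) f(q, z) changes the residue
    -- from -∑ c_l(x) to c_l(0).
    refine ⟨{y | ∀ j ∈ Finset.range m, y - ω m ^ j * z ∉ L.lattice}, ⟨?_, ?_, ?_⟩, ?_,
      fun l => fixedSum hfin (c.c l) -
        (c.c l (pt L 0) + ∑ y ∈ hfin.toFinset, c.c l y) • fEll L z, ?_⟩
    · simp only [Set.ofPred_forall]
      refine isOpen_biInter_finset fun j _ => ?_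
      exact (isOpen_compl_lattice L).preimage (continuous_sub_right _)
    · intro y hy l hl j hj h
      refine hy j hj ?_
      have := sub_mem h hl
      convert! this using 1
      ring
    · intro y hy j hj h
      -- The exponent j - 1 modulo m, written without truncated subtraction.
      refine hy ((j + (m - 1)) % m) (Finset.mem_range.2 (Nat.mod_lt _ (NeZero.pos m))) ?_
      have hω : ω m * ω m ^ ((j + (m - 1)) % m) = ω m ^ j := by
        have h1 := (pow_mod_orderOf (ω m) (j + (m - 1)))
        rw [← (isPrimitiveRoot_ω m).eq_orderOf] at h1
        rw [h1, ← pow_succ', show j + (m - 1) + 1 = j + m by have := NeZero.pos m; omega, pow_add,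
          (isPrimitiveRoot_ω m).pow_eq_one, mul_one]
      rw [← ω_mul_mem_iff hL, mul_sub, ← mul_assoc, hω]
      exact h
    · intro j _ h
      have := sub_mem hx h
      rw [sub_sub_cancel] at this
      exact hzj j this
    · intro l hl
      have hE : IsElliptic L (fixedSum hfin (c.c l) -
          (c.c l (pt L 0) + ∑ y ∈ hfin.toFinset, c.c l y) • fEll L z) := by
        rw [sub_eq_add_neg, ← neg_smul]
        exact (isElliptic_fixedSum hfin _).add ((isElliptic_fEll L z).smul _)
      refine ⟨hE, fun y hy => ?_⟩
      by_cases hyL : y ∈ L.lattice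
      · have h0 := (simplePoleAt_fixedSum_zero hfin (c.c l)).sub
          ((simplePoleAt_fEll_zero L z).smul (c.c l (pt L 0) + ∑ y ∈ hfin.toFinset, c.c l y))
        have h1 := hE.simplePoleAt_add h0 hyL
        rw [zero_add] at h1
        convert! h1 using 1
        rw [pt_eq_zero_iff.2 hyL, show pt L 0 = 0 from pt_eq_zero_iff.2 (zero_mem _)]
        ring
      · have hyz : y - z ∉ L.lattice := by
          simpa using hy 0 (Finset.mem_range.2 (NeZero.pos m))
        have h1 := (simplePoleAt_fixedSum hfin hyL fun hS => c.c_eq_zero hyL hS hl).sub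
          ((regularAt_fEll L hz hyL hyz).simplePoleAt.smul
            (c.c l (pt L 0) + ∑ y ∈ hfin.toFinset, c.c l y))
        rwa [mul_zero, sub_zero] at h1
  · refine ⟨(L.lattice : Set ℂ)ᶜ, ⟨isOpen_compl_lattice L, ?_, ?_⟩, hx,
      fun l => fixedSum hfin (c.c l), fun l hl => ⟨isElliptic_fixedSum hfin _, fun y hy =>
        simplePoleAt_fixedSum hfin hy fun hS => c.c_eq_zero hy hS hl⟩⟩
    · intro y hy l hl h
      exact hy (by simpa using sub_mem h hl)
    · intro y hy h
      exact hy ((ω_mul_mem_iff hL).1 h)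

end FixedSum

/-! ### Expansions at the origin -/

section Expansion

variable {m : ℕ} [NeZero m] {L : PeriodPair}

theorem rotHom_ddq (f : Mer) : rotHom (rootChar m (s m)) (ddq f) =
    (ω m)⁻¹ • ddq (rotHom (rootChar m (s m)) f) := by
  rw [ddq_rotHom, rootChar_s, smul_smul, inv_mul_cancel₀ (ω_ne_zero m), one_smul]

theorem rotHom_ddq_iterate {f : Mer} {k : ℕ}
    (hf : rotHom (rootChar m (s m)) f = (ω m)⁻¹ ^ k • f) (i : ℕ) :
    rotHom (rootChar m (s m)) (ddq^[i] f) = (ω m)⁻¹ ^ (i + k) • ddq^[i] f := by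
  induction i with
  | zero => simpa using hf
  | succ i ih =>
    rw [Function.iterate_succ_apply', rotHom_ddq, ih, map_smul, smul_smul, ← pow_succ']
    congr 2
    omega

theorem rotHom_qInv : rotHom (rootChar m (s m)) qInv = (ω m)⁻¹ • qInv := by
  refine (toMer_eq_iff (rotFun _ ⟨_, _⟩) ((ω m)⁻¹ • ⟨_, _⟩)).2 fun x =>
    Eventually.of_forall fun z => ?_
  change ((rootChar m (s m) : ℂˣ) * z : ℂ)⁻¹ = (ω m)⁻¹ * z⁻¹
  rw [rootChar_s, mul_inv]

theorem ω_pow_ne_one {k : ℕ} (hk : 0 < k) (hkm : k < m) : ω m ^ k ≠ 1 := fun h =>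
  absurd (Nat.le_of_dvd hk ((isPrimitiveRoot_ω m).dvd_of_pow_eq_one k h)) (by omega)

theorem inv_ω_pow {j k : ℕ} (h : j + k = m) : (ω m)⁻¹ ^ j = ω m ^ k := by
  rw [inv_pow]
  refine inv_eq_of_mul_eq_one_right ?_
  rw [← pow_add, h, (isPrimitiveRoot_ω m).pow_eq_one]

/-- Weight -j equals weight k modulo m. As j > 0 gives k < m, no exponent smaller than k has this
weight. -/
theorem exists_eq_qMer_pow_mul_of_rot {f : Mer} (hf : RegularAt f 0) {j k : ℕ} (hj : 0 < j)
    (h : j + k = m) (hrot : rotHom (rootChar m (s m)) f = (ω m)⁻¹ ^ j • f) :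
    ∃ g, RegularAt g 0 ∧ f = qMer ^ k * g := by
  refine exists_eq_qMer_pow_mul hf (rootChar m (s m)) k (fun i hi => ?_) ?_
  · rw [rootChar_s]
    have := Finset.mem_Ico.1 hi
    exact ω_pow_ne_one (by omega) (by omega)
  · rw [hrot, rootChar_s, inv_ω_pow h]

theorem exists_fk_expansion (hL : ∀ z ∈ L.lattice, ω m * z ∈ L.lattice) (c : Couplings m L)
    (k : ℕ) : ∃ g, RegularAt g 0 ∧ c.fk k = (-c.μbar k) • qInv + qMer ^ (m - 1) * g := by
  have hfin := finite_fixedPoints hL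
  have h1 := simplePoleAt_fixedSum_zero hfin (c.μ k)
  rw [← fk_eq_fixedSum, ← μbar_eq_sum hfin] at h1
  have h2 := h1.sub (simplePoleAt_qInv.smul (-c.μbar k))
  rw [mul_one, sub_self] at h2
  obtain ⟨g, hg, he⟩ := exists_eq_qMer_pow_mul_of_rot (m := m) (j := 1) (k := m - 1) h2.regularAt
    one_pos (by have := NeZero.pos m; omega) (by
      rw [map_sub, map_smul, rotHom_fk hL, rotHom_qInv, pow_one, smul_sub, smul_comm])
  exact ⟨g, hg, by rw [← he]; abel⟩

theorem ddq_iterate_qInv_sq (i : ℕ) : ddq^[i] (qInv ^ 2) =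
    ((-1) ^ (i + 2) * (Nat.factorial (i + 1) : ℂ)) • qInv ^ (i + 2) := by
  induction i with
  | zero => simp
  | succ i ih =>
    rw [Function.iterate_succ_apply', ih, map_smul, ddq_qInv_pow, smul_neg, ← neg_smul, smul_smul,
      Nat.factorial_succ (i + 1)]
    congr 1
    push_cast
    ring

theorem regularAt_ddq_iterate {f : Mer} {x : ℂ} (hf : RegularAt f x) (i : ℕ) :
    RegularAt (ddq^[i] f) x := by
  induction i with
  | zero => exact hf
  | succ i ih =>
    rw [Function.iterate_succ_apply']
    exact ih.ddq

theorem isElliptic_ddq_iterate {f : Mer} (hf : IsElliptic L f) (i : ℕ) :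
    IsElliptic L (ddq^[i] f) := by
  induction i with
  | zero => exact hf
  | succ i ih =>
    rw [Function.iterate_succ_apply']
    exact ih.ddq

theorem isElliptic_weierP : IsElliptic L (weierP L) :=
  ⟨_, ⟨_, rfl⟩, fun l hl z => L.weierstrassP_add_coe z ⟨l, hl⟩⟩

theorem regularAt_weierP {x : ℂ} (hx : x ∉ L.lattice) : RegularAt (weierP L) x :=
  ⟨_, ⟨_, rfl⟩, L.analyticOnNhd_weierstrassP x hx⟩

theorem regularAt_weierP_sub : RegularAt (weierP L - qInv ^ 2) 0 := by
  have h : Tendsto (L.weierstrassPExcept 0) (𝓝[≠] 0) (𝓝 (L.weierstrassPExcept 0 0)) :=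
    (L.analyticAt_weierstrassPExcept 0).continuousAt.tendsto.mono_left nhdsWithin_le_nhds
  refine regularAt_iff.2 ⟨_, (hasLim_mk (f := ⟨_, fun x => L.meromorphic_weierstrassP x⟩ -
    ⟨_, fun x => (MeromorphicAt.id x).inv⟩ ^ 2)).2 (h.congr fun z => ?_)⟩
  have h3 := L.weierstrassPExcept_def 0 z
  simp only [ZeroMemClass.coe_zero, sub_zero] at h3
  rw [h3]
  change _ = L.weierstrassP z - z⁻¹ ^ 2
  simp
  ring

/-- The polar part is the i-th derivative of q⁻², the source of the signs and factorials in the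
relation for the α_i. The remainder is regular of weight -(i + 2), hence divisible by q^(m-i-2). -/
theorem exists_weierP_expansion (hL : ∀ z ∈ L.lattice, ω m * z ∈ L.lattice) {i k : ℕ}
    (h : i + 2 + k = m) : ∃ g, RegularAt g 0 ∧ ddq^[i] (weierP L) =
      ((-1) ^ (i + 2) * (Nat.factorial (i + 1) : ℂ)) • qInv ^ (i + 2) + qMer ^ k * g := by
  have hsub : ∀ i, ddq^[i] (weierP L) - ddq^[i] (qInv ^ 2) = ddq^[i] (weierP L - qInv ^ 2) := by
    intro i
    induction i with
    | zero => rfl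
    | succ i ih =>
      rw [Function.iterate_succ_apply', Function.iterate_succ_apply',
        Function.iterate_succ_apply', ← map_sub, ih]
  obtain ⟨g, hg, he⟩ := exists_eq_qMer_pow_mul_of_rot (m := m) (j := i + 2) (k := k)
    (regularAt_ddq_iterate regularAt_weierP_sub i) (by omega) h
    (rotHom_ddq_iterate (by
      rw [map_sub, map_pow, rotHom_weierP hL, rotHom_qInv, smul_pow, smul_sub]) i)
  refine ⟨g, hg, ?_⟩
  rw [← ddq_iterate_qInv_sq, ← he, ← hsub]
  abel

end Expansion

/-! ### The hamiltonian is a section over every chart -/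

section Hamiltonian

variable {R : Type} [Ring R] [Algebra ℂ R]
variable {ι : Mer →ₐ[ℂ] R} {P : R} {ħ : ℂ} {m : ℕ} [NeZero m] [MulSemiringAction (Zm m) R]
variable {L : PeriodPair} {c : Couplings m L}

theorem IsMomentum.smul_ladder (h : IsMomentum ι P ħ m) {g : ℕ → Mer}
    (hg : ∀ j, rotHom (rootChar m (s m)) (g j) = (ω m)⁻¹ • g j) (j : ℕ) :
    s m • ladder ι P g j = (ω m)⁻¹ ^ j • ladder ι P g j := by
  induction j with
  | zero => simp [ladder]
  | succ j ih =>
    rw [ladder, smul_mul', ih, smul_sub, h.smul_momentum, h.smul_coeff, hg, map_smul, ← smul_sub,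
      smul_mul_smul_comm, ← pow_succ']

theorem IsMomentum.smul_pow_ladder (h : IsMomentum ι P ħ m) {g : ℕ → Mer}
    (hg : ∀ j, rotHom (rootChar m (s m)) (g j) = (ω m)⁻¹ • g j) (j l : ℕ) :
    s m ^ l • ladder ι P g j = (ω m)⁻¹ ^ (j * l) • ladder ι P g j := by
  induction l with
  | zero => simp
  | succ l ih =>
    rw [pow_succ', mul_smul, ih, h.smul_complex, h.smul_ladder hg, smul_smul, ← pow_add]
    rfl

/-- The j-th ladder product has weight -j, so y acts on it as left multiplication by P - ∑ ω^{-jl}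
b_l. This differs from the next factor P - g_j by an element of `K`. The lemma serves f_j away from
the lattice and μ_j(0)/q at the origin. -/
theorem IsMomentum.ladder_mem_dunklSpan (h : IsMomentum ι P ħ m) {b g : ℕ → Mer}
    {K : Subalgebra ℂ Mer} (hb : Compatible m b K)
    (hg : ∀ j, rotHom (rootChar m (s m)) (g j) = (ω m)⁻¹ • g j)
    (hK : ∀ j, ∑ l ∈ Finset.Ico 1 m, (ω m)⁻¹ ^ (j * l) • b l - g j ∈ K) (j : ℕ) :
    ladder ι P g j ∈ dunklSpan ι P m K b := by
  induction j with
  | zero => exact one_mem_dunklSpan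
  | succ j ih =>
    have h1 : ladder ι P g (j + 1) = dunklMap ι P m b (ladder ι P g j) +
        ι (∑ l ∈ Finset.Ico 1 m, (ω m)⁻¹ ^ (j * l) • b l - g j) * ladder ι P g j := by
      rw [dunklMap_apply, ladder, map_sub, map_sum, sub_mul, sub_mul, Finset.sum_mul]
      simp only [h.smul_pow_ladder hg, map_smul, smul_mul_assoc, mul_smul_comm]
      abel
    rw [h1]
    exact add_mem (h.dunklMap_mem_dunklSpan hb ih) (coeff_mul_mem_dunklSpan (hK j) ih)

theorem IsMomentum.ladder_monic (h : IsMomentum ι P ħ m) (g : ℕ → Mer) (j : ℕ) :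
    ladder ι P g j - P ^ j ∈ ordLT ι P j := by
  induction j with
  | zero => simp [ladder]
  | succ j ih =>
    have h1 : ladder ι P g (j + 1) - P ^ (j + 1) =
        P * (ladder ι P g j - P ^ j) - ι (g j) * ladder ι P g j := by
      rw [ladder, pow_succ']
      noncomm_ring
    rw [h1]
    exact sub_mem (h.mul_mem_ordLT ih) (coeff_mul_mem_ordLT _ (mem_ordLT_of_monic ih))

theorem IsMomentum.hamiltonian_monic (h : IsMomentum ι P ħ m) (α : Fin (m - 1) → ℂ) :
    hamiltonian ι P c α - P ^ m ∈ ordLT ι P m := by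
  rw [hamiltonian, add_sub_right_comm]
  refine add_mem (h.ladder_monic _ _) (sum_mem fun i _ => smul_mem_coeffSpan _ ?_)
  exact coeff_mul_mem_ordLT _
    (coeffSpan_mono (by omega) (mem_ordLT_of_monic (h.ladder_monic _ (m - 2 - i))))

theorem IsMomentum.smul_hamiltonian (h : IsMomentum ι P ħ m)
    (hL : ∀ z ∈ L.lattice, ω m * z ∈ L.lattice) (α : Fin (m - 1) → ℂ) :
    s m • hamiltonian ι P c α = hamiltonian ι P c α := by
  have hω : (ω m)⁻¹ ^ m = 1 := (isPrimitiveRoot_ω m).inv.pow_eq_one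
  rw [hamiltonian, smul_add, w, h.smul_ladder (rotHom_fk hL c), hω, one_smul, Finset.smul_sum]
  congr 1
  refine Finset.sum_congr rfl fun i _ => ?_
  rw [h.smul_complex, v, smul_mul', h.smul_ladder (rotHom_fk hL c), h.smul_coeff,
    rotHom_ddq_iterate (rotHom_weierP hL), map_smul, smul_mul_smul_comm, ← pow_add,
    show (i : ℕ) + 2 + (m - 2 - i) = m by omega, hω, one_smul]

/-- Away from the lattice the hamiltonian is a section. -/
theorem IsMomentum.hamiltonian_mem_compl (h : IsMomentum ι P ħ m)
    (hL : ∀ z ∈ L.lattice, ω m * z ∈ L.lattice) {U : Set ℂ} (hU : IsChart m L U) {b : ℕ → Mer}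
    (hb : AdmissibleOn c U b) (α : Fin (m - 1) → ℂ) :
    hamiltonian ι P c α ∈ dunklSpan ι P m (regularSubalgebra L (U \ L.lattice)) b := by
  have hfin := finite_fixedPoints hL
  have hcomp : Compatible m b (regularSubalgebra L (U \ L.lattice)) :=
    compatible_regularSubalgebra hL hb Set.sdiff_subset fun x hx =>
      ⟨hU.mul_mem x hx.1, fun hx' => hx.2 ((ω_mul_mem_iff hL).1 hx')⟩
  have hlad := h.ladder_mem_dunklSpan hcomp (rotHom_fk hL c) fun j => by
    refine ⟨?_, fun x hx => ?_⟩
    · rw [sub_eq_add_neg, ← neg_one_smul ℂ (c.fk j)]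
      refine (IsElliptic.sum fun l hl => (hb l hl).1.smul _).add (IsElliptic.smul _ ?_)
      rw [fk_eq_fixedSum hfin]
      exact isElliptic_fixedSum hfin _
    · have h1 := (SimplePoleAt.sum (s := Finset.Ico 1 m) fun l hl =>
        ((hb l hl).2 x hx.1).smul ((ω m)⁻¹ ^ (j * l))).sub (simplePoleAt_fk hfin c j hx.2)
      rw [Couplings.μ, sub_self] at h1
      exact h1.regularAt
  refine add_mem (hlad m) (sum_mem fun i _ => smul_mem_dunklSpan _ ?_)
  exact coeff_mul_mem_dunklSpan ⟨isElliptic_ddq_iterate isElliptic_weierP _, fun x hx =>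
    regularAt_ddq_iterate (regularAt_weierP hx.2) _⟩ (hlad _)

/-- The elements that preserve an additive subgroup. -/
def leftStabilizer (N : AddSubgroup R) : Subring R where
  carrier := {r | ∀ x ∈ N, r * x ∈ N}
  mul_mem' {a b} ha hb x hx := by
    rw [mul_assoc]
    exact ha _ (hb x hx)
  one_mem' x hx := by rwa [one_mul]
  add_mem' ha hb x hx := by
    rw [add_mul]
    exact add_mem (ha x hx) (hb x hx)
  zero_mem' x _ := by
    rw [zero_mul]
    exact zero_mem N
  neg_mem' ha x hx := by
    rw [neg_mul]
    exact neg_mem (ha x hx)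

/-! ### Ladder products modulo operators generated by regular germs and qP -/

section Ladder

variable {E : Subring R}

theorem algebraMap_mem_of_coeff (hK : ∀ f, RegularAt f 0 → ι f ∈ E) (t : ℂ) :
    algebraMap ℂ R t ∈ E := by
  rw [← ι.commutes]
  exact hK _ (regularAt_algebraMap t 0)

theorem IsMomentum.exists_ladder_eq (h : IsMomentum ι P ħ m)
    (hK : ∀ f, RegularAt f 0 → ι f ∈ E) (hT : ι qMer * P ∈ E) (t : ℕ → ℂ) (j : ℕ) :
    ∃ r ∈ E, ladder ι P (fun k => t k • qInv) j = ι (qInv ^ j) * r := by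
  refine ⟨_, ?_, h.ladder_smul_qInv t j⟩
  rw [Polynomial.aeval_eq_sum_range]
  refine sum_mem fun k _ => ?_
  rw [Algebra.smul_def]
  exact mul_mem (algebraMap_mem_of_coeff hK _) (pow_mem hT k)

theorem qMer_pow_mul_qInv_pow (j k : ℕ) : qMer ^ (k + j) * qInv ^ j = qMer ^ k := by
  rw [pow_add, mul_assoc, ← mul_pow, qMer_mul_qInv, one_pow, mul_one]

theorem regularAt_qMer_pow (k : ℕ) (x : ℂ) : RegularAt (qMer ^ k) x := by
  induction k with
  | zero => simpa using regularAt_algebraMap 1 x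
  | succ k ih =>
    rw [pow_succ]
    exact ih.mul (hasLim_qMer x).regularAt

/-- Dropping the regular part q^(m-1) g of each factor costs only q^(m-j) E after j factors: a
factor P - t/q lowers the power of q by one, and the new error q^(m-1) g is multiplied by a ladder
in q^{-j} E, which leaves q^(m-1-j) E. -/
theorem IsMomentum.exists_ladder_sub (h : IsMomentum ι P ħ m)
    (hK : ∀ f, RegularAt f 0 → ι f ∈ E) (hT : ι qMer * P ∈ E) {t : ℕ → ℂ} {g f : ℕ → Mer}
    (hg : ∀ k, RegularAt (g k) 0) (hf : ∀ k, f k = t k • qInv + qMer ^ (m - 1) * g k)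
    (j k : ℕ) (hjk : k + j = m) :
    ∃ r ∈ E, ladder ι P f j = ladder ι P (fun k => t k • qInv) j + ι (qMer ^ k) * r := by
  induction j generalizing k with
  | zero => exact ⟨0, zero_mem _, by simp [ladder]⟩
  | succ j ih =>
    obtain ⟨r, hr, he⟩ := ih (k + 1) (by omega)
    obtain ⟨r', hr', he'⟩ := h.exists_ladder_eq hK hT t j
    have h1 : (P - ι (t j • qInv)) * ι (qMer ^ (k + 1)) =
        ι (qMer ^ k) * (ι qMer * P + algebraMap ℂ R (ħ * (k + 1) - t j)) := by
      have h2 : ι (t j • qInv) * ι (qMer ^ (k + 1)) = ι (qMer ^ k) * algebraMap ℂ R (t j) := by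
        rw [← map_mul, smul_mul_assoc, pow_succ', ← mul_assoc, qInv_mul_qMer, one_mul, map_smul,
          Algebra.smul_def, Algebra.commutes]
      rw [sub_mul, h2, h.mul_coeff, ddq_qMer_pow, map_smul, smul_smul, pow_succ, map_mul, map_sub]
      generalize ħ * ((k : ℂ) + 1) = u
      rw [mul_add, mul_sub, mul_assoc, ← Algebra.commutes u, ← Algebra.smul_def, add_sub_assoc]
    have h3 : ι (qMer ^ (m - 1) * g j) * ι (qInv ^ j) = ι (qMer ^ k) * ι (g j) := by
      rw [← map_mul, ← map_mul, mul_right_comm, show m - 1 = k + j by omega,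
        qMer_pow_mul_qInv_pow]
    have h4 : ι (qMer ^ (m - 1) * g j) * ι (qMer ^ (k + 1)) =
        ι (qMer ^ k) * ι (qMer ^ m * g j) := by
      rw [← map_mul, ← map_mul, mul_right_comm, ← pow_add, ← mul_assoc, ← pow_add]
      congr 3
      omega
    refine ⟨(ι qMer * P + algebraMap ℂ R (ħ * (k + 1) - t j)) * r - ι (g j) * r' -
      ι (qMer ^ m * g j) * r, ?_, ?_⟩
    · exact sub_mem (sub_mem (mul_mem (add_mem hT (algebraMap_mem_of_coeff hK _)) hr)
        (mul_mem (hK _ (hg j)) hr'))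
        (mul_mem (hK _ ((regularAt_qMer_pow m 0).mul (hg j))) hr)
    · rw [ladder, ladder, he, hf, map_add, ← sub_sub, sub_mul, mul_add, mul_add, ← mul_assoc _ _ r,
        ← mul_assoc _ _ r, h1, h4, he', ← mul_assoc _ _ r', ← mul_assoc _ _ r', h3]
      noncomm_ring

end Ladder

/-- Near the origin the hamiltonian is a section. -/
theorem IsMomentum.hamiltonian_mem_zero (h : IsMomentum ι P ħ m)
    (hL : ∀ z ∈ L.lattice, ω m * z ∈ L.lattice) {U : Set ℂ} (h0 : (0 : ℂ) ∈ U) {b : ℕ → Mer}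
    (hb : AdmissibleOn c U b) {α : Fin (m - 1) → ℂ} (hα : PrincipalPartsMatch ι P c α) :
    hamiltonian ι P c α ∈ dunklSpan ι P m regularAtZero b := by
  have hcomp := compatible_regularAtZero hb h0
  have hres : ∀ l ∈ Finset.Ico 1 m, SimplePoleAt (b l) 0 (c.c l 0) := fun l hl => by
    have h1 := (hb l hl).2 0 h0
    rwa [pt_eq_zero_iff.2 (zero_mem _)] at h1
  set E := leftStabilizer (dunklSpan ι P m regularAtZero b)
  have hK : ∀ f, RegularAt f 0 → ι f ∈ E := fun f hf x hx => coeff_mul_mem_dunklSpan hf hx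
  -- qP = q y + ∑ (q b_l) s^l in the action, and q b_l is regular at 0.
  have hT : ι qMer * P ∈ E := fun x hx => by
    have h1 : ι qMer * P * x = ι qMer * dunklMap ι P m b x +
        ∑ l ∈ Finset.Ico 1 m, ι (qMer * b l) * (s m ^ l • x) := by
      simp only [dunklMap_apply, mul_sub, Finset.mul_sum, map_mul, mul_assoc]
      abel
    rw [h1]
    refine add_mem (coeff_mul_mem_dunklSpan (hasLim_qMer 0).regularAt
      (h.dunklMap_mem_dunklSpan hcomp hx)) (sum_mem fun l hl => ?_)
    exact coeff_mul_mem_dunklSpan (hres l hl).regularAt_qMer_mul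
      (smul_pow_mem (fun _ => h.rot_mem_dunklSpan hcomp) l hx)
  have hE : ∀ r ∈ E, r ∈ dunklSpan ι P m regularAtZero b := fun r hr => by
    simpa using hr 1 one_mem_dunklSpan
  -- ∑ ω^{-jl} b_l has residue μ_j(0) at the origin, so each ladder step differs from y by a regular
  -- coefficient.
  have hmodel : ladder ι P (fun k => c.μ k 0 • qInv) m ∈ dunklSpan ι P m regularAtZero b := by
    refine h.ladder_mem_dunklSpan hcomp (fun j => ?_) (fun j => ?_) m
    · rw [map_smul, rotHom_qInv, smul_comm]
    · have h1 := (SimplePoleAt.sum (s := Finset.Ico 1 m) fun l hl =>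
        (hres l hl).smul ((ω m)⁻¹ ^ (j * l))).sub (simplePoleAt_qInv.smul (c.μ j 0))
      rw [mul_one, Couplings.μ, sub_self] at h1
      exact h1.regularAt
  choose g hg hfk using exists_fk_expansion hL c
  have hbar : (fun k => -(c.μbar k • qInv)) = fun k => (-c.μbar k) • qInv :=
    funext fun k => (neg_smul _ _).symm
  rw [PrincipalPartsMatch, hbar] at hα
  obtain ⟨r, hr, hw⟩ := h.exists_ladder_sub hK hT hg hfk m 0 (zero_add m)
  rw [pow_zero, map_one, one_mul] at hw
  -- The errors in ℘^{(i)}, of order q^(m-i-2), and in the ladder of length m - 2 - i, of order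
  -- q^(i+2), exactly absorb the pole of the other factor.
  have hv : ∀ i : Fin (m - 1), ∃ r ∈ E, v ι P c i (m - 2 - i) =
      ((-1) ^ ((i : ℕ) + 2) * (Nat.factorial ((i : ℕ) + 1) : ℂ)) • (ι (qInv ^ ((i : ℕ) + 2)) *
        ladder ι P (fun k => (-c.μbar k) • qInv) (m - 2 - i)) + r := fun i => by
    set j := m - 2 - (i : ℕ)
    have hj : (i : ℕ) + 2 + j = m := by omega
    obtain ⟨g', hg', hP⟩ := exists_weierP_expansion (L := L) hL hj
    obtain ⟨r, hr, he⟩ := h.exists_ladder_sub hK hT hg hfk j (i + 2) hj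
    obtain ⟨r', hr', he'⟩ := h.exists_ladder_eq hK hT (fun k => -c.μbar k) j
    refine ⟨((-1) ^ ((i : ℕ) + 2) * (Nat.factorial ((i : ℕ) + 1) : ℂ)) • r + ι g' * r' +
      ι (qMer ^ m * g') * r, ?_, ?_⟩
    · rw [Algebra.smul_def]
      exact add_mem (add_mem (mul_mem (algebraMap_mem_of_coeff hK _) hr)
        (mul_mem (hK _ hg') hr')) (mul_mem (hK _ ((regularAt_qMer_pow m 0).mul hg')) hr)
    · have h1 : ι (qInv ^ ((i : ℕ) + 2)) * ι (qMer ^ ((i : ℕ) + 2)) = 1 := by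
        rw [← map_mul, ← mul_pow, qInv_mul_qMer, one_pow, map_one]
      have h2 : ι (qMer ^ j * g') * ι (qInv ^ j) = ι g' := by
        rw [← map_mul, mul_right_comm, ← mul_pow, qMer_mul_qInv, one_pow, one_mul]
      have h3 : ι (qMer ^ j * g') * ι (qMer ^ ((i : ℕ) + 2)) = ι (qMer ^ m * g') := by
        rw [← map_mul, mul_right_comm, ← pow_add, add_comm j, hj]
      rw [v, hP, he, map_add, map_smul, add_mul, smul_mul_assoc, mul_add, mul_add, smul_add,
        ← mul_assoc _ _ r, h1, one_mul, ← mul_assoc _ _ r, h3, he', ← mul_assoc _ _ r',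
        ← mul_assoc (ι (qMer ^ j * g')) _ r', h2]
      abel
  choose rv hrv hv using hv
  -- The polar parts of w_m and of the v-terms, weighted by the α_i, form the right side of the
  -- principal part relation; they are replaced by its left side.
  have hfinal : hamiltonian ι P c α = ladder ι P (fun k => c.μ k 0 • qInv) m +
      (r + ∑ i, α i • rv i) := by
    rw [hamiltonian, w, hw, hα, Finset.sum_congr rfl fun i _ => by rw [hv i]]
    simp only [smul_add, Finset.sum_add_distrib, smul_smul, mul_comm (α _)]
    abel
  rw [hfinal]
  refine add_mem hmodel (hE _ (add_mem hr (sum_mem fun i _ => ?_)))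
  rw [Algebra.smul_def]
  exact mul_mem (algebraMap_mem_of_coeff hK _) (hrv i)

/-- Unique coefficients allow the two local results to be intersected. An elliptic coefficient
regular at 0 is regular at all lattice points, so the intersection lies in 𝒪_U. -/
theorem IsMomentum.hamiltonian_mem (h : IsMomentum ι P ħ m)
    (hL : ∀ z ∈ L.lattice, ω m * z ∈ L.lattice) {U : Set ℂ} (hU : IsChart m L U) {b : ℕ → Mer}
    (hb : AdmissibleOn c U b) {α : Fin (m - 1) → ℂ} (hα : PrincipalPartsMatch ι P c α) :
    hamiltonian ι P c α ∈ dunklSpan ι P m (regularSubalgebra L U) b := by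
  have h1 := h.hamiltonian_mem_compl hL hU hb α
  by_cases h0 : (0 : ℂ) ∈ U
  · refine dunklSpan_mono ?_ (h.mem_dunklSpan_inf h1 (h.hamiltonian_mem_zero hL h0 hb hα))
    intro f hf
    obtain ⟨⟨hE, hf1⟩, hf2⟩ := Algebra.mem_inf.1 hf
    refine ⟨hE, fun x hx => ?_⟩
    by_cases hxL : x ∈ L.lattice
    · have := hE.regularAt_add hf2 hxL
      rwa [zero_add] at this
    · exact hf1 x ⟨hx, hxL⟩
  · refine dunklSpan_mono ?_ h1
    rintro f ⟨hE, hf1⟩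
    refine ⟨hE, fun x hx => hf1 x ⟨hx, fun hxL => h0 ?_⟩⟩
    have := hU.add_mem x hx (-x) (neg_mem hxL)
    rwa [add_neg_cancel] at this

theorem IsMomentum.exists_globalSections_eq_adjoin (h : IsMomentum ι P ħ m) (hm : 2 ≤ m)
    (hL : ∀ z ∈ L.lattice, ω m * z ∈ L.lattice) (c : Couplings m L) :
    ∃ α : Fin (m - 1) → ℂ, (∀ β : Fin (m - 1) → ℂ, PrincipalPartsMatch ι P c β ↔ β = α) ∧
      globalSections ι P c = (Algebra.adjoin ℂ {hamiltonian ι P c α} : Set R) := by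
  obtain ⟨α, hα⟩ := h.exists_principalPartsMatch hm hL c
  exact ⟨α, hα, h.globalSections_eq hL (h.smul_hamiltonian hL α) (h.hamiltonian_monic α)
    (fun _ _ hU hb => h.hamiltonian_mem hL hU hb ((hα α).2 rfl)) (exists_chart hL c)⟩

end Hamiltonian

end

end EllipticCherednik

theorem mainTheorem4 (m : ℕ) [NeZero m] (hm : m = 2 ∨ m = 3 ∨ m = 4 ∨ m = 6)
    (L : PeriodPair) (hL : ∀ z ∈ L.lattice, EllipticCherednik.ω m * z ∈ L.lattice)
    (c : EllipticCherednik.Couplings m L) :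
    (∀ ħ : ℂ, ħ ≠ 0 → ∃ α : Fin (m - 1) → ℂ,
      (∀ β : Fin (m - 1) → ℂ,
        EllipticCherednik.PrincipalPartsMatch EllipticCherednik.opCoeff
          (EllipticCherednik.opMomentum ħ) c β ↔ β = α) ∧
      EllipticCherednik.globalSections EllipticCherednik.opCoeff
          (EllipticCherednik.opMomentum ħ) c =
        (Algebra.adjoin ℂ {EllipticCherednik.hamiltonian EllipticCherednik.opCoeff
          (EllipticCherednik.opMomentum ħ) c α} : Set EllipticCherednik.diffOp)) ∧
    (∃ α : Fin (m - 1) → ℂ,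
      (∀ β : Fin (m - 1) → ℂ,
        EllipticCherednik.PrincipalPartsMatch EllipticCherednik.symCoeff
          EllipticCherednik.symMomentum c β ↔ β = α) ∧
      EllipticCherednik.globalSections EllipticCherednik.symCoeff
          EllipticCherednik.symMomentum c =
        (Algebra.adjoin ℂ {EllipticCherednik.hamiltonian EllipticCherednik.symCoeff
          EllipticCherednik.symMomentum c α} : Set EllipticCherednik.Sym)) := by
  have hm2 : 2 ≤ m := by omega
  exact ⟨fun ħ hħ => (EllipticCherednik.isMomentum_op hħ m).exists_globalSections_eq_adjoin hm2 hL c,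
    (EllipticCherednik.isMomentum_sym m).exists_globalSections_eq_adjoin hm2 hL c⟩
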